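/- Let $\mathcal G$ be a group-generator scheme: on input $1^\lambda$ and random coins $\omega$ it outputs in polynomial time a description of a cyclic group $\mathbb G$ of prime order $p$ with generator $g$, where $p$ and the encodings of group elements as bit strings have polynomially many bits, and multiplication and inversion in $\mathbb G$ are computable in polynomial time. Let $\sigma=\sigma(\lambda)$ be polynomially bounded and let $\mathtt H:\{0,1\}^*\to\{0,1\}^{\sigma}$ be a random oracle. "PPT" means nonuniform PPT throughout (randomized circuits of polynomial size, one for each $\lambda$, where sampling uniformly from $\mathbb Z_N$ is a basic operation). The protocol DQ-OT has four parties: a sender $S$ with input $(m_0,m_1)\in(\{0,1\}^{\sigma})^2$, a receiver $R$ with input $s\in\{0,1\}$, and two helpers $P_1,P_2$ without input. 1. $S$ runs $\mathcal G$, picks $a\leftarrow\mathbb Z_p$ uniformly and publishes $pk=(\mathbb G,p,g,C)$ with $C=g^a$. 2. $R$ picks a uniform bit $s_1$, sets $s_2=s\oplus s_1$, picks uniform $r_1,r_2\leftarrow\mathbb Z_p$, and sends $(s_i,r_i)$ to $P_i$ for $i=1,2$. 3. $P_2$ sets $\delta_{s_2}=g^{r_2}$, $\delta_{1-s_2}=C/g^{r_2}$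 and sends $(\delta_0,\delta_1)$ to $P_1$. 4. $P_1$ sets $\beta_{s_1}=\delta_0\cdot g^{r_1}$, $\beta_{1-s_1}=\delta_1/g^{r_1}$ and sends $(\beta_0,\beta_1)$ to $S$. 5. $S$ aborts if $C\ne\beta_0\beta_1$; otherwise it picks uniform $y_0,y_1\leftarrow\mathbb Z_p$ and sends $e_b=(g^{y_b},\mathtt H(\beta_b^{y_b})\oplus m_b)$, $b=0,1$, to $R$. 6. $R$ sets $x=r_2+r_1(-1)^{s_2}$ and outputs $\mathtt H\big((e_{s,0})^{x}\big)\oplus e_{s,1}$, where $e_s=(e_{s,0},e_{s,1})$. The view of a party consists of its input, its random coins and the messages it receives (for $S$ also its public key; for $R$ also its output). **Theorem.** If the discrete-logarithm (DL) and the computational Diffie–Hellman (CDH) assumptions hold for $\mathcal G$ against PPT algorithms, then, in the random-oracle model, DQ-OT securely computes the delegated-query 1-out-of-2 OT functionality $\big((m_0,m_1),\epsilon,\epsilon,s\big)\mapsto(\epsilon,\epsilon,\epsilon,m_s)$ (parties in the order $S,P_1,P_2,R$) in the presence of a semi-honest adversary that corrupts one party. That is, in every execution no party aborts, $R$ outputs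 $m_s$ and the other parties output $\epsilon$; and there are PPT simulators $\mathsf{Sim}_S,\mathsf{Sim}_{P_1},\mathsf{Sim}_{P_2},\mathsf{Sim}_R$ with access to $\mathtt H$ such that the ensembles, indexed by $\lambda,m_0,m_1,s$, $$\mathsf{Sim}_S\big((m_0,m_1),\epsilon\big),\qquad \mathsf{Sim}_{P_1}(\epsilon,\epsilon),\qquad \mathsf{Sim}_{P_2}(\epsilon,\epsilon),\qquad \mathsf{Sim}_R(s,m_s)$$ are computationally indistinguishable from the views of $S$, $P_1$, $P_2$ and $R$, respectively, in an execution of DQ-OT on these inputs: every PPT distinguisher with access to the same oracle $\mathtt H$ has an advantage of at most a negligible $\mu(\lambda)$, for all $m_0,m_1,s$. -/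

import Mathlib

open Filter

noncomputable section

/-! ### Bit strings, asymptotics -/

/-- Bit strings of length `n`. -/
abbrev Bits (n : ℕ) : Type := Fin n → Bool

/-- A bit string of fixed length as an element of `{0,1}^*`. -/
def str {n : ℕ} (x : Bits n) : List Bool := List.ofFn x

/-- Bitwise exclusive or. -/
def bxor {n : ℕ} (x y : Bits n) : Bits n := fun i => xor (x i) (y i)

/-- The `n` low-order binary digits of `N`, least significant first. -/
def natBits (n N : ℕ) : List Bool := List.ofFn fun i : Fin n => N.testBit i

/-- The number written, least significant digit first, in the first `n` bits of `x`
(missing bits count as `0`). -/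
def readNat (n : ℕ) (x : List Bool) : ℕ := Nat.ofBits fun i : Fin n => x.getD i false

def PolyBounded (f : ℕ → ℕ) : Prop := ∃ P : Polynomial ℕ, ∀ k, f k ≤ P.eval k

def Negligible (μ : ℕ → ℝ) : Prop :=
  Asymptotics.SuperpolynomialDecay atTop (fun k : ℕ => (k : ℝ)) μ

/-- The uniform distribution on `{0, …, N - 1}`, the representatives of `ℤ_N`
(and the constant `0` if `N = 0`). -/
def below (N : ℕ) : PMF ℕ :=
  if h : N = 0 then PMF.pure 0
  else PMF.uniformOfFinset (Finset.range N) (Finset.nonempty_range_iff.mpr h)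

/-! ### The random oracle -/

/-- Probabilistic computations with access to a random oracle `H : {0,1}^* → {0,1}^n`.
The state is the finite part of `H` that has been determined so far. -/
abbrev Rom (n : ℕ) : Type → Type := StateT (List Bool → Option (Bits n)) PMF

/-- The query `H(q)`: a fresh uniform answer for a new `q`, the old answer for a repeated one. -/
def hash {n : ℕ} (q : List Bool) : Rom n (Bits n) := fun t =>
  match t q with
  | some y => PMF.pure (y, t)
  | none => (PMF.uniformOfFintype (Bits n)).map fun y => (y, Function.update t q (some y))

/-- The distribution of the result of a computation that starts with a fresh random oracle. -/
def Rom.dist {n : ℕ} {α : Type} (X : Rom n α) : PMF α :=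
  (X.run fun _ => none).map Prod.fst

/-! ### Probabilistic oracle circuits -/

/-- Boolean circuits with sampling gates and oracle gates, built by sequential composition and by
pairing. -/
inductive Circ : Type
  /-- output the input bits at the listed positions (a missing bit is `0`) -/
  | wires (js : List ℕ)
  /-- output a constant bit -/
  | const (b : Bool)
  /-- output the negated conjunction of the first two input bits -/
  | nand
  /-- feed the output of the first circuit into the second one -/
  | seq (c d : Circ)
  /-- run both circuits on the same input and concatenate the outputs -/
  | pair (c d : Circ)
  /-- read a number `N` from the first `n` input bits and output the `n` digits of a uniform
  element of `{0, …, N - 1}` -/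
  | sample (n : ℕ)
  /-- send the whole input to the oracle and output the answer -/
  | query

namespace Circ

/-- The number of gates and wires. -/
def size : Circ → ℕ
  | wires js => js.length + 1
  | const _ => 1
  | nand => 1
  | seq c d => c.size + d.size + 1
  | pair c d => c.size + d.size + 1
  | sample n => n + 1
  | query => 1

/-- No oracle gates. -/
def OracleFree : Circ → Prop
  | seq c d => c.OracleFree ∧ d.OracleFree
  | pair c d => c.OracleFree ∧ d.OracleFree
  | query => False
  | _ => True

/-- No oracle gates and no sampling gates. -/
def IsDet : Circ → Prop
  | seq c d => c.IsDet ∧ d.IsDet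
  | pair c d => c.IsDet ∧ d.IsDet
  | sample _ => False
  | query => False
  | _ => True

def nandHead (x : List Bool) : Bool := !(x.getD 0 false && x.getD 1 false)

/-- The function computed by a deterministic circuit (only used for such circuits). -/
def eval : Circ → List Bool → List Bool
  | wires js, x => js.map fun j => x.getD j false
  | const b, _ => [b]
  | nand, x => [nandHead x]
  | seq c d, x => d.eval (c.eval x)
  | pair c d, x => c.eval x ++ d.eval x
  | sample _, _ => []
  | query, _ => []

/-- The execution of a circuit, relative to a random oracle with `n`-bit answers. -/
def run {n : ℕ} : Circ → List Bool → Rom n (List Bool)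
  | wires js, x => pure (js.map fun j => x.getD j false)
  | const b, _ => pure [b]
  | nand, x => pure [nandHead x]
  | seq c d, x => do
      let y ← c.run x
      d.run y
  | pair c d, x => do
      let y ← c.run x
      let z ← d.run x
      pure (y ++ z)
  | sample l, x => do
      let N ← (below (readNat l x) : PMF ℕ)
      pure (natBits l N)
  | query, x => do
      let y ← hash x
      pure (str y)

/-- The output distribution of a circuit that has no (useful) oracle. -/
def plain (c : Circ) (x : List Bool) : PMF (List Bool) := (c.run (n := 0) x).dist

end Circ

/-- Circuit families of polynomial size: nonuniform PPT algorithms, one circuit for each security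
parameter. -/
def PolySize (A : ℕ → Circ) : Prop := PolyBounded fun k => (A k).size

/-! ### Group generation, DL and CDH -/

/-- An output `(𝔾, p, g)` of a group generator: a cyclic group of prime order `p` with generator `g`,
a string `desc` that describes it, and the representation of its elements by bit strings. -/
structure GroupInstance (descLen ordLen elemLen : ℕ) where
  desc : Bits descLen
  Carrier : Type
  [group : CommGroup Carrier]
  p : ℕ
  prime : p.Prime
  lt : p < 2 ^ ordLen
  card : Nat.card Carrier = p
  g : Carrier
  generates : ∀ x : Carrier, x ∈ Subgroup.zpowers g
  enc : Carrier → Bits elemLen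
  enc_injective : Function.Injective enc

attribute [instance] GroupInstance.group

/-- The public string `(𝔾, p, g)`. -/
def GroupInstance.pub {l₁ l₂ l₃ : ℕ} (G : GroupInstance l₁ l₂ l₃) : List Bool :=
  str G.desc ++ natBits l₂ G.p ++ str (G.enc G.g)

/-- A group-generator scheme: for the security parameter `k` and the random coins `ω` it outputs
`(𝔾, p, g)`, in polynomial time; multiplication and inversion in the group can be computed in
polynomial time from the public string. -/
structure GroupGen where
  coinLen : ℕ → ℕ
  descLen : ℕ → ℕ
  ordLen : ℕ → ℕ
  elemLen : ℕ → ℕ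
  coinLen_poly : PolyBounded coinLen
  descLen_poly : PolyBounded descLen
  ordLen_poly : PolyBounded ordLen
  elemLen_poly : PolyBounded elemLen
  gen : ∀ k, Bits (coinLen k) → GroupInstance (descLen k) (ordLen k) (elemLen k)
  gen_poly : ∃ c : ℕ → Circ, PolySize c ∧ ∀ k, (c k).IsDet ∧
    ∀ ω, (c k).eval (str ω) = (gen k ω).pub
  mul_poly : ∃ c : ℕ → Circ, PolySize c ∧ ∀ k, (c k).IsDet ∧
    ∀ ω, ∀ x y : (gen k ω).Carrier,
      (c k).eval ((gen k ω).pub ++ str ((gen k ω).enc x) ++ str ((gen k ω).enc y)) =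
        str ((gen k ω).enc (x * y))
  inv_poly : ∃ c : ℕ → Circ, PolySize c ∧ ∀ k, (c k).IsDet ∧
    ∀ ω, ∀ x : (gen k ω).Carrier,
      (c k).eval ((gen k ω).pub ++ str ((gen k ω).enc x)) = str ((gen k ω).enc x⁻¹)

namespace GroupGen

variable (𝒢 : GroupGen)

/-- Random coins for the generator. -/
def coins (k : ℕ) : PMF (Bits (𝒢.coinLen k)) := PMF.uniformOfFintype _

/-- The discrete-logarithm game: `A` gets `(𝔾, p, g, g ^ a)` and wins if it outputs `a`. -/
def dlGame (A : Circ) (k : ℕ) : PMF Prop := do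
  let ω ← 𝒢.coins k
  let a ← below (𝒢.gen k ω).p
  let out ← A.plain ((𝒢.gen k ω).pub ++ str ((𝒢.gen k ω).enc ((𝒢.gen k ω).g ^ a)))
  pure (out = natBits (𝒢.ordLen k) a)

/-- The CDH game: `A` gets `(𝔾, p, g, g ^ a, g ^ b)` and wins if it outputs `g ^ (a * b)`. -/
def cdhGame (A : Circ) (k : ℕ) : PMF Prop := do
  let ω ← 𝒢.coins k
  let a ← below (𝒢.gen k ω).p
  let b ← below (𝒢.gen k ω).p
  let out ← A.plain ((𝒢.gen k ω).pub ++ str ((𝒢.gen k ω).enc ((𝒢.gen k ω).g ^ a)) ++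
    str ((𝒢.gen k ω).enc ((𝒢.gen k ω).g ^ b)))
  pure (out = str ((𝒢.gen k ω).enc ((𝒢.gen k ω).g ^ (a * b))))

/-- The DL assumption. -/
def DLHard : Prop :=
  ∀ A : ℕ → Circ, (∀ k, (A k).OracleFree) → PolySize A →
    Negligible fun k => (𝒢.dlGame (A k) k True).toReal

/-- The CDH assumption. -/
def CDHHard : Prop :=
  ∀ A : ℕ → Circ, (∀ k, (A k).OracleFree) → PolySize A →
    Negligible fun k => (𝒢.cdhGame (A k) k True).toReal

end GroupGen

/-! ### Secure computation of delegated-query OT -/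

/-- The sender, the two helpers and the receiver. -/
inductive Party
  | S | P1 | P2 | R

/-- The inputs `((m₀, m₁), ε, ε, s)`; the message `m_b` is `m b`. -/
def partyInput {n : ℕ} (m : Bool → Bits n) (s : Bool) : Party → List Bool
  | .S => str (m false) ++ str (m true)
  | .P1 => []
  | .P2 => []
  | .R => [s]

/-- The outputs `(ε, ε, ε, m_s)` of the delegated-query 1-out-of-2 OT functionality. -/
def dqotFunctionality {n : ℕ} (m : Bool → Bits n) (s : Bool) : Party → List Bool
  | .S => []
  | .P1 => []
  | .P2 => []
  | .R => str (m s)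

/-- The result of an execution of a four-party protocol: the views of the parties, and their
outputs (`none` if the party aborts or cannot compute an output). -/
structure Execution where
  view : Party → List Bool
  output : Party → Option (List Bool)

/-- A four-party protocol for the inputs of the functionality, in the random-oracle model. -/
abbrev FourPartyProtocol (σ : ℕ → ℕ) : Type :=
  ∀ k, (Bool → Bits (σ k)) → Bool → Rom (σ k) Execution

/-- The probability that the distinguisher `D` accepts a sample of `X`; the random oracle of `D` is
the one that was used to produce the sample. -/
def acceptProb {n : ℕ} (D : Circ) (X : Rom n (List Bool)) : ℝ :=
  ((X >>= fun v => D.run v).dist [true]).toReal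

/-- Computational indistinguishability (for nonuniform distinguishers with access to the random
oracle) of two ensembles indexed by the security parameter and all inputs. -/
def CompIndist {σ : ℕ → ℕ}
    (X Y : ∀ k, (Bool → Bits (σ k)) → Bool → Rom (σ k) (List Bool)) : Prop :=
  ∀ D : ℕ → Circ, PolySize D → ∃ μ : ℕ → ℝ, Negligible μ ∧
    ∀ k m s, |acceptProb (D k) (X k m s) - acceptProb (D k) (Y k m s)| ≤ μ k

/-- The protocol `Γ` securely computes delegated-query OT in the presence of one semi-honest
corrupted party: every execution gives every party its output, and the view of each party is
simulated, by a nonuniform PPT algorithm, from the party's own input and output. -/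
def SecurelyComputesDQOT {σ : ℕ → ℕ} (Γ : FourPartyProtocol σ) : Prop :=
  (∀ k m s, ∀ e ∈ (Γ k m s).dist.support, ∀ P, e.output P = some (dqotFunctionality m s P)) ∧
  ∀ P : Party, ∃ Sim : ℕ → Circ, PolySize Sim ∧
    CompIndist (fun k m s => (Sim k).run (partyInput m s P ++ dqotFunctionality m s P))
      (fun k m s => do
        let e ← Γ k m s
        pure (e.view P))

/-! ### The protocol DQ-OT -/

namespace DQOT

/-- XOR-based 2-out-of-2 secret sharing of a bit. -/
def share (s : Bool) : PMF (Bool × Bool) := do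
  let s₁ ← PMF.uniformOfFintype Bool
  pure (s₁, xor s₁ s)

section

variable {l₁ l₂ l₃ : ℕ} (G : GroupInstance l₁ l₂ l₃)

/-- Query generation of `P₂`: the pair `δ` with `δ_{s₂} = g ^ r₂` and `δ_{1-s₂} = C / g ^ r₂`. -/
def genQuery₂ (C : G.Carrier) (s₂ : Bool) (r₂ : ℕ) : Bool → G.Carrier := fun b =>
  if b = s₂ then G.g ^ r₂ else C / G.g ^ r₂

/-- Query generation of `P₁`: the pair `β` with `β_{s₁} = δ₀ * g ^ r₁` and
`β_{1-s₁} = δ₁ / g ^ r₁`. -/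
def genQuery₁ (δ : Bool → G.Carrier) (s₁ : Bool) (r₁ : ℕ) : Bool → G.Carrier := fun b =>
  if b = s₁ then δ false * G.g ^ r₁ else δ true / G.g ^ r₁

open Classical in
/-- Response generation of `S` with the coins `y₀ = y false`, `y₁ = y true`. -/
def genRes {n : ℕ} (m : Bool → Bits n) (C : G.Carrier) (β : Bool → G.Carrier) (y : Bool → ℕ) :
    Rom n (Option (Bool → G.Carrier × Bits n)) :=
  if β false * β true = C then do
    let h₀ ← hash (str (G.enc (β false ^ y false)))
    let h₁ ← hash (str (G.enc (β true ^ y true)))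
    pure (some fun b => (G.g ^ y b, bxor (if b then h₁ else h₀) (m b)))
  else pure none

/-- Message extraction of `R`. -/
def retrieve {n : ℕ} (res : Option (Bool → G.Carrier × Bits n)) (s s₂ : Bool) (r₁ r₂ : ℕ) :
    Rom n (Option (Bits n)) :=
  match res with
  | none => pure none
  | some e => do
      let x : ℤ := r₂ + r₁ * (-1) ^ s₂.toNat
      let h ← hash (str (G.enc ((e s).1 ^ x)))
      pure (some (bxor h (e s).2))

/-- A pair of group elements as a string. -/
def encPair (x : Bool → G.Carrier) : List Bool := str (G.enc (x false)) ++ str (G.enc (x true))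

/-- A response as a string. -/
def encRes {n : ℕ} : Option (Bool → G.Carrier × Bits n) → List Bool
  | none => []
  | some e => str (G.enc (e false).1) ++ str (e false).2 ++ str (G.enc (e true).1) ++ str (e true).2

/-- The protocol after the generation of `(𝔾, p, g)` by `S` with the coins `ω`. A view consists of
the party's input, its coins, the messages it gets (for `S`: with its own public key), and for `R`
also its output. -/
def exec {n c : ℕ} (ω : Bits c) (m : Bool → Bits n) (s : Bool) : Rom n Execution := do
  -- initialization by `S`: a random group element `C`
  let a ← (below G.p : PMF ℕ)
  let C := G.g ^ a
  let pk := G.pub ++ str (G.enc C)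
  -- delegation by `R`
  let (s₁, s₂) ← (share s : PMF (Bool × Bool))
  let r₁ ← (below G.p : PMF ℕ)
  let r₂ ← (below G.p : PMF ℕ)
  -- query generation by `P₂`, then by `P₁`
  let δ := genQuery₂ G C s₂ r₂
  let β := genQuery₁ G δ s₁ r₁
  -- response by `S`
  let y₀ ← (below G.p : PMF ℕ)
  let y₁ ← (below G.p : PMF ℕ)
  let res ← genRes G m C β (fun b => if b then y₁ else y₀)
  -- message extraction by `R`
  let out ← retrieve G res s s₂ r₁ r₂
  pure
    { view := fun
        | .S => partyInput m s .S ++ str ω ++ natBits l₂ a ++ natBits l₂ y₀ ++ natBits l₂ y₁ ++ pk ++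
            encPair G β
        | .P1 => pk ++ [s₁] ++ natBits l₂ r₁ ++ encPair G δ
        | .P2 => pk ++ [s₂] ++ natBits l₂ r₂
        | .R => [s] ++ [s₁, s₂] ++ natBits l₂ r₁ ++ natBits l₂ r₂ ++ pk ++ encRes G res ++
            (out.map str).getD []
      output := fun
        | .S => res.map fun _ => []
        | .P1 => some []
        | .P2 => some []
        | .R => out.map str }

end

/-- The protocol DQ-OT over the group generator `𝒢`, for messages of `σ k` bits. -/
def protocol (𝒢 : GroupGen) (σ : ℕ → ℕ) : FourPartyProtocol σ := fun k m s => do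
  let ω ← 𝒢.coins k
  exec (𝒢.gen k ω) ω m s

end DQOT

end

/-!
# Security of DQ-OT

Let `X = g ^ (r₂ ± r₁)` be the power of `g` whose exponent the receiver computes. The combined query
of the helpers consists of `X`, at the index `s`, and of `C / X` (`DQOT.genQuery_eq`). This gives the
correctness (`DQOT.exec_eq`, `DQOT.output_eq`): the receiver can compute `(g ^ y) ^ (r₂ ± r₁) = X ^ y`.

The views of the sender and of the helpers do not depend on the oracle and are simulated perfectly:
multiplication by a uniform power of `g` makes the component that the sender or the first helper sees
a uniform group element, and each of the shares `s₁`, `s₂` alone is a uniform bit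
(`DQOT.sender_law`, `DQOT.helper₁_law`, `DQOT.helper₂_law`). That the samplers are circuits of
polynomial size is expressed by `Feasible`, a calculus for families of circuits that compute given
distributions; exponentiation is done by square-and-multiply (`FeasibleFun.pow`).

The simulator of the receiver follows the protocol, but takes a uniform string for the encryption of
the message that the receiver must not learn. In an execution this message is masked by the answer of
the oracle to the query `q = (C / X) ^ y'`. A distinguisher notices the difference only by querying
`q` (`Rom.expect_uniform_le`). If it does so, a CDH adversary with the input `C = g ^ a`, `g ^ y'`
chooses the exponent of `X` itself, simulates the view and the distinguisher, guesses the position of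
`q` among the queries, and outputs `(C / X) ^ y' * X ^ y' = g ^ (a * y')`
(`DQOT.exists_adversary`). The adversary has no oracle, so it is needed that an oracle circuit can be
simulated by a circuit that samples the oracle lazily and keeps a table of the queries
(`Circ.exists_simulation`). The number of queries of a circuit and their lengths are known in advance,
hence so are the positions in the table, and guessing costs only a polynomial factor. The best
position, and the worst inputs of the parties, are nonuniform advice.
-/

noncomputable section

/-! ### Expectations -/

namespace PMF

variable {α β : Type}

/-- The expectation of a nonnegative function. -/
def expect (μ : PMF α) (φ : α → ENNReal) : ENNReal := ∑' a, μ a * φ a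

theorem expect_pure (a : α) (φ : α → ENNReal) : (PMF.pure a).expect φ = φ a := by
  unfold expect
  rw [tsum_eq_single a]
  · simp
  · intro b hb
    simp [PMF.pure_apply, hb]

theorem expect_bind (μ : PMF α) (f : α → PMF β) (φ : β → ENNReal) :
    (μ.bind f).expect φ = μ.expect fun a => (f a).expect φ := by
  unfold expect
  simp only [PMF.bind_apply, ← ENNReal.tsum_mul_right, ← ENNReal.tsum_mul_left]
  rw [ENNReal.tsum_comm]
  simp only [mul_assoc]

theorem expect_map (μ : PMF α) (f : α → β) (φ : β → ENNReal) :
    (μ.map f).expect φ = μ.expect fun a => φ (f a) := by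
  rw [← PMF.bind_pure_comp, expect_bind]
  simp only [Function.comp_apply, expect_pure]

theorem expect_mono {μ : PMF α} {φ ψ : α → ENNReal} (h : ∀ a ∈ μ.support, φ a ≤ ψ a) :
    μ.expect φ ≤ μ.expect ψ := by
  refine ENNReal.tsum_le_tsum fun a => ?_
  by_cases ha : a ∈ μ.support
  · exact mul_le_mul_right (h a ha) _
  · rw [PMF.mem_support_iff, not_not] at ha
    simp [ha]

theorem expect_add (μ : PMF α) (φ ψ : α → ENNReal) :
    (μ.expect fun a => φ a + ψ a) = μ.expect φ + μ.expect ψ := by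
  simp only [expect, mul_add, ENNReal.tsum_add]

theorem expect_const (μ : PMF α) (c : ENNReal) : (μ.expect fun _ => c) = c := by
  simp [expect, ENNReal.tsum_mul_right]

theorem expect_sum {ι : Type} (μ : PMF α) (s : Finset ι) (φ : ι → α → ENNReal) :
    (μ.expect fun a => ∑ i ∈ s, φ i a) = ∑ i ∈ s, μ.expect (φ i) := by
  classical
  induction s using Finset.induction_on with
  | empty => simp [expect]
  | insert i s hi ih => simp only [Finset.sum_insert hi, expect_add, ih]

open Classical in
theorem apply_eq_expect (μ : PMF α) (a : α) : μ a = μ.expect fun b => if b = a then 1 else 0 := by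
  simp [expect]

end PMF

/-! ### Computations with a random oracle -/

namespace Rom

variable {n : ℕ} {α β : Type}

theorem run_bind_eq (X : Rom n α) (f : α → Rom n β) (t : List Bool → Option (Bits n)) :
    (X >>= f).run t = (X.run t).bind fun p => (f p.1).run p.2 := rfl

theorem run_lift (μ : PMF α) (t : List Bool → Option (Bits n)) :
    (liftM μ : Rom n α).run t = μ.bind fun a => PMF.pure (a, t) := rfl

theorem run_pure_eq (a : α) (t : List Bool → Option (Bits n)) :
    (pure a : Rom n α).run t = PMF.pure (a, t) := rfl

theorem lift_pure (a : α) : (liftM (PMF.pure a) : Rom n α) = pure a := by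
  funext t
  exact PMF.pure_bind a _

theorem lift_bind (μ : PMF α) (f : α → PMF β) :
    (liftM (μ.bind f) : Rom n β) = liftM μ >>= fun a => liftM (f a) := by
  funext t
  change StateT.run _ t = StateT.run _ t
  simp only [run_bind_eq, run_lift, PMF.bind_bind, PMF.pure_bind]

/-- The computations that access the table of the oracle through queries only. The state monad
would also allow a computation to read or to change the table directly. -/
inductive IsOracleComp {n : ℕ} : {α : Type} → Rom n α → Prop
  | ret {α : Type} (a : α) : IsOracleComp (pure a)
  | lift {α : Type} (μ : PMF α) : IsOracleComp (liftM μ)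
  | query (q : List Bool) : IsOracleComp (hash q)
  | bind {α β : Type} {X : Rom n α} {f : α → Rom n β} :
      IsOracleComp X → (∀ a, IsOracleComp (f a)) → IsOracleComp (X >>= f)

theorem hash_run_of_some {t : List Bool → Option (Bits n)} {q : List Bool} {y : Bits n}
    (h : t q = some y) : (hash q : Rom n _).run t = PMF.pure (y, t) := by
  change (match t q with | some y => _ | none => _) = _
  rw [h]

theorem hash_run_of_none {t : List Bool → Option (Bits n)} {q : List Bool} (h : t q = none) :
    (hash q : Rom n _).run t =
      (PMF.uniformOfFintype (Bits n)).bind fun y => PMF.pure (y, Function.update t q (some y)) := by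
  change (match t q with | some y => _ | none => _) = _
  rw [h]
  rfl

theorem hash_hash (q : List Bool) (K : Bits n → Bits n → Rom n α) :
    (do let y ← hash q; let z ← hash q; K y z) = (do let y ← hash q; K y y) := by
  funext t
  change StateT.run _ t = StateT.run _ t
  simp only [run_bind_eq]
  cases h : t q with
  | some y => simp only [hash_run_of_some h, PMF.pure_bind]
  | none =>
    rw [hash_run_of_none h]
    simp only [PMF.bind_bind, PMF.pure_bind]
    congr 1
    funext y
    rw [hash_run_of_some (Function.update_self q _ t), PMF.pure_bind]

theorem hash_comm_hash (q r : List Bool) (K : Bits n → Bits n → Rom n α) :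
    (do let y ← hash q; let z ← hash r; K y z) = (do let z ← hash r; let y ← hash q; K y z) := by
  by_cases hqr : q = r
  · subst hqr
    rw [hash_hash, hash_hash]
  funext t
  change StateT.run _ t = StateT.run _ t
  simp only [run_bind_eq]
  have hr (v) : Function.update t q v r = t r := Function.update_of_ne (Ne.symm hqr) _ _
  have hq (v) : Function.update t r v q = t q := Function.update_of_ne hqr _ _
  cases h : t q with
  | some y =>
    cases h' : t r with
    | some z => simp only [hash_run_of_some h, hash_run_of_some h', PMF.pure_bind]
    | none =>
      simp only [hash_run_of_some h, hash_run_of_none h', PMF.pure_bind, PMF.bind_bind]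
      congr 1
      funext z
      rw [hash_run_of_some ((hq _).trans h), PMF.pure_bind]
  | none =>
    cases h' : t r with
    | some z =>
      simp only [hash_run_of_none h, hash_run_of_some h', PMF.pure_bind, PMF.bind_bind]
      congr 1
      funext z
      rw [hash_run_of_some ((hr _).trans h'), PMF.pure_bind]
    | none =>
      simp only [hash_run_of_none h, hash_run_of_none h', PMF.pure_bind, PMF.bind_bind]
      simp only [hash_run_of_none ((hq _).trans h), hash_run_of_none ((hr _).trans h'),
        PMF.pure_bind, PMF.bind_bind]
      rw [PMF.bind_comm]
      simp only [Function.update_comm hqr]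

theorem lift_comm_lift {γ : Type} (μ : PMF α) (ν : PMF β) (K : α → β → Rom n γ) :
    (do let x ← (liftM μ : Rom n α); let y ← (liftM ν : Rom n β); K x y) =
      (do let y ← (liftM ν : Rom n β); let x ← (liftM μ : Rom n α); K x y) := by
  funext t
  change StateT.run _ t = StateT.run _ t
  simp only [run_bind_eq, run_lift, PMF.bind_bind, PMF.pure_bind]
  rw [PMF.bind_comm]

/-- Queries can be made earlier or later than they are made. -/
theorem IsOracleComp.hash_comm {X : Rom n α} (hX : IsOracleComp X) (q : List Bool)
    {γ : Type} (K : Bits n → α → Rom n γ) :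
    (do let y ← hash q; let x ← X; K y x) = (do let x ← X; let y ← hash q; K y x) := by
  induction hX with
  | ret a => simp only [LawfulMonad.pure_bind]
  | lift μ =>
    funext t
    change StateT.run _ t = StateT.run _ t
    simp only [run_bind_eq, run_lift]
    cases h : t q with
    | some y => simp only [hash_run_of_some h, PMF.pure_bind, PMF.bind_bind]
    | none =>
      simp only [hash_run_of_none h, PMF.pure_bind, PMF.bind_bind]
      rw [PMF.bind_comm]
  | query r => exact hash_comm_hash q r K
  | bind _ _ ihX ihf =>
    simp only [bind_assoc]
    rw [ihX]
    congr 1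
    funext a
    exact ihf a _

theorem dist_bind (X : Rom n α) (f : α → Rom n β) :
    (X >>= f).dist = (X.run fun _ => none).bind fun p => ((f p.1).run p.2).map Prod.fst := by
  rw [Rom.dist, run_bind_eq, PMF.map_bind]

theorem dist_lift_bind (μ : PMF α) (f : α → Rom n β) :
    ((liftM μ : Rom n α) >>= f).dist = μ.bind fun a => (f a).dist := by
  rw [dist_bind, run_lift]
  simp only [PMF.bind_bind, PMF.pure_bind]
  rfl

theorem dist_bind_hash_const (X : Rom n α) (q : List Bool) :
    (do let x ← X; let _ ← hash q; pure x : Rom n α).dist = X.dist := by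
  rw [dist_bind, Rom.dist, ← PMF.bind_pure_comp]
  congr 1
  funext p
  rw [run_bind_eq, PMF.map_bind]
  simp only [run_pure_eq, PMF.pure_map, PMF.bind_const]
  rfl

/-- The answer to a query that is not used does not have to be determined. -/
theorem IsOracleComp.dist_hash_bind {X : Rom n α} (hX : IsOracleComp X) (q : List Bool) :
    (hash q >>= fun _ => X).dist = X.dist := by
  rw [← dist_bind_hash_const X q, ← hX.hash_comm q fun _ x => pure x]
  simp only [bind_pure]

/-- Answers of the oracle that have been determined do not change. -/
theorem IsOracleComp.run_extends {X : Rom n α} (hX : IsOracleComp X)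
    {t : List Bool → Option (Bits n)} {o : α × (List Bool → Option (Bits n))}
    (ho : o ∈ (X.run t).support) {q : List Bool} {y : Bits n} (h : t q = some y) :
    o.2 q = some y := by
  induction hX generalizing t with
  | ret a =>
    rw [run_pure_eq, PMF.mem_support_pure_iff] at ho
    rwa [ho]
  | lift μ =>
    simp only [run_lift, PMF.mem_support_bind_iff, PMF.mem_support_pure_iff] at ho
    obtain ⟨a, -, rfl⟩ := ho
    exact h
  | query r =>
    cases hr : t r with
    | some z =>
      rw [hash_run_of_some hr, PMF.mem_support_pure_iff] at ho
      rwa [ho]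
    | none =>
      simp only [hash_run_of_none hr, PMF.mem_support_bind_iff, PMF.mem_support_pure_iff] at ho
      obtain ⟨z, -, rfl⟩ := ho
      have : q ≠ r := by
        rintro rfl
        simp [h] at hr
      simp only [Function.update_of_ne this, h]
  | bind _ _ ihX ihf =>
    rw [run_bind_eq, PMF.mem_support_bind_iff] at ho
    obtain ⟨p, hp, ho⟩ := ho
    exact ihf _ ho (ihX hp h)

open Classical in
/-- Programming the oracle at `q` has no effect on the executions that do not query `q`: the
executions from `t` that end with `q` undetermined are among those from the programmed table. -/
theorem IsOracleComp.expect_le_programmed {X : Rom n α} (hX : IsOracleComp X)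
    {t : List Bool → Option (Bits n)} {q : List Bool} (ht : t q = none) (y : Bits n)
    (φ : α × (List Bool → Option (Bits n)) → ENNReal) (hφ : ∀ o, o.2 q ≠ none → φ o = 0) :
    (X.run t).expect φ ≤ (X.run (Function.update t q (some y))).expect fun o =>
      if o.2 q = some y then φ (o.1, Function.update o.2 q none) else 0 := by
  have restore : Function.update (Function.update t q (some y)) q none = t := by
    rw [Function.update_idem, ← ht, Function.update_eq_self]
  induction hX generalizing t with
  | ret a =>
    simp only [run_pure_eq, PMF.expect_pure, Function.update_self, if_true, restore, le_refl]
  | lift μ =>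
    simp only [run_lift, PMF.expect_bind, PMF.expect_pure, Function.update_self, if_true, restore,
      le_refl]
  | query r =>
    by_cases hqr : q = r
    -- the query determines `q`, so that `φ` vanishes on every outcome
    · subst hqr
      rw [hash_run_of_none ht, PMF.expect_bind]
      refine (PMF.expect_mono (ψ := fun _ => 0) fun z _ => ?_).trans ?_
      · rw [PMF.expect_pure, hφ]
        simp
      · simp [PMF.expect]
    have hne (v) : Function.update t q v r = t r := Function.update_of_ne (Ne.symm hqr) _ _
    cases hr : t r with
    | some z =>
      rw [hash_run_of_some hr, hash_run_of_some ((hne _).trans hr)]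
      simp only [PMF.expect_pure, Function.update_self, if_true, restore, le_refl]
    | none =>
      rw [hash_run_of_none hr, hash_run_of_none ((hne _).trans hr)]
      simp only [PMF.expect_bind, PMF.expect_pure]
      refine PMF.expect_mono fun z _ => ?_
      rw [if_pos (by simp [Function.update_of_ne hqr])]
      rw [Function.update_comm hqr, Function.update_idem, Function.update_comm (Ne.symm hqr),
        ← ht, Function.update_eq_self]
  | @bind α β X f hX hf ihX ihf =>
    simp only [run_bind_eq, PMF.expect_bind]
    refine (ihX ht (fun p => ((f p.1).run p.2).expect φ) ?_ restore).trans ?_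
    -- once `q` is determined it remains so, and then `φ` vanishes
    · intro o ho
      refine le_antisymm ((PMF.expect_mono (ψ := fun _ => 0) fun o' ho' => ?_).trans ?_) zero_le
      · obtain ⟨z, hz⟩ := Option.ne_none_iff_exists'.mp ho
        rw [hφ o' (by simp [(hf _).run_extends ho' hz])]
      · simp [PMF.expect]
    · refine PMF.expect_mono fun p _ => ?_
      split_ifs with hp
      · refine (ihf p.1 (t := Function.update p.2 q none) (by simp) φ hφ (by simp)).trans ?_
        rw [Function.update_idem, ← hp, Function.update_eq_self]
      · exact zero_le

end Rom

/-! ### Circuits without oracle gates -/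

namespace Circ

/-- The output distribution of a circuit without oracle gates (oracle gates output nothing). -/
def law : Circ → List Bool → PMF (List Bool)
  | wires js, x => PMF.pure (js.map fun j => x.getD j false)
  | const b, _ => PMF.pure [b]
  | nand, x => PMF.pure [nandHead x]
  | seq c d, x => (c.law x).bind d.law
  | pair c d, x => (c.law x).bind fun y => (d.law x).bind fun z => PMF.pure (y ++ z)
  | sample l, x => (below (readNat l x)).map (natBits l)
  | query, _ => PMF.pure []

theorem run_eq_law {n : ℕ} (c : Circ) (hc : c.OracleFree) (x : List Bool) :
    (c.run x : Rom n (List Bool)) = liftM (c.law x) := by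
  induction c generalizing x with
  | wires js => exact (Rom.lift_pure _).symm
  | const b => exact (Rom.lift_pure _).symm
  | nand => exact (Rom.lift_pure _).symm
  | seq c d ihc ihd =>
    rw [run, law, ihc hc.1, Rom.lift_bind]
    congr 1
    funext y
    exact ihd hc.2 y
  | pair c d ihc ihd =>
    simp only [run, law, ihc hc.1, ihd hc.2, Rom.lift_bind, Rom.lift_pure]
  | sample l =>
    rw [run, law, ← PMF.bind_pure_comp, Rom.lift_bind]
    simp only [Function.comp_apply, Rom.lift_pure]
  | query => exact hc.elim

theorem plain_eq_law (c : Circ) (hc : c.OracleFree) (x : List Bool) : c.plain x = c.law x := by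
  rw [plain, run_eq_law c hc, Rom.dist, Rom.run_lift, PMF.map_bind]
  simp only [PMF.pure_map]
  exact PMF.bind_pure _

theorem IsDet.oracleFree {c : Circ} (hc : c.IsDet) : c.OracleFree := by
  induction c with
  | seq c d ihc ihd => exact ⟨ihc hc.1, ihd hc.2⟩
  | pair c d ihc ihd => exact ⟨ihc hc.1, ihd hc.2⟩
  | query => exact hc
  | _ => trivial

theorem IsDet.law_eq {c : Circ} (hc : c.IsDet) (x : List Bool) : c.law x = PMF.pure (c.eval x) := by
  induction c generalizing x with
  | seq c d ihc ihd => rw [law, ihc hc.1, PMF.pure_bind, ihd hc.2, eval]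
  | pair c d ihc ihd => simp only [law, ihc hc.1, PMF.pure_bind, ihd hc.2, eval]
  | sample l => exact hc.elim
  | query => exact hc.elim
  | _ => rfl

theorem isOracleComp_run {n : ℕ} (c : Circ) (x : List Bool) :
    Rom.IsOracleComp (c.run x : Rom n (List Bool)) := by
  induction c generalizing x with
  | seq c d ihc ihd => exact .bind (ihc x) fun y => ihd y
  | pair c d ihc ihd => exact .bind (ihc x) fun y => .bind (ihd x) fun z => .ret _
  | sample l => exact .bind (.lift _) fun _ => .ret _
  | query => exact .bind (.query _) fun _ => .ret _
  | _ => exact .ret _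

/-- Run all circuits on the same input and concatenate the outputs. -/
def concat : List Circ → Circ
  | [] => wires []
  | c :: cs => pair c (concat cs)

theorem concat_isDet {cs : List Circ} (h : ∀ c ∈ cs, c.IsDet) : (concat cs).IsDet := by
  induction cs with
  | nil => trivial
  | cons c cs ih => exact ⟨h c (by simp), ih fun d hd => h d (by simp [hd])⟩

theorem eval_concat (cs : List Circ) (x : List Bool) :
    (concat cs).eval x = cs.flatMap fun c => c.eval x := by
  induction cs with
  | nil => rfl
  | cons c cs ih => rw [concat, eval, ih, List.flatMap_cons]

theorem size_concat_le {cs : List Circ} {s : ℕ} (h : ∀ c ∈ cs, c.size ≤ s) :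
    (concat cs).size ≤ cs.length * (s + 1) + 1 := by
  induction cs with
  | nil => simp [concat, size]
  | cons c cs ih =>
    have h₁ := h c (by simp)
    have h₂ := ih fun d hd => h d (by simp [hd])
    simp only [concat, size, List.length_cons]
    nlinarith

end Circ

theorem map_getD_range' (x : List Bool) (a l : ℕ) (h : a + l ≤ x.length) :
    ((List.range' a l).map fun j => x.getD j false) = (x.drop a).take l := by
  apply List.ext_getElem
  · simp; omega
  · intro i h₁ h₂
    have : i < l := by simpa using h₁
    simp [List.getD_eq_getElem?_getD, show a + i < x.length by omega]

/-! ### Functions computed by circuit families of polynomial size -/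

section Feasible

/-- `f` is bounded by a polynomial in `w`. -/
def PolyIn {ι : Type} (w f : ι → ℕ) : Prop := ∃ P : Polynomial ℕ, ∀ i, f i ≤ P.eval (w i)

theorem eval_monotone (P : Polynomial ℕ) : Monotone fun k => P.eval k := by
  intro a b hab
  simp only [Polynomial.eval_eq_sum, Polynomial.sum]
  exact Finset.sum_le_sum fun i _ => Nat.mul_le_mul_left _ (Nat.pow_le_pow_left hab i)

namespace PolyIn

variable {ι : Type} {w f g : ι → ℕ}

theorem const (c : ℕ) : PolyIn w fun _ => c := ⟨.C c, fun i => by simp⟩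

theorem weight : PolyIn w w := ⟨.X, fun i => by simp⟩

theorem add (hf : PolyIn w f) (hg : PolyIn w g) : PolyIn w fun i => f i + g i := by
  obtain ⟨P, hP⟩ := hf
  obtain ⟨Q, hQ⟩ := hg
  exact ⟨P + Q, fun i => by simpa using add_le_add (hP i) (hQ i)⟩

theorem mul (hf : PolyIn w f) (hg : PolyIn w g) : PolyIn w fun i => f i * g i := by
  obtain ⟨P, hP⟩ := hf
  obtain ⟨Q, hQ⟩ := hg
  exact ⟨P * Q, fun i => by simpa using Nat.mul_le_mul (hP i) (hQ i)⟩

theorem mono (hg : PolyIn w g) (h : ∀ i, f i ≤ g i) : PolyIn w f := by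
  obtain ⟨P, hP⟩ := hg
  exact ⟨P, fun i => (h i).trans (hP i)⟩

theorem trans (hf : PolyIn g f) (hg : PolyIn w g) : PolyIn w f := by
  obtain ⟨P, hP⟩ := hf
  obtain ⟨Q, hQ⟩ := hg
  exact ⟨P.comp Q, fun i => (hP i).trans (by simpa using eval_monotone P (hQ i))⟩

end PolyIn

variable {ι : Type} (w : ι → ℕ) {X Y : ι → Type}

/-- `F` is computed, on the inputs encoded by `e`, by a family of randomized circuits without oracle
whose size is polynomial in `w`. The index may contain nonuniform advice: the polynomial depends on
neither the index nor the input. -/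
def Feasible (e : ∀ i, X i → List Bool) (F : ∀ i, X i → PMF (List Bool)) : Prop :=
  ∃ c : ι → Circ, PolyIn w (fun i => (c i).size) ∧
    ∀ i, (c i).OracleFree ∧ ∀ x, (c i).law (e i x) = F i x

/-- `Feasible` for a function without randomness. -/
def FeasibleFun (e f : ∀ i, X i → List Bool) : Prop := Feasible w e fun i x => PMF.pure (f i x)

/-- The encoding `e` has a length that depends on the index only and is polynomial in `w`. -/
def FixedLength (e : ∀ i, X i → List Bool) : Prop :=
  ∃ l : ι → ℕ, PolyIn w l ∧ ∀ i x, (e i x).length = l i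

variable {w} {e : ∀ i, X i → List Bool}

theorem FixedLength.append {e' : ∀ i, Y i → List Bool} (h : FixedLength w e)
    (h' : FixedLength w e') :
    FixedLength w (X := fun i => X i × Y i) fun i p => e i p.1 ++ e' i p.2 := by
  obtain ⟨l, hl, h⟩ := h
  obtain ⟨l', hl', h'⟩ := h'
  exact ⟨_, hl.add hl', fun i p => by simp [h, h']⟩

theorem FixedLength.comap {Z : ι → Type} (h : FixedLength w e) (g : ∀ i, Z i → X i) :
    FixedLength w fun i z => e i (g i z) := by
  obtain ⟨l, hl, h⟩ := h
  exact ⟨l, hl, fun i z => h i _⟩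

theorem fixedLength_str {n : ι → ℕ} (hn : PolyIn w n) :
    FixedLength w (X := fun i => Bits (n i)) fun _ x => str x :=
  ⟨n, hn, fun _ _ => by simp [str]⟩

theorem fixedLength_natBits {n : ι → ℕ} (hn : PolyIn w n) :
    FixedLength w (X := fun _ => ℕ) fun i N => natBits (n i) N :=
  ⟨n, hn, fun i x => by simp [natBits]⟩

theorem fixedLength_bit : FixedLength w (X := fun _ => Bool) fun _ b => [b] :=
  ⟨_, .const 1, fun _ _ => rfl⟩

theorem FeasibleFun.of_eval {f : ∀ i, X i → List Bool} (c : ι → Circ)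
    (hc : PolyIn w fun i => (c i).size) (hd : ∀ i, (c i).IsDet)
    (h : ∀ i x, (c i).eval (e i x) = f i x) : FeasibleFun w e f :=
  ⟨c, hc, fun i => ⟨(hd i).oracleFree, fun x => by rw [(hd i).law_eq, h]⟩⟩

theorem Feasible.congr {F F' : ∀ i, X i → PMF (List Bool)} (h : Feasible w e F)
    (hF : ∀ i x, F i x = F' i x) : Feasible w e F' := by
  obtain rfl : F = F' := funext fun i => funext (hF i)
  exact h

theorem FeasibleFun.congr {f f' : ∀ i, X i → List Bool} (h : FeasibleFun w e f)
    (hf : ∀ i x, f i x = f' i x) : FeasibleFun w e f' :=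
  Feasible.congr h fun i x => by rw [hf i x]

theorem Feasible.append {F G : ∀ i, X i → PMF (List Bool)} (hF : Feasible w e F)
    (hG : Feasible w e G) :
    Feasible w e fun i x => (F i x).bind fun y => (G i x).bind fun z => PMF.pure (y ++ z) := by
  obtain ⟨c, hc, hF⟩ := hF
  obtain ⟨d, hd, hG⟩ := hG
  refine ⟨fun i => .pair (c i) (d i), (hc.add hd).add (.const 1), fun i =>
    ⟨⟨(hF i).1, (hG i).1⟩, fun x => ?_⟩⟩
  simp only [Circ.law, (hF i).2, (hG i).2]

theorem FeasibleFun.append {f g : ∀ i, X i → List Bool} (hf : FeasibleFun w e f)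
    (hg : FeasibleFun w e g) : FeasibleFun w e fun i x => f i x ++ g i x :=
  (Feasible.append hf hg).congr fun i x => by simp only [PMF.pure_bind]

/-- Composition: a sample of `f`, encoded by `e'`, is the input of the second computation. -/
theorem Feasible.comp {f : ∀ i, X i → PMF (Y i)} {e' : ∀ i, Y i → List Bool}
    {G : ∀ i, Y i → PMF (List Bool)} (hG : Feasible w e' G)
    (hf : Feasible w e fun i x => (f i x).map (e' i)) :
    Feasible w e fun i x => (f i x).bind (G i) := by
  obtain ⟨c, hc, hf⟩ := hf
  obtain ⟨d, hd, hG⟩ := hG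
  refine ⟨fun i => .seq (c i) (d i), (hc.add hd).add (.const 1), fun i =>
    ⟨⟨(hf i).1, (hG i).1⟩, fun x => ?_⟩⟩
  simp only [Circ.law, (hf i).2, PMF.bind_map]
  congr 1
  funext y
  exact (hG i).2 y

theorem Feasible.comp_fun {f : ∀ i, X i → Y i} {e' : ∀ i, Y i → List Bool}
    {G : ∀ i, Y i → PMF (List Bool)} (hG : Feasible w e' G)
    (hf : FeasibleFun w e fun i x => e' i (f i x)) : Feasible w e fun i x => G i (f i x) :=
  (hG.comp (f := fun i x => PMF.pure (f i x))
    (Feasible.congr hf fun i x => by rw [PMF.pure_map])).congr fun i x => PMF.pure_bind _ _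

theorem FeasibleFun.comp {f : ∀ i, X i → Y i} {e' g : ∀ i, Y i → List Bool}
    (hg : FeasibleFun w e' g) (hf : FeasibleFun w e fun i x => e' i (f i x)) :
    FeasibleFun w e fun i x => g i (f i x) :=
  Feasible.comp_fun (G := fun i y => PMF.pure (g i y)) hg hf

theorem FeasibleFun.eval {f : ∀ i, X i → List Bool} (hf : FeasibleFun w e f) (c : ι → Circ)
    (hc : PolyIn w fun i => (c i).size) (hd : ∀ i, (c i).IsDet) :
    FeasibleFun w e fun i x => (c i).eval (f i x) :=
  FeasibleFun.comp (e' := fun _ y => y) (FeasibleFun.of_eval c hc hd fun _ _ => rfl) hf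

theorem FeasibleFun.wires (js : ι → List ℕ) (hjs : PolyIn w fun i => (js i).length) :
    FeasibleFun w e fun i x => (js i).map fun j => (e i x).getD j false :=
  .of_eval (fun i => .wires (js i)) (hjs.add (.const 1)) (fun _ => trivial) fun _ _ => rfl

/-- A part of the input at a fixed position can be read off. -/
theorem FeasibleFun.slice {f : ∀ i, X i → List Bool} (hf : FixedLength w f) (a : ι → ℕ)
    (h : ∀ i x, ∃ s t, e i x = s ++ f i x ++ t ∧ s.length = a i) : FeasibleFun w e f := by
  obtain ⟨l, hl, hf⟩ := hf
  refine (FeasibleFun.wires (fun i => List.range' (a i) (l i)) (by simpa using hl)).congr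
    fun i x => ?_
  obtain ⟨s, t, he, hs⟩ := h i x
  rw [map_getD_range', he, ← hs, ← hf i x, List.append_assoc, List.drop_left, List.take_left]
  rw [he, ← hs, ← hf i x]
  simp

theorem FeasibleFun.input (he : FixedLength w e) : FeasibleFun w e e :=
  .slice he (fun _ => 0) fun i x => ⟨[], [], by simp, rfl⟩

theorem FeasibleFun.const (b : ι → List Bool) (hb : PolyIn w fun i => (b i).length) :
    FeasibleFun w e fun i _ => b i := by
  refine .of_eval (fun i => .concat ((b i).map Circ.const)) ?_ (fun i => ?_) fun i x => ?_
  · refine ((hb.mul (.const 2)).add (.const 1)).mono fun i => ?_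
    refine (Circ.size_concat_le (s := 1) fun c hc => ?_).trans (by simp)
    obtain ⟨b, -, rfl⟩ := List.mem_map.mp hc
    exact le_rfl
  · refine Circ.concat_isDet fun c hc => ?_
    obtain ⟨b, -, rfl⟩ := List.mem_map.mp hc
    trivial
  · rw [Circ.eval_concat]
    induction b i with
    | nil => rfl
    | cons b l ih => simpa [Circ.eval] using ih

section Product

variable {enc : ∀ i, Y i → List Bool}

theorem FeasibleFun.fst {f : ∀ i, X i → List Bool} (he : FixedLength w e) (hf : FeasibleFun w e f) :
    FeasibleFun w (X := fun i => X i × Y i) (fun i p => e i p.1 ++ enc i p.2)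
      fun i p => f i p.1 := by
  refine FeasibleFun.comp (f := fun i (p : X i × Y i) => p.1) hf ?_
  obtain ⟨l, hl, h⟩ := he
  exact .slice ⟨l, hl, fun i p => h i p.1⟩ (fun _ => 0) fun i p => ⟨[], enc i p.2, by simp, rfl⟩

theorem FeasibleFun.snd (he : FixedLength w e) (henc : FixedLength w enc) :
    FeasibleFun w (X := fun i => X i × Y i) (fun i p => e i p.1 ++ enc i p.2)
      fun i p => enc i p.2 := by
  obtain ⟨l, hl, h⟩ := he
  obtain ⟨l', hl', h'⟩ := henc
  exact .slice ⟨l', hl', fun i p => h' i p.2⟩ l fun i p => ⟨e i p.1, [], by simp, h i p.1⟩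

/-- Sampling a value and continuing with the input extended by it. -/
theorem Feasible.bind {f : ∀ i, X i → PMF (Y i)} {G : ∀ i, X i → Y i → PMF (List Bool)}
    (he : FixedLength w e) (hf : Feasible w e fun i x => (f i x).map (enc i))
    (hG : Feasible w (X := fun i => X i × Y i) (fun i p => e i p.1 ++ enc i p.2)
      fun i p => G i p.1 p.2) :
    Feasible w e fun i x => (f i x).bind (G i x) := by
  refine (hG.comp (f := fun i x => (f i x).map (Prod.mk x)) ?_).congr fun i x => ?_
  · refine (Feasible.append (FeasibleFun.input he) hf).congr fun i x => ?_
    rw [PMF.pure_bind, PMF.bind_map, PMF.map_comp]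
    rfl
  · rw [PMF.bind_map]
    rfl

end Product

/-- A polynomial number of iterations. -/
theorem FeasibleFun.iterate {f : ∀ i, X i → X i} (he : FixedLength w e)
    (hf : FeasibleFun w e fun i x => e i (f i x)) {N : ι → ℕ} (hN : PolyIn w N) :
    FeasibleFun w e fun i x => e i ((f i)^[N i] x) := by
  obtain ⟨c, hc, hf⟩ := hf
  obtain ⟨d, hd, hi⟩ := FeasibleFun.input he
  refine ⟨fun i => (Circ.seq (c i))^[N i] (d i),
    (hd.add (hN.mul (hc.add (.const 1)))).mono fun i => ?_, fun i => ⟨?_, ?_⟩⟩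
  · change ((c i).seq^[N i] (d i)).size ≤ _
    generalize N i = m
    induction m with
    | zero => simp
    | succ m ih =>
      rw [Function.iterate_succ_apply']
      simp only [Circ.size]
      nlinarith
  · change ((c i).seq^[N i] (d i)).OracleFree
    generalize N i = m
    induction m with
    | zero => exact (hi i).1
    | succ m ih =>
      rw [Function.iterate_succ_apply']
      exact ⟨(hf i).1, ih⟩
  · change ∀ x, ((c i).seq^[N i] (d i)).law (e i x) = PMF.pure (e i ((f i)^[N i] x))
    generalize N i = m
    induction m with
    | zero => exact (hi i).2
    | succ m ih =>
      intro x
      rw [Function.iterate_succ_apply', Function.iterate_succ_apply, Circ.law, (hf i).2,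
        PMF.pure_bind, ih]

/-! ### Boolean operations -/

/-- The bitwise negated conjunction; all other Boolean operations are composed of it. -/
theorem FeasibleFun.zipWith_nand {f g : ∀ i, X i → List Bool} (hf : FeasibleFun w e f)
    (hg : FeasibleFun w e g) {l : ι → ℕ} (hl : PolyIn w l) (lf : ∀ i x, (f i x).length = l i)
    (lg : ∀ i x, (g i x).length = l i) :
    FeasibleFun w e fun i x => List.zipWith (fun a b => !(a && b)) (f i x) (g i x) := by
  refine ((hf.append hg).eval (fun i => .concat ((List.range (l i)).map fun j =>
    .seq (.wires [j, l i + j]) .nand)) ?_ fun i => ?_).congr fun i x => ?_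
  · refine ((hl.mul (.const 6)).add (.const 1)).mono fun i => ?_
    refine (Circ.size_concat_le (s := 5) ?_).trans (by simp)
    simp [Circ.size]
  · refine Circ.concat_isDet ?_
    simp [Circ.IsDet]
  · rw [Circ.eval_concat, List.flatMap_map]
    have h (j) : (Circ.seq (.wires [j, l i + j]) .nand).eval (f i x ++ g i x) =
        [Circ.nandHead [(f i x ++ g i x).getD j false, (f i x ++ g i x).getD (l i + j) false]] :=
      rfl
    simp only [h, ← List.map_eq_flatMap]
    apply List.ext_getElem
    · simp [lf, lg]
    · intro j h₁ h₂
      have hj : j < l i := by simpa using h₁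
      have h₄ : j < (g i x).length := by simpa [lg]
      simp [Circ.nandHead, List.getD_eq_getElem?_getD, List.getElem?_append, lf, hj, h₄]

theorem FeasibleFun.map_not {f : ∀ i, X i → List Bool} (hf : FeasibleFun w e f)
    (lf : FixedLength w f) : FeasibleFun w e fun i x => (f i x).map not := by
  obtain ⟨l, hl, lf⟩ := lf
  refine (hf.zipWith_nand hf hl lf lf).congr fun i x => ?_
  generalize f i x = u
  simp

theorem FeasibleFun.replicate {b : ∀ i, X i → Bool} (hb : FeasibleFun w e fun i x => [b i x])
    {l : ι → ℕ} (hl : PolyIn w l) : FeasibleFun w e fun i x => List.replicate (l i) (b i x) :=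
  (hb.eval (fun i => .wires (List.replicate (l i) 0))
    (by simpa [Circ.size] using hl.add (.const 1)) fun _ => trivial).congr
    fun i x => by simp [Circ.eval]

/-- Selection between two strings of the same length. -/
theorem FeasibleFun.ite {b : ∀ i, X i → Bool} {f g : ∀ i, X i → List Bool}
    (hb : FeasibleFun w e fun i x => [b i x]) (hf : FeasibleFun w e f) (hg : FeasibleFun w e g)
    {l : ι → ℕ} (hl : PolyIn w l) (lf : ∀ i x, (f i x).length = l i)
    (lg : ∀ i x, (g i x).length = l i) :
    FeasibleFun w e fun i x => if b i x then f i x else g i x := by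
  have hb' : FeasibleFun w e fun i x => [!b i x] := hb.map_not ⟨_, .const 1, fun _ _ => rfl⟩
  refine (((hb.replicate hl).zipWith_nand hf hl (by simp) lf).zipWith_nand
    ((hb'.replicate hl).zipWith_nand hg hl (by simp) lg) hl (by simp [lf]) (by simp [lg])).congr
    fun i x => ?_
  apply List.ext_getElem
  · split_ifs <;> simp [lf, lg]
  · intro j h₁ h₂
    revert h₁ h₂
    generalize b i x = c
    cases c <;> simp

/-- Exclusive or is composed of four negated conjunctions. -/
theorem FeasibleFun.str_bxor {n : ι → ℕ} (hn : PolyIn w n) {x y : ∀ i, X i → Bits (n i)}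
    (hx : FeasibleFun w e fun i a => str (x i a)) (hy : FeasibleFun w e fun i a => str (y i a)) :
    FeasibleFun w e fun i a => str (bxor (x i a) (y i a)) := by
  have l (i) (z : Bits (n i)) : (str z).length = n i := by simp [str]
  have h := hx.zipWith_nand hy hn (fun _ _ => l _ _) fun _ _ => l _ _
  have hx' := hx.zipWith_nand h hn (fun _ _ => l _ _) (by simp [l])
  have hy' := h.zipWith_nand hy hn (by simp [l]) fun _ _ => l _ _
  refine (hx'.zipWith_nand hy' hn (by simp [l]) (by simp [l])).congr fun i a => ?_
  apply List.ext_getElem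
  · simp [l]
  · intro j h₁ h₂
    simp only [str, bxor, List.getElem_zipWith, List.getElem_ofFn]
    cases x i a ⟨j, _⟩ <;> cases y i a ⟨j, _⟩ <;> rfl

/-- The conjunction of the first `l` bits. -/
def Circ.conj : ℕ → Circ
  | 0 => .const true
  | l + 1 => .seq (.pair (.wires [0]) (.seq (.wires (List.range' 1 l)) (.conj l)))
      (.seq .nand (.seq (.wires [0, 0]) .nand))

theorem Circ.size_conj_le (l : ℕ) : (Circ.conj l).size ≤ (l + 1) * (l + 20) := by
  induction l with
  | zero => simp [conj, size]
  | succ l ih =>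
    simp [conj, size]
    nlinarith

theorem Circ.conj_isDet (l : ℕ) : (Circ.conj l).IsDet := by
  induction l with
  | zero => trivial
  | succ l ih => exact ⟨⟨trivial, trivial, ih⟩, trivial, trivial, trivial⟩

theorem Circ.eval_conj (x : List Bool) : (Circ.conj x.length).eval x = [x.all id] := by
  induction x with
  | nil => rfl
  | cons b x ih =>
    have h : ((List.range' 1 x.length).map fun j => (b :: x).getD j false) = x := by
      rw [map_getD_range' _ _ _ (by simp [Nat.add_comm])]
      simp
    simp only [List.length_cons, conj, eval, h, ih]
    cases b <;> cases h : x.all id <;> simp_all [nandHead]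

theorem zipWith_xnor_all (u v : List Bool) (h : u.length = v.length) :
    ((List.zipWith (fun a b => a == b) u v).all id) = decide (u = v) := by
  induction u generalizing v with
  | nil =>
    cases v with
    | nil => rfl
    | cons b v => simp at h
  | cons a u ih =>
    cases v with
    | nil => simp at h
    | cons b v =>
      simp only [List.zipWith_cons_cons, List.all_cons, ih v (by simpa using h)]
      by_cases hab : a = b <;> by_cases huv : u = v <;> simp [hab, huv]

/-- Equality test for strings of the same length. -/
theorem FeasibleFun.decide_eq {f g : ∀ i, X i → List Bool} (hf : FeasibleFun w e f)
    (hg : FeasibleFun w e g) {l : ι → ℕ} (hl : PolyIn w l) (lf : ∀ i x, (f i x).length = l i)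
    (lg : ∀ i x, (g i x).length = l i) :
    FeasibleFun w e fun i x => [decide (f i x = g i x)] := by
  have hnand := hf.zipWith_nand hg hl lf lg
  -- `hor` is the disjunction, and its conjunction with `hnand` negated is the bitwise equality
  have hor := (hf.map_not ⟨l, hl, lf⟩).zipWith_nand (hg.map_not ⟨l, hl, lg⟩) hl (by simp [lf])
    (by simp [lg])
  refine (((hnand.zipWith_nand hor hl (by simp [lf, lg]) (by simp [lf, lg])).eval
    (fun i => .conj (l i)) ?_ fun i => Circ.conj_isDet _)).congr fun i x => ?_
  · exact ((hl.add (.const 1)).mul (hl.add (.const 20))).mono fun i => Circ.size_conj_le _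
  · rw [← zipWith_xnor_all _ _ (by rw [lf, lg])]
    have hl' := lf i x
    have hll := (lf i x).trans (lg i x).symm
    generalize f i x = u at *
    generalize g i x = v at *
    have : List.zipWith (fun a b => !(a && b)) (List.zipWith (fun a b => !(a && b)) u v)
        (List.zipWith (fun a b => !(a && b)) (u.map not) (v.map not)) =
        List.zipWith (fun a b => a == b) u v := by
      apply List.ext_getElem
      · simp
      · intro j h₁ h₂
        simp only [List.getElem_zipWith, List.getElem_map]
        cases u[j]'(by simp at h₂; omega) <;> cases v[j]'(by simp at h₂; omega) <;> rfl
    rw [this, ← Circ.eval_conj]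
    congr 2
    simp [← hll, hl']

/-! ### Sampling -/

theorem readNat_natBits_append (l N : ℕ) (h : N < 2 ^ l) : readNat l (natBits l N) = N := by
  rw [readNat]
  have : (fun i : Fin l => (natBits l N).getD i false) = fun i : Fin l => N.testBit i := by
    funext i
    simp [natBits, List.getD_eq_getElem?_getD]
  rw [this, Nat.ofBits_testBit, Nat.mod_eq_of_lt h]

/-- Sampling below a number that the input determines. -/
theorem Feasible.below {l : ι → ℕ} (hl : PolyIn w l) {N : ∀ i, X i → ℕ}
    (hN : FeasibleFun w e fun i x => natBits (l i) (N i x)) (h : ∀ i x, N i x < 2 ^ l i) :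
    Feasible w e fun i x => (below (N i x)).map (natBits (l i)) := by
  obtain ⟨c, hc, hN⟩ := hN
  refine ⟨fun i => .seq (c i) (.sample (l i)), (hc.add (hl.add (.const 1))).add (.const 1),
    fun i => ⟨⟨(hN i).1, trivial⟩, fun x => ?_⟩⟩
  rw [Circ.law, (hN i).2, PMF.pure_bind, Circ.law, readNat_natBits_append _ _ (h i x)]

theorem map_uniformOfFintype_equiv {α β : Type} [Fintype α] [Nonempty α] [Fintype β] [Nonempty β]
    (f : α ≃ β) : (PMF.uniformOfFintype α).map f = PMF.uniformOfFintype β := by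
  classical
  ext b
  rw [PMF.map_apply, tsum_eq_single (f.symm b)]
  · simp [Fintype.card_congr f]
  · intro a ha
    rw [if_neg]
    rintro rfl
    simp at ha

theorem below_eq_map (N : ℕ) [NeZero N] :
    below N = (PMF.uniformOfFintype (Fin N)).map Fin.val := by
  classical
  ext a
  rw [below, dif_neg (NeZero.ne N), PMF.uniformOfFinset_apply, PMF.map_apply]
  by_cases ha : a < N
  · rw [if_pos (by simpa), tsum_eq_single ⟨a, ha⟩]
    · simp
    · intro b hb
      rw [if_neg]
      rintro rfl
      simp at hb
  · rw [if_neg (by simpa using ha), eq_comm, ENNReal.tsum_eq_zero]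
    intro b
    rw [if_neg]
    rintro rfl
    exact ha b.2

/-- Numbers below `2 ^ n` and strings of `n` bits. -/
def finPowEquivBits (n : ℕ) : Fin (2 ^ n) ≃ Bits n where
  toFun N i := N.val.testBit i
  invFun x := ⟨Nat.ofBits x, Nat.ofBits_lt_two_pow x⟩
  left_inv N := by
    ext
    simp [Nat.ofBits_testBit, Nat.mod_eq_of_lt N.2]
  right_inv x := by
    funext i
    simp

theorem map_natBits_below_two_pow (n : ℕ) :
    (below (2 ^ n)).map (natBits n) = (PMF.uniformOfFintype (Bits n)).map str := by
  rw [below_eq_map, ← map_uniformOfFintype_equiv (finPowEquivBits n), PMF.map_comp, PMF.map_comp]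
  rfl

/-- Uniform strings come from the sampling gate with `N = 2 ^ n`, a number of `n + 1` digits. -/
theorem Feasible.bits {n : ι → ℕ} (hn : PolyIn w n) :
    Feasible w e fun i _ => (PMF.uniformOfFintype (Bits (n i))).map str := by
  have h : Feasible w e fun i _ => (_root_.below (2 ^ n i)).map (natBits (n i + 1)) :=
    .below (N := fun i _ => 2 ^ n i) (hn.add (.const 1))
      (.const (fun i => natBits (n i + 1) (2 ^ n i)) (by simpa [natBits] using hn.add (.const 1)))
      fun i _ => Nat.pow_lt_pow_right (by norm_num) (Nat.lt_succ_self _)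
  have h' : FeasibleFun w (X := fun _ => ℕ) (fun i N => natBits (n i + 1) N)
      fun i N => natBits (n i) N :=
    .slice (fixedLength_natBits hn) (fun _ => 0) fun i N =>
      ⟨[], [N.testBit (n i)], by rw [natBits, List.ofFn_succ_last]; rfl, rfl⟩
  refine (Feasible.comp h' h).congr fun i x => ?_
  rw [← map_natBits_below_two_pow]
  rfl

theorem Feasible.coin : Feasible w e fun _ _ => (PMF.uniformOfFintype Bool).map fun b => [b] := by
  refine (Feasible.bits (w := w) (e := e) (.const 1)).congr fun i x => ?_
  rw [← map_uniformOfFintype_equiv (Equiv.funUnique (Fin 1) Bool), PMF.map_comp]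
  rfl

end Feasible

/-! ### Simulation of the oracle by a circuit -/

theorem PMF.bind_congr_support {α β : Type} {μ : PMF α} {f g : α → PMF β}
    (h : ∀ a ∈ μ.support, f a = g a) : μ.bind f = μ.bind g := by
  ext b
  rw [PMF.bind_apply, PMF.bind_apply]
  refine tsum_congr fun a => ?_
  by_cases ha : a ∈ μ.support
  · rw [h a ha]
  · rw [PMF.mem_support_iff, not_not] at ha
    simp [ha]

/-- A table of queries and answers, in the order in which the queries were made. A repeated query is
recorded again, with the same answer: thus the shape of the table is known in advance. -/
abbrev Table (n : ℕ) : Type := List (List Bool × Bits n)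

namespace Table

variable {n : ℕ}

/-- The part of the oracle that the table determines. -/
def oracle (t : Table n) : List Bool → Option (Bits n) := fun q => t.lookup q

/-- The table as a string. -/
def encode (t : Table n) : List Bool := t.flatMap fun p => p.1 ++ str p.2

/-- The lengths of the queries. -/
def shape (t : Table n) : List ℕ := t.map fun p => p.1.length

/-- The length of the string that encodes a table of the given shape. -/
def width (n : ℕ) (ls : List ℕ) : ℕ := (ls.map fun l => l + n).sum

theorem length_encode (t : Table n) : t.encode.length = width n t.shape := by
  induction t with
  | nil => rfl
  | cons p t ih =>
    simp only [encode, shape, width, List.flatMap_cons, List.map_cons, List.sum_cons,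
      List.length_append] at ih ⊢
    rw [ih]
    simp [str]

theorem encode_append (t : Table n) (q : List Bool) (y : Bits n) :
    encode (t ++ [(q, y)]) = t.encode ++ q ++ str y := by
  simp [encode]

theorem shape_append (t : Table n) (q : List Bool) (y : Bits n) :
    shape (t ++ [(q, y)]) = t.shape ++ [q.length] := by
  simp [shape]

theorem width_append (ls ls' : List ℕ) : width n (ls ++ ls') = width n ls + width n ls' := by
  simp [width]

theorem oracle_append (t : Table n) (q : List Bool) (y : Bits n) :
    oracle (t ++ [(q, (t.lookup q).getD y)]) =
      match t.oracle q with
      | some _ => t.oracle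
      | none => Function.update t.oracle q (some y) := by
  funext r
  rw [oracle, List.lookup_append]
  by_cases hr : r = q
  · subst hr
    cases h : t.oracle r with
    | some z =>
      change t.lookup r = some z at h
      simp only [h, Option.some_or]
      exact h.symm
    | none =>
      change t.lookup r = none at h
      simp [h, List.lookup]
  · have : List.lookup r [(q, (t.lookup q).getD y)] = none := by
      simp [List.lookup, beq_eq_false_iff_ne.mpr hr]
    rw [this, Option.or_none]
    cases h : t.oracle q with
    | some z => rfl
    | none => exact (Function.update_of_ne hr (some y) t.oracle).symm

end Table

namespace Circ

variable {n : ℕ}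

/-- The execution of a circuit with an oracle that is sampled lazily and recorded in a table. -/
def runTable : Circ → List Bool → Table n → PMF (List Bool × Table n)
  | seq c d, x, t => (c.runTable x t).bind fun p => d.runTable p.1 p.2
  | pair c d, x, t =>
      (c.runTable x t).bind fun p => (d.runTable x p.2).map fun r => (p.1 ++ r.1, r.2)
  | query, x, t => (PMF.uniformOfFintype (Bits n)).map fun y =>
      (str ((t.lookup x).getD y), t ++ [(x, (t.lookup x).getD y)])
  | c, x, t => (c.law x).map fun y => (y, t)

theorem run_oracle (c : Circ) (x : List Bool) (t : Table n) :
    (c.run x : Rom n _).run t.oracle = (c.runTable x t).map fun p => (p.1, p.2.oracle) := by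
  have leaf (c : Circ) (hc : c.OracleFree) (x : List Bool) (t : Table n) :
      (c.run x : Rom n _).run t.oracle =
        ((c.law x).map fun y => (y, t)).map fun p => (p.1, p.2.oracle) := by
    rw [run_eq_law c hc, Rom.run_lift, PMF.map_comp]
    rfl
  induction c generalizing x t with
  | seq c d ihc ihd =>
    rw [run, Rom.run_bind_eq, ihc, runTable, PMF.bind_map, PMF.map_bind]
    congr 1
    funext p
    exact ihd _ _
  | pair c d ihc ihd =>
    rw [run, Rom.run_bind_eq, ihc, runTable, PMF.bind_map, PMF.map_bind]
    congr 1
    funext p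
    rw [Function.comp_apply, Rom.run_bind_eq, ihd, PMF.bind_map, PMF.map_comp]
    rfl
  | query =>
    rw [run, Rom.run_bind_eq, runTable, PMF.map_comp]
    cases h : t.oracle x with
    | some y =>
      have h' : t.lookup x = some y := h
      rw [Rom.hash_run_of_some h, PMF.pure_bind, Rom.run_pure_eq, ← PMF.map_const
        (PMF.uniformOfFintype (Bits n))]
      congr 1
      funext z
      simp only [Function.comp_apply, Function.const_apply, Table.oracle_append, h]
      simp [h']
    | none =>
      have h' : t.lookup x = none := h
      rw [Rom.hash_run_of_none h, PMF.bind_bind, ← PMF.bind_pure_comp]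
      congr 1
      funext z
      simp only [Function.comp_apply, Table.oracle_append, h, PMF.pure_bind, Rom.run_pure_eq]
      simp [h']
  | wires js => exact leaf (.wires js) trivial x t
  | const b => exact leaf (.const b) trivial x t
  | nand => exact leaf .nand trivial x t
  | sample l => exact leaf (.sample l) trivial x t

/-- The length of the output, for inputs of length `L`. -/
def outLength (n : ℕ) : Circ → ℕ → ℕ
  | wires js, _ => js.length
  | const _, _ => 1
  | nand, _ => 1
  | seq c d, L => d.outLength n (c.outLength n L)
  | pair c d, L => c.outLength n L + d.outLength n L
  | sample l, _ => l
  | query, _ => n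

/-- The lengths of the queries, for inputs of length `L`. -/
def queryLengths (n : ℕ) : Circ → ℕ → List ℕ
  | seq c d, L => c.queryLengths n L ++ d.queryLengths n (c.outLength n L)
  | pair c d, L => c.queryLengths n L ++ d.queryLengths n L
  | query, L => [L]
  | _, _ => []

theorem outLength_le (c : Circ) (L : ℕ) : c.outLength n L ≤ c.size * (n + 1) := by
  induction c generalizing L with
  | wires js => simp only [outLength, size]; nlinarith
  | seq c d ihc ihd =>
    have := ihd (c.outLength n L)
    simp only [outLength, size]
    nlinarith
  | pair c d ihc ihd =>
    have := ihc L
    have := ihd L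
    simp only [outLength, size]
    nlinarith
  | _ => simp only [outLength, size]; nlinarith

theorem length_queryLengths_le (c : Circ) (L : ℕ) : (c.queryLengths n L).length ≤ c.size := by
  induction c generalizing L with
  | seq c d ihc ihd =>
    have := ihc L
    have := ihd (c.outLength n L)
    simp only [queryLengths, size, List.length_append]
    omega
  | pair c d ihc ihd =>
    have := ihc L
    have := ihd L
    simp only [queryLengths, size, List.length_append]
    omega
  | _ => simp [queryLengths, size]

theorem width_queryLengths_le (c : Circ) {L V : ℕ} (hL : n + L ≤ V)
    (hc : n + c.size * (n + 1) ≤ V) :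
    Table.width n (c.queryLengths n L) + (c.queryLengths n L).length ≤ c.size * (V + 1) := by
  induction c generalizing L with
  | seq c d ihc ihd =>
    simp only [size] at hc
    have hout := c.outLength_le (n := n) L
    have h₁ := ihc hL (by nlinarith)
    have h₂ := ihd (L := c.outLength n L) (by nlinarith) (by nlinarith)
    simp only [queryLengths, size, List.length_append, Table.width_append]
    nlinarith
  | pair c d ihc ihd =>
    simp only [size] at hc
    have h₁ := ihc hL (by nlinarith)
    have h₂ := ihd hL (by nlinarith)
    simp only [queryLengths, size, List.length_append, Table.width_append]
    nlinarith
  | query =>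
    simp only [queryLengths, size, Table.width, List.map_cons, List.map_nil, List.sum_cons,
      List.sum_nil, List.length_cons, List.length_nil]
    omega
  | _ => simp [queryLengths, Table.width]

theorem lengths_of_mem_support {c : Circ} {x : List Bool} {t : Table n} {p : List Bool × Table n}
    (hp : p ∈ (c.runTable x t).support) :
    p.1.length = c.outLength n x.length ∧ p.2.shape = t.shape ++ c.queryLengths n x.length := by
  induction c generalizing x t p with
  | seq c d ihc ihd =>
    rw [runTable, PMF.mem_support_bind_iff] at hp
    obtain ⟨r, hr, hp⟩ := hp
    obtain ⟨h₁, h₂⟩ := ihc hr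
    obtain ⟨h₃, h₄⟩ := ihd hp
    rw [h₃, h₄, h₁, h₂]
    exact ⟨rfl, List.append_assoc _ _ _⟩
  | pair c d ihc ihd =>
    rw [runTable, PMF.mem_support_bind_iff] at hp
    obtain ⟨r, hr, hp⟩ := hp
    rw [PMF.mem_support_map_iff] at hp
    obtain ⟨r', hr', rfl⟩ := hp
    obtain ⟨h₁, h₂⟩ := ihc hr
    obtain ⟨h₃, h₄⟩ := ihd hr'
    simp [outLength, queryLengths, h₁, h₂, h₃, h₄]
  | query =>
    rw [runTable, PMF.mem_support_map_iff] at hp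
    obtain ⟨y, -, rfl⟩ := hp
    simp [outLength, queryLengths, Table.shape_append, str]
  | sample l =>
    simp only [runTable, law, PMF.mem_support_map_iff] at hp
    obtain ⟨_, ⟨y, -, rfl⟩, rfl⟩ := hp
    simp [outLength, queryLengths, natBits]
  | _ =>
    simp only [runTable, law, PMF.mem_support_map_iff, PMF.mem_support_pure_iff] at hp
    obtain ⟨_, rfl, rfl⟩ := hp
    simp [outLength, queryLengths]

/-- One step of the search for a query `q` in a table: the answer `a` is selected if the entry `q'`
equals `q`, and otherwise the result `r` of the search in the rest of the table is kept. -/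
theorem exists_select : ∃ P : Polynomial ℕ, ∀ n L l : ℕ, ∃ c : Circ,
    c.size ≤ P.eval (n + L) + n + 1 ∧ c.OracleFree ∧
    ∀ (q q' : List Bool) (a r : Bits n), q.length = L → q'.length = l →
      c.law (q ++ q' ++ str a ++ str r) = PMF.pure (if q = q' then str a else str r) := by
  let w : ℕ × ℕ → ℕ := fun i => i.1 + i.2
  have hn : PolyIn w Prod.fst := PolyIn.weight.mono fun i => Nat.le_add_right _ _
  have hL : PolyIn w Prod.snd := PolyIn.weight.mono fun i => Nat.le_add_left _ _
  let X : ℕ × ℕ → Type := fun i => {z : List Bool × List Bool × Bits i.1 × Bits i.1 //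
    z.1.length = i.2 ∧ z.2.1.length = i.2}
  let e : ∀ i, X i → List Bool := fun i z => z.1.1 ++ z.1.2.1 ++ str z.1.2.2.1 ++ str z.1.2.2.2
  have h₁ : FeasibleFun w e fun i z => z.1.1 :=
    .slice ⟨_, hL, fun i z => z.2.1⟩ (fun _ => 0) fun i z =>
      ⟨[], z.1.2.1 ++ str z.1.2.2.1 ++ str z.1.2.2.2, by simp [e], rfl⟩
  have h₂ : FeasibleFun w e fun i z => z.1.2.1 :=
    .slice ⟨_, hL, fun i z => z.2.2⟩ (fun i => i.2) fun i z =>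
      ⟨z.1.1, str z.1.2.2.1 ++ str z.1.2.2.2, by simp [e], z.2.1⟩
  have h₃ : FeasibleFun w e fun i z => str z.1.2.2.1 :=
    .slice ⟨_, hn, fun i z => by simp [str]⟩ (fun i => i.2 + i.2) fun i z =>
      ⟨z.1.1 ++ z.1.2.1, str z.1.2.2.2, by simp [e], by simp [z.2.1, z.2.2]⟩
  have h₄ : FeasibleFun w e fun i z => str z.1.2.2.2 :=
    .slice ⟨_, hn, fun i z => by simp [str]⟩ (fun i => i.2 + i.2 + i.1) fun i z =>
      ⟨z.1.1 ++ z.1.2.1 ++ str z.1.2.2.1, [], by simp [e],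
        by simp [z.2.1, z.2.2, str, Nat.add_assoc]⟩
  obtain ⟨c, ⟨P, hP⟩, hc⟩ :=
    (h₁.decide_eq h₂ hL (fun i z => z.2.1) fun i z => z.2.2).ite h₃ h₄ hn (by simp [str])
      (by simp [str])
  refine ⟨P, fun n L l => ?_⟩
  by_cases hl : L = l
  · subst hl
    refine ⟨c (n, L), (hP (n, L)).trans (by simp only [w]; omega), (hc _).1,
      fun q q' a r hq hq' => ?_⟩
    refine ((hc (n, L)).2 ⟨(q, q', a, r), hq, hq'⟩).trans ?_
    simp
  -- strings of different lengths are different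
  · refine ⟨.wires (List.range' (L + l + n) n), by simp [size], trivial, fun q q' a r hq hq' => ?_⟩
    rw [if_neg (by rintro rfl; omega), law, map_getD_range' _ _ _ (by simp [hq, hq', str]; omega)]
    congr 1
    rw [List.drop_left' (by simp [hq, hq', str, Nat.add_assoc]),
      List.take_of_length_le (by simp [str])]

/-- The search for a query in a table, with the default answer `y`. -/
theorem exists_lookup : ∃ P : Polynomial ℕ, ∀ n L V : ℕ, n + L ≤ V → ∀ ls : List ℕ,
    Table.width n ls ≤ V → ∃ c : Circ, c.size ≤ (ls.length + 1) * P.eval V ∧ c.OracleFree ∧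
      ∀ (q : List Bool) (y : Bits n) (t : Table n), q.length = L → t.shape = ls →
        c.law (q ++ str y ++ t.encode) = PMF.pure (str ((t.lookup q).getD y)) := by
  obtain ⟨P, hP⟩ := exists_select
  refine ⟨P + .C 4 * .X + .C 10, fun n L V hV ls => ?_⟩
  have hPV : P.eval (n + L) ≤ P.eval V := eval_monotone P hV
  simp only [Polynomial.eval_add, Polynomial.eval_mul, Polynomial.eval_C, Polynomial.eval_X]
  induction ls with
  | nil =>
    refine fun _ => ⟨.wires (List.range' L n), ?_, trivial, fun q y t hq ht => ?_⟩
    · simp only [size, List.length_range', List.length_nil]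
      nlinarith
    · obtain rfl : t = [] := by simpa [Table.shape] using ht
      rw [law, map_getD_range' _ _ _ (by simp [hq, str])]
      congr 1
      rw [List.append_assoc, List.drop_left' hq, List.take_left' (by simp [str])]
      rfl
  | cons l ls ih =>
    intro hw
    obtain ⟨c, hcs, hco, hc⟩ := ih (le_trans (by simp [Table.width]) hw)
    obtain ⟨d, hds, hdo, hd⟩ := hP n L l
    have hw' : l + n + Table.width n ls ≤ V := by simpa [Table.width] using hw
    refine ⟨.seq (.pair (.wires (List.range' 0 L ++ List.range' (L + n) (l + n)))
      (.seq (.wires (List.range' 0 (L + n) ++ List.range' (L + n + (l + n)) (Table.width n ls))) c))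
      d, ?_, ⟨⟨trivial, trivial, hco⟩, hdo⟩, fun q y t hq ht => ?_⟩
    · simp only [size, List.length_append, List.length_range', List.length_cons]
      nlinarith
    · obtain ⟨⟨q', a⟩, t, rfl⟩ : ∃ p t', t = p :: t' := by
        cases t with
        | nil => simp [Table.shape] at ht
        | cons p t => exact ⟨p, t, rfl⟩
      obtain ⟨hq', ht'⟩ : q'.length = l ∧ Table.shape t = ls := by simpa [Table.shape] using ht
      have hle := Table.length_encode t
      rw [ht'] at hle
      have henc : Table.encode ((q', a) :: t) = q' ++ str a ++ Table.encode t := by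
        simp [Table.encode]
      have lstr (z : Bits n) : (str z).length = n := by simp [str]
      have e₁ : ((List.range' 0 L ++ List.range' (L + n) (l + n)).map fun j =>
          (q ++ str y ++ (q' ++ str a ++ Table.encode t)).getD j false) = q ++ (q' ++ str a) := by
        rw [List.map_append, map_getD_range' _ _ _ (by simp [hq]),
          map_getD_range' _ _ _ (by simp [hq, hq', lstr]; omega)]
        congr 1
        · rw [List.drop_zero, List.append_assoc, List.take_left' hq]
        · rw [List.drop_left' (by simp [hq, lstr]), List.take_left' (by simp [hq', lstr])]
      have e₂ : ((List.range' 0 (L + n) ++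
          List.range' (L + n + (l + n)) (Table.width n ls)).map fun j =>
          (q ++ str y ++ (q' ++ str a ++ Table.encode t)).getD j false) =
            q ++ str y ++ Table.encode t := by
        rw [List.map_append, map_getD_range' _ _ _ (by simp [hq, lstr]),
          map_getD_range' _ _ _ (by simp [hq, hq', lstr, hle]; omega)]
        congr 1
        · rw [List.drop_zero, List.take_left' (by simp [hq, lstr])]
        · rw [← List.append_assoc, List.drop_left' (by simp [hq, hq', lstr, Nat.add_assoc]),
            List.take_of_length_le hle.le]
      simp only [henc, law, PMF.pure_bind]
      rw [e₁, e₂, hc q y t hq ht', PMF.pure_bind, ← List.append_assoc, PMF.pure_bind,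
        hd q q' a _ hq hq']
      congr 1
      by_cases h : q = q'
      · simp [h]
      · simp [h, List.lookup, beq_eq_false_iff_ne.mpr h]

/-- Every circuit is simulated by a circuit without oracle gates, which keeps the table of the
queries behind the data and answers new queries by uniform strings. Here `V` bounds the length of
every query together with its answer, and `T` the length of the final table; with these bounds fixed
in advance, the size of the new circuit is linear in the size of the old one. -/
theorem exists_simulation : ∃ P : Polynomial ℕ, ∀ (n V T : ℕ) (c : Circ) (L : ℕ) (ls : List ℕ),
    n + L ≤ V → n + c.size * (n + 1) ≤ V →
    Table.width n ls + ls.length + c.size * (V + 1) ≤ T →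
    ∃ c' : Circ, c'.size ≤ c.size * P.eval (V + T) ∧ c'.OracleFree ∧
      ∀ (x : List Bool) (t : Table n), x.length = L → t.shape = ls →
        c'.law (x ++ t.encode) = (c.runTable x t).map fun p => p.1 ++ p.2.encode := by
  obtain ⟨P, hP⟩ := exists_lookup
  obtain ⟨G, ⟨Q, hQ⟩, hG⟩ := Feasible.bits (ι := ℕ) (w := id) (X := fun _ => List Bool)
    (e := fun _ x => x) PolyIn.weight
  refine ⟨(.X + .C 1) * P + Q + .C 20 * .X + .C 40, fun n V T c => ?_⟩
  simp only [Polynomial.eval_add, Polynomial.eval_mul, Polynomial.eval_C, Polynomial.eval_X]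
  have leaf (c : Circ) (hc : c.OracleFree) (L : ℕ) (ls : List ℕ) (hL : n + L ≤ V)
      (hls : Table.width n ls + ls.length + c.size * (V + 1) ≤ T) (hs : 1 ≤ c.size) :
      ∃ c' : Circ, c'.size ≤ c.size * ((V + T + 1) * P.eval (V + T) + Q.eval (V + T) +
        20 * (V + T) + 40) ∧
        c'.OracleFree ∧ ∀ (x : List Bool) (t : Table n), x.length = L → t.shape = ls →
        c'.law (x ++ t.encode) =
          ((c.law x).map fun y => (y, t)).map fun p => p.1 ++ p.2.encode := by
    refine ⟨.pair (.seq (.wires (List.range' 0 L)) c)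
      (.wires (List.range' L (Table.width n ls))), ?_, ⟨⟨trivial, hc⟩, trivial⟩,
      fun x t hx ht => ?_⟩
    · simp only [size, List.length_range']
      have : Table.width n ls ≤ T := by omega
      nlinarith [Nat.zero_le (c.size * ((V + T + 1) * P.eval (V + T)))]
    · have hle := t.length_encode
      rw [ht] at hle
      simp only [law, PMF.pure_bind]
      rw [map_getD_range' _ _ _ (by simp [hx]), map_getD_range' _ _ _ (by simp [hx, hle]),
        List.drop_zero, List.take_left' hx, List.drop_left' hx, List.take_of_length_le hle.le,
        PMF.map_comp]
      rfl
  induction c with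
  | seq c d ihc ihd =>
    intro L ls hL hs hls
    simp only [size] at hs hls ⊢
    obtain ⟨c', hcs, hco, hc⟩ := ihc L ls hL (by nlinarith) (by nlinarith)
    have hout := c.outLength_le (n := n) L
    have hq := c.width_queryLengths_le hL (by nlinarith)
    obtain ⟨d', hds, hdo, hd⟩ := ihd (c.outLength n L) (ls ++ c.queryLengths n L) (by nlinarith)
      (by nlinarith) (by rw [Table.width_append, List.length_append]; nlinarith)
    refine ⟨.seq c' d', ?_, ⟨hco, hdo⟩, fun x t hx ht => ?_⟩
    · simp only [size]
      nlinarith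
    · rw [law, hc x t hx ht, runTable, PMF.bind_map, PMF.map_bind]
      refine PMF.bind_congr_support fun p hp => ?_
      obtain ⟨hp₁, hp₂⟩ := lengths_of_mem_support hp
      exact hd _ _ (by rw [hp₁, hx]) (by rw [hp₂, ht, hx])
  | pair c d ihc ihd =>
    intro L ls hL hs hls
    simp only [size] at hs hls ⊢
    obtain ⟨c', hcs, hco, hc⟩ := ihc L ls hL (by nlinarith) (by nlinarith)
    have hout := c.outLength_le (n := n) L
    have hq := c.width_queryLengths_le hL (by nlinarith)
    obtain ⟨d', hds, hdo, hd⟩ := ihd L (ls ++ c.queryLengths n L) (by nlinarith)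
      (by nlinarith) (by rw [Table.width_append, List.length_append]; nlinarith)
    set o := c.outLength n L with ho
    set W := Table.width n (ls ++ c.queryLengths n L) with hW
    have hWT : W ≤ T := by rw [hW, Table.width_append]; nlinarith
    -- the input is kept for `d'`, which continues with the table that `c'` leaves
    refine ⟨.seq (.pair (.wires (List.range' 0 L)) c') (.pair (.wires (List.range' L o))
      (.seq (.wires (List.range' 0 L ++ List.range' (L + o) W)) d')), ?_,
      ⟨⟨trivial, hco⟩, trivial, trivial, hdo⟩, fun x t hx ht => ?_⟩
    · simp only [size, List.length_append, List.length_range']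
      nlinarith
    · simp only [law, PMF.pure_bind]
      rw [map_getD_range' _ _ _ (by simp [hx]), List.drop_zero, List.take_left' hx, hc x t hx ht,
        runTable, PMF.bind_bind, PMF.bind_map, PMF.map_bind]
      refine PMF.bind_congr_support fun p hp => ?_
      obtain ⟨hp₁, hp₂⟩ := lengths_of_mem_support hp
      rw [hx] at hp₁ hp₂
      rw [ht] at hp₂
      have hle := p.2.length_encode
      rw [hp₂] at hle
      simp only [Function.comp_apply, PMF.pure_bind]
      rw [map_getD_range' _ _ _ (by simp [hx, hp₁, ← ho]), List.map_append,
        map_getD_range' _ _ _ (by simp [hx]),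
        map_getD_range' _ _ _ (by rw [List.length_append, List.length_append, hx, hp₁, hle, ← ho,
          ← hW, Nat.add_assoc]), List.drop_left' hx, List.take_left' hp₁,
        List.drop_zero, List.take_left' hx, ← List.append_assoc,
        List.drop_left' (by simp [hx, hp₁, ho]), List.take_of_length_le hle.le, hd x p.2 hx hp₂,
        PMF.map_comp, PMF.bind_map, ← PMF.bind_pure_comp]
      congr 1
      funext r
      simp
  | query =>
    intro L ls hL hs hls
    simp only [size] at hs hls ⊢
    obtain ⟨c, hcs, hco, hc⟩ := hP n L (V + T) (by omega) ls (by omega)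
    set W := Table.width n ls with hW
    have hgs : (G n).size ≤ Q.eval (V + T) := (hQ n).trans (eval_monotone Q (by simp; omega))
    have hg := (hG n).2
    -- draw a fresh answer, look the query up, and append the query and its answer to the table
    refine ⟨.seq (.pair (.wires (List.range' 0 (L + W))) (G n)) (.seq (.pair
      (.seq (.wires (List.range' 0 L ++ List.range' (L + W) n ++ List.range' L W)) c)
      (.wires (List.range' 0 (L + W)))) (.wires (List.range' 0 n ++ List.range' (n + L) W ++
        List.range' n L ++ List.range' 0 n))), ?_,
      ⟨⟨trivial, (hG n).1⟩, ⟨⟨trivial, hco⟩, trivial⟩, trivial⟩, fun x t hx ht => ?_⟩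
    · simp only [size, List.length_append, List.length_range']
      have : (ls.length + 1) * P.eval (V + T) ≤ (V + T + 1) * P.eval (V + T) :=
        Nat.mul_le_mul_right _ (by omega)
      nlinarith
    · have hle := t.length_encode
      rw [ht, ← hW] at hle
      have lstr (z : Bits n) : (str z).length = n := by simp [str]
      have e₀ : ((List.range' 0 (L + W)).map fun j => (x ++ t.encode).getD j false) =
          x ++ t.encode := by
        rw [map_getD_range' _ _ _ (by simp [hx, hle]), List.drop_zero,
          List.take_of_length_le (by simp [hx, hle])]
      have e₁ (y : Bits n) : ((List.range' 0 (L + W)).map fun j =>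
          (x ++ t.encode ++ str y).getD j false) = x ++ t.encode := by
        rw [map_getD_range' _ _ _ (by simp [hx, hle, ← Nat.add_assoc]), List.drop_zero,
          List.take_left' (by simp [hx, hle])]
      have e₂ (y : Bits n) : ((List.range' 0 L ++ List.range' (L + W) n ++ List.range' L W).map
          fun j => (x ++ t.encode ++ str y).getD j false) = x ++ str y ++ t.encode := by
        rw [List.map_append, List.map_append, map_getD_range' _ _ _ (by simp [hx]),
          map_getD_range' _ _ _ (by simp [hx, hle, lstr, Nat.add_assoc]),
          map_getD_range' _ _ _ (by simp [hx, hle, ← Nat.add_assoc]),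
          List.drop_zero, List.drop_left' (l₁ := x ++ t.encode) (by simp [hx, hle]),
          List.take_of_length_le (lstr y).le, List.append_assoc x, List.take_left' hx,
          List.drop_left' hx, List.take_left' hle]
      have e₃ (a : Bits n) : ((List.range' 0 n ++ List.range' (n + L) W ++ List.range' n L ++
          List.range' 0 n).map fun j => (str a ++ (x ++ t.encode)).getD j false) =
          str a ++ (t.encode ++ x ++ str a) := by
        simp only [List.map_append]
        rw [map_getD_range' _ _ _ (by simp [lstr]),
          map_getD_range' _ _ _ (by simp [lstr, hx, hle, Nat.add_assoc]),
          map_getD_range' _ _ _ (by simp [lstr, hx]),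
          List.drop_zero, List.take_left' (lstr a), List.drop_left' (lstr a), List.take_left' hx,
          ← List.append_assoc, List.drop_left' (by simp [lstr, hx]), List.take_of_length_le hle.le]
        simp
      simp only [law, PMF.pure_bind, hg, runTable]
      rw [e₀, PMF.bind_map, PMF.bind_bind, PMF.map_comp, ← PMF.bind_pure_comp]
      congr 1
      funext y
      simp only [Function.comp_apply, PMF.pure_bind]
      rw [e₁, e₂, hc x y t hx ht, PMF.pure_bind, Table.encode_append, PMF.pure_bind, e₃]
  | wires js => exact fun L ls hL _ hls => leaf (.wires js) trivial L ls hL hls (by simp [size])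
  | const b => exact fun L ls hL _ hls => leaf (.const b) trivial L ls hL hls (by simp [size])
  | nand => exact fun L ls hL _ hls => leaf .nand trivial L ls hL hls (by simp [size])
  | sample l => exact fun L ls hL _ hls => leaf (.sample l) trivial L ls hL hls (by simp [size])

end Circ

/-! ### Group operations -/

theorem PolyBounded.polyIn {f : ℕ → ℕ} (hf : PolyBounded f) {ι : Type} (κ : ι → ℕ) :
    PolyIn κ fun i => f (κ i) := by
  obtain ⟨P, hP⟩ := hf
  exact ⟨P, fun i => hP _⟩

section GroupOperations

variable {𝒢 : GroupGen} {ι : Type} {κ : ι → ℕ} {X : ι → Type} {e : ∀ i, X i → List Bool}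
  {ω : ∀ i, X i → Bits (𝒢.coinLen (κ i))}

theorem length_str {n : ℕ} (x : Bits n) : (str x).length = n := by simp [str]

theorem length_natBits (n N : ℕ) : (natBits n N).length = n := by simp [natBits]

theorem length_pub {k : ℕ} (ω : Bits (𝒢.coinLen k)) :
    (𝒢.gen k ω).pub.length = 𝒢.descLen k + 𝒢.ordLen k + 𝒢.elemLen k := by
  simp [GroupInstance.pub, length_str, length_natBits, Nat.add_assoc]

theorem fixedLength_pub : FixedLength κ fun i (x : X i) => (𝒢.gen (κ i) (ω i x)).pub :=
  ⟨_, ((𝒢.descLen_poly.polyIn κ).add (𝒢.ordLen_poly.polyIn κ)).add (𝒢.elemLen_poly.polyIn κ),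
    fun _ _ => length_pub _⟩

theorem fixedLength_elem {h : ∀ i (x : X i), (𝒢.gen (κ i) (ω i x)).Carrier} :
    FixedLength κ fun i (x : X i) => str ((𝒢.gen (κ i) (ω i x)).enc (h i x)) :=
  ⟨_, 𝒢.elemLen_poly.polyIn κ, fun _ _ => length_str _⟩

namespace FeasibleFun

theorem pub (hω : FeasibleFun κ e fun i x => str (ω i x)) :
    FeasibleFun κ e fun i x => (𝒢.gen (κ i) (ω i x)).pub := by
  obtain ⟨c, hc, h⟩ := 𝒢.gen_poly
  exact (hω.eval (fun i => c (κ i)) (PolyBounded.polyIn hc κ) fun i => (h _).1).congr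
    fun i x => (h _).2 _

theorem order (hpub : FeasibleFun κ e fun i x => (𝒢.gen (κ i) (ω i x)).pub) :
    FeasibleFun κ e fun i x => natBits (𝒢.ordLen (κ i)) (𝒢.gen (κ i) (ω i x)).p := by
  have h : FeasibleFun κ (X := fun i => Bits (𝒢.coinLen (κ i))) (fun i ω => (𝒢.gen (κ i) ω).pub)
      fun i ω => natBits (𝒢.ordLen (κ i)) (𝒢.gen (κ i) ω).p :=
    .slice ⟨_, 𝒢.ordLen_poly.polyIn κ, fun i x => length_natBits _ _⟩
      (fun i => 𝒢.descLen (κ i)) fun i ω =>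
      ⟨str (𝒢.gen (κ i) ω).desc, str ((𝒢.gen (κ i) ω).enc (𝒢.gen (κ i) ω).g), rfl, length_str _⟩
  exact h.comp hpub

theorem gen (hpub : FeasibleFun κ e fun i x => (𝒢.gen (κ i) (ω i x)).pub) :
    FeasibleFun κ e fun i x => str ((𝒢.gen (κ i) (ω i x)).enc (𝒢.gen (κ i) (ω i x)).g) := by
  have h : FeasibleFun κ (X := fun i => Bits (𝒢.coinLen (κ i))) (fun i ω => (𝒢.gen (κ i) ω).pub)
      fun i ω => str ((𝒢.gen (κ i) ω).enc (𝒢.gen (κ i) ω).g) :=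
    .slice ⟨_, 𝒢.elemLen_poly.polyIn κ, fun i x => length_str _⟩
      (fun i => 𝒢.descLen (κ i) + 𝒢.ordLen (κ i)) fun i ω =>
      ⟨str (𝒢.gen (κ i) ω).desc ++ natBits (𝒢.ordLen (κ i)) (𝒢.gen (κ i) ω).p, [],
        by simp [GroupInstance.pub], by simp [length_str, length_natBits]⟩
  exact h.comp hpub

variable {g h : ∀ i (x : X i), (𝒢.gen (κ i) (ω i x)).Carrier}

theorem mul (hpub : FeasibleFun κ e fun i x => (𝒢.gen (κ i) (ω i x)).pub)
    (hg : FeasibleFun κ e fun i x => str ((𝒢.gen (κ i) (ω i x)).enc (g i x)))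
    (hh : FeasibleFun κ e fun i x => str ((𝒢.gen (κ i) (ω i x)).enc (h i x))) :
    FeasibleFun κ e fun i x => str ((𝒢.gen (κ i) (ω i x)).enc (g i x * h i x)) := by
  obtain ⟨c, hc, h⟩ := 𝒢.mul_poly
  exact (((hpub.append hg).append hh).eval (fun i => c (κ i)) (PolyBounded.polyIn hc κ)
    fun i => (h _).1).congr fun i x => (h _).2 _ _ _

theorem inv (hpub : FeasibleFun κ e fun i x => (𝒢.gen (κ i) (ω i x)).pub)
    (hg : FeasibleFun κ e fun i x => str ((𝒢.gen (κ i) (ω i x)).enc (g i x))) :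
    FeasibleFun κ e fun i x => str ((𝒢.gen (κ i) (ω i x)).enc (g i x)⁻¹) := by
  obtain ⟨c, hc, h⟩ := 𝒢.inv_poly
  exact ((hpub.append hg).eval (fun i => c (κ i)) (PolyBounded.polyIn hc κ)
    fun i => (h _).1).congr fun i x => (h _).2 _ _

theorem div (hpub : FeasibleFun κ e fun i x => (𝒢.gen (κ i) (ω i x)).pub)
    (hg : FeasibleFun κ e fun i x => str ((𝒢.gen (κ i) (ω i x)).enc (g i x)))
    (hh : FeasibleFun κ e fun i x => str ((𝒢.gen (κ i) (ω i x)).enc (h i x))) :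
    FeasibleFun κ e fun i x => str ((𝒢.gen (κ i) (ω i x)).enc (g i x / h i x)) :=
  (hpub.mul hg (hpub.inv hh)).congr fun i x => by rw [div_eq_mul_inv]

theorem ite_elem {b : ∀ i, X i → Bool} (hb : FeasibleFun κ e fun i x => [b i x])
    (hg : FeasibleFun κ e fun i x => str ((𝒢.gen (κ i) (ω i x)).enc (g i x)))
    (hh : FeasibleFun κ e fun i x => str ((𝒢.gen (κ i) (ω i x)).enc (h i x))) :
    FeasibleFun κ e fun i x =>
      str ((𝒢.gen (κ i) (ω i x)).enc (if b i x then g i x else h i x)) :=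
  (hb.ite hg hh (𝒢.elemLen_poly.polyIn κ) (fun _ _ => length_str _)
    fun _ _ => length_str _).congr fun i x => by split_ifs <;> rfl

end FeasibleFun

/-! ### Exponentiation -/

/-- The state of the square-and-multiply algorithm: the group, the accumulator, the current power of
the base, and the part of the exponent that has not been processed. -/
abbrev PowState (𝒢 : GroupGen) (k : ℕ) : Type :=
  (ω : Bits (𝒢.coinLen k)) × (𝒢.gen k ω).Carrier × (𝒢.gen k ω).Carrier × Fin (2 ^ 𝒢.ordLen k)

namespace PowState

variable {k : ℕ}

/-- The state as a string that begins with the public string of the group. -/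
def encode (z : PowState 𝒢 k) : List Bool :=
  (𝒢.gen k z.1).pub ++ str ((𝒢.gen k z.1).enc z.2.1) ++ str ((𝒢.gen k z.1).enc z.2.2.1) ++
    natBits (𝒢.ordLen k) z.2.2.2

/-- One step of the algorithm, which processes the lowest digit of the exponent. -/
def step (z : PowState 𝒢 k) : PowState 𝒢 k :=
  ⟨z.1, (if z.2.2.2.val.testBit 0 then z.2.1 * z.2.2.1 else z.2.1), z.2.2.1 * z.2.2.1,
    ⟨z.2.2.2 / 2, (Nat.div_le_self _ _).trans_lt z.2.2.2.2⟩⟩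

theorem iterate_step (z : PowState 𝒢 k) (j : ℕ) :
    step^[j] z = ⟨z.1, z.2.1 * z.2.2.1 ^ (z.2.2.2.val % 2 ^ j), z.2.2.1 ^ 2 ^ j,
      ⟨z.2.2.2 / 2 ^ j, (Nat.div_le_self _ _).trans_lt z.2.2.2.2⟩⟩ := by
  obtain ⟨ω, a, b, N⟩ := z
  induction j with
  | zero => simp [Nat.mod_one]
  | succ j ih =>
    rw [Function.iterate_succ_apply', ih, step]
    simp only [Nat.testBit_zero, Nat.div_div_eq_div_mul, ← pow_succ, ← pow_add, ← two_mul]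
    congr 2
    · rw [Nat.mod_pow_succ, pow_add, ← mul_assoc, pow_mul]
      rcases Nat.mod_two_eq_zero_or_one (N.val / 2 ^ j) with h | h <;> simp [h]
    · exact Prod.ext (by simp only [pow_succ']) rfl

theorem fixedLength_encode : FixedLength κ fun i (z : PowState 𝒢 (κ i)) => z.encode :=
  ⟨_, ((((𝒢.descLen_poly.polyIn κ).add (𝒢.ordLen_poly.polyIn κ)).add
    (𝒢.elemLen_poly.polyIn κ)).add ((𝒢.elemLen_poly.polyIn κ).add (𝒢.elemLen_poly.polyIn κ))).add
    (𝒢.ordLen_poly.polyIn κ),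
    fun _ x => by simp [encode, GroupInstance.pub, length_str, length_natBits, Nat.add_assoc]⟩

theorem feasible_step :
    FeasibleFun κ (fun i (z : PowState 𝒢 (κ i)) => z.encode) fun i z => z.step.encode := by
  let ω : ∀ i, PowState 𝒢 (κ i) → Bits (𝒢.coinLen (κ i)) := fun _ z => z.1
  have hpub : FeasibleFun κ (fun i (z : PowState 𝒢 (κ i)) => z.encode)
      fun i z => (𝒢.gen (κ i) (ω i z)).pub :=
    .slice fixedLength_pub (fun _ => 0) fun i z => ⟨[], _, by
      simp only [encode, List.nil_append, List.append_assoc]; rfl, rfl⟩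
  have hacc : FeasibleFun κ (fun i (z : PowState 𝒢 (κ i)) => z.encode)
      fun i z => str ((𝒢.gen (κ i) (ω i z)).enc z.2.1) :=
    .slice fixedLength_elem (fun i => 𝒢.descLen (κ i) + 𝒢.ordLen (κ i) + 𝒢.elemLen (κ i))
      fun i z => ⟨(𝒢.gen (κ i) z.1).pub, _, by
        simp only [encode, List.append_assoc]; rfl, length_pub _⟩
  have hbase : FeasibleFun κ (fun i (z : PowState 𝒢 (κ i)) => z.encode)
      fun i z => str ((𝒢.gen (κ i) (ω i z)).enc z.2.2.1) :=
    .slice fixedLength_elem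
      (fun i => 𝒢.descLen (κ i) + 𝒢.ordLen (κ i) + 𝒢.elemLen (κ i) + 𝒢.elemLen (κ i))
      fun i z => ⟨(𝒢.gen (κ i) z.1).pub ++ str ((𝒢.gen (κ i) z.1).enc z.2.1), _, rfl,
        by simp [length_pub, length_str]⟩
  have hexp : FeasibleFun κ (fun i (z : PowState 𝒢 (κ i)) => z.encode)
      fun i z => natBits (𝒢.ordLen (κ i)) z.2.2.2 :=
    .slice ⟨_, 𝒢.ordLen_poly.polyIn κ, fun i x => length_natBits _ _⟩
      (fun i => 𝒢.descLen (κ i) + 𝒢.ordLen (κ i) + 𝒢.elemLen (κ i) + 𝒢.elemLen (κ i) +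
        𝒢.elemLen (κ i))
      fun i z => ⟨(𝒢.gen (κ i) z.1).pub ++ str ((𝒢.gen (κ i) z.1).enc z.2.1) ++
        str ((𝒢.gen (κ i) z.1).enc z.2.2.1), [], (List.append_nil _).symm,
        by simp [length_pub, length_str, Nat.add_assoc]⟩
  -- missing digits are read as `0`
  have hbit : FeasibleFun κ (fun i (z : PowState 𝒢 (κ i)) => z.encode)
      fun i z => [z.2.2.2.val.testBit 0] := by
    refine (hexp.eval (fun _ => .wires [0]) (.const 2) fun _ => trivial).congr fun i z => ?_
    have hN := z.2.2.2.2
    generalize z.2.2.2.val = N at hN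
    simp only [Circ.eval, List.map_cons, List.map_nil]
    rcases Nat.eq_zero_or_pos (𝒢.ordLen (κ i)) with h | h
    · rw [h, pow_zero, Nat.lt_one_iff] at hN
      simp [h, hN, natBits]
    · simp [natBits, List.getD_eq_getElem?_getD, h]
  have hhalf : FeasibleFun κ (fun i (z : PowState 𝒢 (κ i)) => z.encode)
      fun i z => natBits (𝒢.ordLen (κ i)) (z.2.2.2.val / 2) := by
    refine (hexp.eval (fun i => .wires (List.range' 1 (𝒢.ordLen (κ i))))
      (by simpa [Circ.size] using (𝒢.ordLen_poly.polyIn κ).add (.const 1))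
      fun _ => trivial).congr fun i z => ?_
    have hN := z.2.2.2.2
    generalize z.2.2.2.val = N at hN
    apply List.ext_getElem
    · simp [Circ.eval, natBits]
    · intro j h₁ h₂
      have hj : j < 𝒢.ordLen (κ i) := by simpa [natBits] using h₂
      simp only [Circ.eval, natBits, List.getElem_map, List.getElem_range', List.getElem_ofFn,
        List.getD_eq_getElem?_getD, List.getElem?_ofFn, Nat.testBit_div_two, one_mul]
      split_ifs with h
      · simp [Nat.add_comm]
      · have : j + 1 = 𝒢.ordLen (κ i) := by omega
        simp [this, Nat.testBit_lt_two_pow hN]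
  exact ((hpub.append (hbit.ite_elem (hpub.mul hacc hbase) hacc)).append
    (hpub.mul hbase hbase)).append hhalf

end PowState

namespace FeasibleFun

variable {g : ∀ i (x : X i), (𝒢.gen (κ i) (ω i x)).Carrier}

/-- Exponentiation by square-and-multiply. -/
theorem pow (hpub : FeasibleFun κ e fun i x => (𝒢.gen (κ i) (ω i x)).pub)
    (hg : FeasibleFun κ e fun i x => str ((𝒢.gen (κ i) (ω i x)).enc (g i x)))
    {N : ∀ i, X i → Fin (2 ^ 𝒢.ordLen (κ i))}
    (hN : FeasibleFun κ e fun i x => natBits (𝒢.ordLen (κ i)) (N i x)) :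
    FeasibleFun κ e fun i x => str ((𝒢.gen (κ i) (ω i x)).enc (g i x ^ (N i x).val)) := by
  have hone : FeasibleFun κ e fun i x => str ((𝒢.gen (κ i) (ω i x)).enc 1) :=
    (hpub.div hg hg).congr fun i x => by rw [div_self']
  have hread : FeasibleFun κ (fun i (z : PowState 𝒢 (κ i)) => z.encode)
      fun i z => str ((𝒢.gen (κ i) z.1).enc z.2.1) :=
    .slice (fixedLength_elem (ω := fun i (z : PowState 𝒢 (κ i)) => z.1))
      (fun i => 𝒢.descLen (κ i) + 𝒢.ordLen (κ i) + 𝒢.elemLen (κ i))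
      fun i z => ⟨(𝒢.gen (κ i) z.1).pub, _, by
        simp only [PowState.encode, List.append_assoc]; rfl, length_pub _⟩
  have hiter := hread.comp (FeasibleFun.iterate (f := fun i => PowState.step (k := κ i))
    PowState.fixedLength_encode PowState.feasible_step (𝒢.ordLen_poly.polyIn κ))
  refine (hiter.comp (f := fun i x => (⟨ω i x, 1, g i x, N i x⟩ : PowState 𝒢 (κ i)))
    (((hpub.append hone).append hg).append hN)).congr fun i x => ?_
  rw [PowState.iterate_step]
  simp only [one_mul, Nat.mod_eq_of_lt (N i x).2]

end FeasibleFun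

variable (𝒢) in
theorem fixedLength_exponent :
    FixedLength κ (X := fun i => Fin (2 ^ 𝒢.ordLen (κ i)))
      fun i r => natBits (𝒢.ordLen (κ i)) r :=
  (fixedLength_natBits (𝒢.ordLen_poly.polyIn κ)).comap fun _ => Fin.val

variable (𝒢) in
/-- What is computed from the input can also be computed after the sampling of an exponent. -/
theorem FeasibleFun.extend {f : ∀ i, X i → List Bool} (hf : FeasibleFun κ e f)
    (he : FixedLength κ e) :
    FeasibleFun κ (X := fun i => X i × Fin (2 ^ 𝒢.ordLen (κ i)))
      (fun i z => e i z.1 ++ natBits (𝒢.ordLen (κ i)) z.2) fun i z => f i z.1 :=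
  FeasibleFun.fst (enc := fun i (r : Fin (2 ^ 𝒢.ordLen (κ i))) => natBits (𝒢.ordLen (κ i)) r) he hf

/-- Sampling an exponent. In the input of the continuation the exponent is below `2 ^ ordLen`, since
only such numbers are determined by their encoding. -/
theorem Feasible.bind_below {G : ∀ i, X i → ℕ → PMF (List Bool)} (he : FixedLength κ e)
    (hpub : FeasibleFun κ e fun i x => (𝒢.gen (κ i) (ω i x)).pub)
    (hG : Feasible κ (X := fun i => X i × Fin (2 ^ 𝒢.ordLen (κ i)))
      (fun i z => e i z.1 ++ natBits (𝒢.ordLen (κ i)) z.2) fun i z => G i z.1 z.2) :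
    Feasible κ e fun i x => (_root_.below (𝒢.gen (κ i) (ω i x)).p).bind (G i x) := by
  have hlt (i) (x : X i) (r : ℕ) (hr : r ∈ (_root_.below (𝒢.gen (κ i) (ω i x)).p).support) :
      r % 2 ^ 𝒢.ordLen (κ i) = r := by
    refine Nat.mod_eq_of_lt (lt_trans ?_ (𝒢.gen (κ i) (ω i x)).lt)
    rw [_root_.below, dif_neg (𝒢.gen (κ i) (ω i x)).prime.ne_zero,
      PMF.mem_support_uniformOfFinset_iff] at hr
    exact Finset.mem_range.mp hr
  refine (Feasible.bind (Y := fun i => Fin (2 ^ 𝒢.ordLen (κ i)))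
    (f := fun i x => (_root_.below (𝒢.gen (κ i) (ω i x)).p).map fun r =>
      ⟨r % 2 ^ 𝒢.ordLen (κ i), Nat.mod_lt _ (by positivity)⟩)
    (enc := fun i r => natBits (𝒢.ordLen (κ i)) r) (G := fun i x r => G i x r) he ?_ hG).congr
    fun i x => ?_
  · refine (Feasible.below (𝒢.ordLen_poly.polyIn κ) hpub.order fun i x =>
      (𝒢.gen (κ i) (ω i x)).lt).congr fun i x => ?_
    rw [PMF.map_comp, ← PMF.bind_pure_comp, ← PMF.bind_pure_comp]
    refine PMF.bind_congr_support fun r hr => ?_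
    simp only [Function.comp_apply, hlt i x r hr]
  · rw [PMF.bind_map]
    refine PMF.bind_congr_support fun r hr => ?_
    simp only [Function.comp_apply, hlt i x r hr]

end GroupOperations

/-! ### Uniform group elements -/

namespace GroupInstance

variable {l₁ l₂ l₃ : ℕ} (G : GroupInstance l₁ l₂ l₃)

theorem bijective_pow : Function.Bijective fun r : Fin G.p => G.g ^ r.val := by
  classical
  have hord : orderOf G.g = G.p := by
    rw [← G.card]
    exact orderOf_eq_card_of_forall_mem_zpowers G.generates
  have hpos : 0 < orderOf G.g := hord ▸ G.prime.pos
  constructor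
  · intro r s hrs
    have := pow_inj_mod.mp hrs
    rw [hord, Nat.mod_eq_of_lt r.2, Nat.mod_eq_of_lt s.2] at this
    exact Fin.ext this
  · intro x
    obtain ⟨m, hm, rfl⟩ := (isOfFinOrder_iff_pow_eq_one.mpr
      ⟨_, hpos, pow_orderOf_eq_one _⟩).mem_zpowers_iff_mem_range_orderOf.mp (G.generates x)
        |> Finset.mem_image.mp
    exact ⟨⟨m, by simpa [hord] using hm⟩, rfl⟩

/-- A uniform power of the generator is a uniform group element. -/
theorem bind_pow_perm {β : Type} (π : Equiv.Perm G.Carrier) (K : G.Carrier → PMF β) :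
    ((below G.p).bind fun r => K (π (G.g ^ r))) = (below G.p).bind fun r => K (G.g ^ r) := by
  have : NeZero G.p := ⟨G.prime.ne_zero⟩
  let f : Fin G.p ≃ G.Carrier := Equiv.ofBijective _ G.bijective_pow
  let _ : Fintype G.Carrier := Fintype.ofEquiv _ f
  have h (π : Equiv.Perm G.Carrier) : ((below G.p).bind fun r => K (π (G.g ^ r))) =
      (PMF.uniformOfFintype G.Carrier).bind K := by
    rw [below_eq_map, PMF.bind_map, ← map_uniformOfFintype_equiv (f.trans π), PMF.bind_map]
    rfl
  rw [h π, ← h (Equiv.refl _)]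
  rfl

end GroupInstance

/-! ### Executions of the protocol -/

/-- A repetition of the first query after the second one returns the first answer. -/
theorem Rom.hash_hash_hash {n : ℕ} {α : Type} (q r : List Bool)
    (K : Bits n → Bits n → Bits n → Rom n α) :
    (do let y ← hash q; let z ← hash r; let y' ← hash q; K y z y') =
      (do let y ← hash q; let z ← hash r; K y z y) := by
  rw [← Rom.hash_hash q fun y y' => (do let z ← hash r; K y z y')]
  refine bind_congr fun y => ?_
  rw [Rom.hash_comm_hash]

namespace DQOT

variable {l₁ l₂ l₃ n c : ℕ} (G : GroupInstance l₁ l₂ l₃)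

variable {G} in
/-- The power `b ^ (r₂ ± r₁)` with the exponent that the receiver computes from `s₂`, `r₁`, `r₂`. -/
def receiverPower (b : G.Carrier) (s₂ : Bool) (r₁ r₂ : ℕ) : G.Carrier :=
  if s₂ then b ^ r₂ / b ^ r₁ else b ^ r₂ * b ^ r₁

theorem zpow_eq_receiverPower (b : G.Carrier) (s₂ : Bool) (r₁ r₂ : ℕ) :
    b ^ ((r₂ : ℤ) + r₁ * (-1) ^ s₂.toNat) = receiverPower b s₂ r₁ r₂ := by
  cases s₂ <;> simp [receiverPower, zpow_add, div_eq_mul_inv]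

theorem receiverPower_pow (b : G.Carrier) (s₂ : Bool) (r₁ r₂ y : ℕ) :
    receiverPower (b ^ y) s₂ r₁ r₂ = receiverPower b s₂ r₁ r₂ ^ y := by
  cases s₂ <;> simp [receiverPower, mul_pow, div_pow, ← pow_mul, Nat.mul_comm]

/-- The receiver knows the exponent of the component of the combined query with index `s`. -/
theorem genQuery_eq (C : G.Carrier) (s s₁ : Bool) (r₁ r₂ : ℕ) (b : Bool) :
    genQuery₁ G (genQuery₂ G C (xor s₁ s) r₂) s₁ r₁ b =
      if b = s then receiverPower G.g (xor s₁ s) r₁ r₂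
      else C / receiverPower G.g (xor s₁ s) r₁ r₂ := by
  cases s <;> cases s₁ <;> cases b <;>
    simp [genQuery₁, genQuery₂, receiverPower, div_eq_mul_inv, mul_comm, mul_left_comm]

/-- The view of the receiver; `u` and `u'` are the encryptions of `m_s` and of the other message,
with the group elements `A` and `B`. -/
def receiverView (s s₁ : Bool) (r₁ r₂ : ℕ) (C A B : G.Carrier) (u u' ms : Bits n) : List Bool :=
  [s, s₁, xor s₁ s] ++ natBits l₂ r₁ ++ natBits l₂ r₂ ++ G.pub ++ str (G.enc C) ++
    str (G.enc (if s then B else A)) ++ (if s then str u' else str u) ++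
    str (G.enc (if s then A else B)) ++ (if s then str u else str u') ++ str ms

/-- The result of an execution as a function of the coins; `y` and `h` belong to the message `m_s`,
`y'` and `h'` to the other message. -/
def outcome (ω : Bits c) (m : Bool → Bits n) (s : Bool) (a : ℕ) (s₁ : Bool) (r₁ r₂ y y' : ℕ)
    (h h' : Bits n) : Execution where
  view
    | .S => str (m false) ++ str (m true) ++ str ω ++ natBits l₂ a ++
        natBits l₂ (if s then y' else y) ++ natBits l₂ (if s then y else y') ++ G.pub ++
        str (G.enc (G.g ^ a)) ++
        str (G.enc (if s then G.g ^ a / receiverPower G.g (xor s₁ s) r₁ r₂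
          else receiverPower G.g (xor s₁ s) r₁ r₂)) ++
        str (G.enc (if s then receiverPower G.g (xor s₁ s) r₁ r₂
          else G.g ^ a / receiverPower G.g (xor s₁ s) r₁ r₂))
    | .P1 => G.pub ++ str (G.enc (G.g ^ a)) ++ [s₁] ++ natBits l₂ r₁ ++
        encPair G (genQuery₂ G (G.g ^ a) (xor s₁ s) r₂)
    | .P2 => G.pub ++ str (G.enc (G.g ^ a)) ++ [xor s₁ s] ++ natBits l₂ r₂
    | .R => receiverView G s s₁ r₁ r₂ (G.g ^ a) (G.g ^ y) (G.g ^ y') (bxor h (m s))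
        (bxor h' (m !s)) (m s)
  output P := some (dqotFunctionality m s P)

theorem bxor_bxor_cancel (x y : Bits n) : bxor x (bxor x y) = y := by
  funext i
  simp [bxor]

/-- The execution, with the choices of the sender listed by their role for the receiver. The last
query of the protocol, by the receiver, repeats a query of the sender. -/
theorem exec_eq (ω : Bits c) (m : Bool → Bits n) (s : Bool) :
    (exec G ω m s : Rom n Execution) = (do
      let a ← (below G.p : PMF ℕ)
      let s₁ ← (PMF.uniformOfFintype Bool : PMF Bool)
      let r₁ ← (below G.p : PMF ℕ)
      let r₂ ← (below G.p : PMF ℕ)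
      let y ← (below G.p : PMF ℕ)
      let y' ← (below G.p : PMF ℕ)
      let h ← hash (str (G.enc (receiverPower G.g (xor s₁ s) r₁ r₂ ^ y)))
      let h' ← hash (str (G.enc ((G.g ^ a / receiverPower G.g (xor s₁ s) r₁ r₂) ^ y')))
      pure (outcome G ω m s a s₁ r₁ r₂ y y' h h')) := by
  unfold exec
  refine bind_congr fun a => ?_
  have hshare : (liftM (share s) : Rom n (Bool × Bool)) =
      liftM (PMF.uniformOfFintype Bool) >>= fun s₁ => pure (s₁, xor s₁ s) := by
    rw [← funext fun s₁ => Rom.lift_pure (n := n) ((s₁, xor s₁ s) : Bool × Bool), ← Rom.lift_bind]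
    rfl
  rw [hshare]
  simp only [bind_assoc, LawfulMonad.pure_bind]
  refine bind_congr fun s₁ => bind_congr fun r₁ => bind_congr fun r₂ => ?_
  generalize hx : receiverPower G.g (xor s₁ s) r₁ r₂ = x
  have hf : genQuery₁ G (genQuery₂ G (G.g ^ a) (xor s₁ s) r₂) s₁ r₁ false =
      if s then G.g ^ a / x else x := by
    rw [genQuery_eq, hx]; cases s <;> simp
  have ht : genQuery₁ G (genQuery₂ G (G.g ^ a) (xor s₁ s) r₂) s₁ r₁ true =
      if s then x else G.g ^ a / x := by
    rw [genQuery_eq, hx]; cases s <;> simp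
  have hprod : (if s then G.g ^ a / x else x) * (if s then x else G.g ^ a / x) = G.g ^ a := by
    cases s <;> simp
  have hret (y : ℕ) : (G.g ^ y) ^ ((r₂ : ℤ) + r₁ * (-1) ^ (xor s₁ s).toNat) = x ^ y := by
    rw [zpow_eq_receiverPower, receiverPower_pow, hx]
  simp only [genRes, encPair, hf, ht, hprod, if_true, bind_assoc, LawfulMonad.pure_bind, retrieve]
  cases s
  · refine bind_congr fun y₀ => bind_congr fun y₁ => ?_
    simp only [Bool.false_eq_true, if_false, hret]
    rw [Rom.hash_hash_hash]
    refine bind_congr fun h => bind_congr fun h' => congrArg pure ?_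
    simp only [Option.map_some, bxor_bxor_cancel, outcome, hx, Execution.mk.injEq]
    refine ⟨funext fun P => ?_, funext fun P => ?_⟩
    · cases P <;> simp [partyInput, receiverView, encRes, encPair]
    · cases P <;> rfl
  · rw [Rom.lift_comm_lift]
    refine bind_congr fun y₁ => bind_congr fun y₀ => ?_
    simp only [if_true, hret]
    rw [Rom.hash_comm_hash, Rom.hash_hash_hash]
    refine bind_congr fun h => bind_congr fun h' => congrArg pure ?_
    simp only [Option.map_some, bxor_bxor_cancel, outcome, hx, Execution.mk.injEq]
    refine ⟨funext fun P => ?_, funext fun P => ?_⟩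
    · cases P <;> simp [partyInput, receiverView, encRes, encPair]
    · cases P <;> rfl

end DQOT

namespace DQOT

/-! ### Simulation of the sender and of the helpers -/

section Perfect

variable {𝒢 : GroupGen} {σ : ℕ → ℕ}

theorem dist_run_bind {n : ℕ} {c : Circ} (hc : c.OracleFree) (x : List Bool) (D : Circ) :
    ((c.run x : Rom n _) >>= fun v => D.run v).dist =
      (c.law x).bind fun v => (D.run v : Rom n _).dist := by
  rw [c.run_eq_law hc, Rom.dist_lift_bind]

/-- The law of a function of the coins of an execution. The exponents `y` and `y'` of the sender are
those of the chosen and of the other message, and the function may use further coins. -/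
def coinsLaw {β : Type} (𝒢 : GroupGen) (k : ℕ)
    (v : Bits (𝒢.coinLen k) → ℕ → Bool → ℕ → ℕ → ℕ → ℕ → PMF β) : PMF β :=
  (𝒢.coins k).bind fun ω => (below (𝒢.gen k ω).p).bind fun a =>
    (PMF.uniformOfFintype Bool).bind fun s₁ => (below (𝒢.gen k ω).p).bind fun r₁ =>
    (below (𝒢.gen k ω).p).bind fun r₂ => (below (𝒢.gen k ω).p).bind fun y =>
    (below (𝒢.gen k ω).p).bind fun y' => v ω a s₁ r₁ r₂ y y'

theorem coinsLaw_bind {β γ : Type} (k : ℕ)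
    (v : Bits (𝒢.coinLen k) → ℕ → Bool → ℕ → ℕ → ℕ → ℕ → PMF β) (f : β → PMF γ) :
    (coinsLaw 𝒢 k v).bind f =
      coinsLaw 𝒢 k fun ω a s₁ r₁ r₂ y y' => (v ω a s₁ r₁ r₂ y y').bind f := by
  simp only [coinsLaw, PMF.bind_bind]

theorem protocol_bind_dist {β : Type} (k : ℕ) (m : Bool → Bits (σ k)) (s : Bool)
    (K : Execution → Rom (σ k) β) :
    (protocol 𝒢 σ k m s >>= K).dist = coinsLaw 𝒢 k fun ω a s₁ r₁ r₂ y y' =>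
      (do let h ← hash (str ((𝒢.gen k ω).enc
            (receiverPower (𝒢.gen k ω).g (xor s₁ s) r₁ r₂ ^ y)))
          let h' ← hash (str ((𝒢.gen k ω).enc
            (((𝒢.gen k ω).g ^ a / receiverPower (𝒢.gen k ω).g (xor s₁ s) r₁ r₂) ^ y')))
          K (outcome (𝒢.gen k ω) ω m s a s₁ r₁ r₂ y y' h h') : Rom (σ k) β).dist := by
  simp only [protocol, exec_eq, bind_assoc, LawfulMonad.pure_bind, Rom.dist_lift_bind, coinsLaw]

/-- A view that does not depend on the answers of the oracle is simulated perfectly. -/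
theorem exists_simulator (P : Party)
    (v : ∀ k, (Bool → Bits (σ k)) → Bool → Bits (𝒢.coinLen k) →
      ℕ → Bool → ℕ → ℕ → ℕ → ℕ → List Bool)
    (hv : ∀ k m s ω a s₁ r₁ r₂ y y' h h',
      (outcome (𝒢.gen k ω) ω m s a s₁ r₁ r₂ y y' h h').view P = v k m s ω a s₁ r₁ r₂ y y')
    (h : Feasible id (X := fun k => (Bool → Bits (σ k)) × Bool)
      (fun _ x => partyInput x.1 x.2 P ++ dqotFunctionality x.1 x.2 P)
      fun k x => coinsLaw 𝒢 k fun ω a s₁ r₁ r₂ y y' =>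
        PMF.pure (v k x.1 x.2 ω a s₁ r₁ r₂ y y')) :
    ∃ Sim : ℕ → Circ, PolySize Sim ∧
      CompIndist (fun k m s => (Sim k).run (partyInput m s P ++ dqotFunctionality m s P))
        (fun k m s => do
          let e ← protocol 𝒢 σ k m s
          pure (e.view P)) := by
  obtain ⟨c, hc, h⟩ := h
  refine ⟨c, hc, fun D _ => ⟨0, Asymptotics.superpolynomialDecay_zero _ _, fun k m s => ?_⟩⟩
  suffices acceptProb (D k) ((c k).run (partyInput m s P ++ dqotFunctionality m s P)) =
      acceptProb (D k) (protocol 𝒢 σ k m s >>= fun e => pure (e.view P)) by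
    rw [this]
    simp
  rw [acceptProb, acceptProb, dist_run_bind (h k).1, (h k).2 (m, s), coinsLaw_bind, bind_assoc,
    protocol_bind_dist]
  simp only [LawfulMonad.pure_bind, hv, PMF.pure_bind]
  congr 3
  funext ω a s₁ r₁ r₂ y y'
  -- the two queries of the protocol have no effect on the distinguisher
  rw [((Circ.isOracleComp_run _ _).dist_hash_bind _).symm]
  exact (Rom.IsOracleComp.dist_hash_bind
    (.bind (.query _) fun _ => Circ.isOracleComp_run _ _) _).symm

/-- The string that is simulated for the sender: `t` is uniform, so that `g ^ t` is a uniform first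
component of the combined query. -/
theorem sender_law (k : ℕ) (s : Bool)
    {β : Type} (K : ∀ ω : Bits (𝒢.coinLen k), ℕ → ℕ → ℕ → (𝒢.gen k ω).Carrier → PMF β) :
    (coinsLaw 𝒢 k fun ω a s₁ r₁ r₂ y y' => K ω a (if s then y' else y) (if s then y else y')
        (if s then (𝒢.gen k ω).g ^ a / receiverPower (𝒢.gen k ω).g (xor s₁ s) r₁ r₂
          else receiverPower (𝒢.gen k ω).g (xor s₁ s) r₁ r₂)) =
      (𝒢.coins k).bind fun ω => (below (𝒢.gen k ω).p).bind fun a =>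
        (below (𝒢.gen k ω).p).bind fun y₀ => (below (𝒢.gen k ω).p).bind fun y₁ =>
        (below (𝒢.gen k ω).p).bind fun t => K ω a y₀ y₁ ((𝒢.gen k ω).g ^ t) := by
  unfold coinsLaw
  congr 1
  funext ω
  congr 1
  funext a
  set G := 𝒢.gen k ω
  -- for all other coins fixed, the map from `g ^ r₂` to the component is a permutation
  have hmask (L : G.Carrier → PMF β) (s₁ : Bool) (r₁ : ℕ) : ((below G.p).bind fun r₂ =>
      L (if s then G.g ^ a / receiverPower G.g (xor s₁ s) r₁ r₂
        else receiverPower G.g (xor s₁ s) r₁ r₂)) = (below G.p).bind fun t => L (G.g ^ t) := by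
    rw [← G.bind_pow_perm ((Equiv.mulRight
      (if xor s₁ s then (G.g ^ r₁)⁻¹ else G.g ^ r₁)).trans
      (if s then Equiv.divLeft (G.g ^ a) else Equiv.refl _)) L]
    congr 1
    funext r₂
    cases s <;> cases s₁ <;> simp [receiverPower, div_eq_mul_inv]
  have hswap (L : ℕ → ℕ → PMF β) : ((below G.p).bind fun y => (below G.p).bind fun y' =>
      L (if s then y' else y) (if s then y else y')) =
      (below G.p).bind fun y₀ => (below G.p).bind fun y₁ => L y₀ y₁ := by
    cases s
    · simp
    · simp only [if_true]
      rw [PMF.bind_comm]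
  have h (s₁ : Bool) (r₁ : ℕ) : ((below G.p).bind fun r₂ => (below G.p).bind fun y =>
      (below G.p).bind fun y' => K ω a (if s then y' else y) (if s then y else y')
        (if s then G.g ^ a / receiverPower G.g (xor s₁ s) r₁ r₂
          else receiverPower G.g (xor s₁ s) r₁ r₂)) =
      (below G.p).bind fun t => (below G.p).bind fun y₀ => (below G.p).bind fun y₁ =>
        K ω a y₀ y₁ (G.g ^ t) := by
    rw [hmask fun z => (below G.p).bind fun y => (below G.p).bind fun y' =>
      K ω a (if s then y' else y) (if s then y else y') z]
    congr 1
    funext t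
    exact hswap fun y₀ y₁ => K ω a y₀ y₁ _
  refine (congrArg (PMF.bind _) (funext fun s₁ => congrArg (PMF.bind _) (funext (h s₁)))).trans ?_
  rw [PMF.bind_const, PMF.bind_const, PMF.bind_comm]
  congr 1
  funext y₀
  rw [PMF.bind_comm]

theorem feasible_sender (hσ : PolyBounded σ) :
    Feasible id (X := fun k => (Bool → Bits (σ k)) × Bool)
      (fun _ x => partyInput x.1 x.2 .S ++ dqotFunctionality x.1 x.2 .S) fun k x =>
      (𝒢.coins k).bind fun ω => (below (𝒢.gen k ω).p).bind fun a =>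
        (below (𝒢.gen k ω).p).bind fun y₀ => (below (𝒢.gen k ω).p).bind fun y₁ =>
        (below (𝒢.gen k ω).p).bind fun t => PMF.pure (str (x.1 false) ++ str (x.1 true) ++ str ω ++
          natBits (𝒢.ordLen k) a ++ natBits (𝒢.ordLen k) y₀ ++ natBits (𝒢.ordLen k) y₁ ++
          (𝒢.gen k ω).pub ++ str ((𝒢.gen k ω).enc ((𝒢.gen k ω).g ^ a)) ++
          str ((𝒢.gen k ω).enc ((𝒢.gen k ω).g ^ t)) ++
          str ((𝒢.gen k ω).enc ((𝒢.gen k ω).g ^ a / (𝒢.gen k ω).g ^ t))) := by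
  have hcoin : PolyIn id 𝒢.coinLen := 𝒢.coinLen_poly
  have he : FixedLength id (X := fun k => (Bool → Bits (σ k)) × Bool)
      (fun _ x => partyInput x.1 x.2 .S ++ dqotFunctionality x.1 x.2 .S) :=
    ⟨_, PolyIn.add (hσ.polyIn id) (hσ.polyIn id), fun k x => by
      simp [partyInput, dqotFunctionality, length_str]⟩
  have hin := FeasibleFun.input he
  refine Feasible.bind (Y := fun k => Bits (𝒢.coinLen k)) (enc := fun _ ω => str ω) he
    (.bits hcoin) ?_
  have hω := FeasibleFun.snd he (fixedLength_str hcoin)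
  replace hin := hin.fst (enc := fun k (ω : Bits (𝒢.coinLen k)) => str ω) he
  replace he := he.append (fixedLength_str hcoin)
  refine Feasible.bind_below (ω := fun _ x => x.2) he hω.pub ?_
  have ha := FeasibleFun.snd he (fixedLength_exponent 𝒢)
  replace hω := hω.extend 𝒢 he
  replace hin := hin.extend 𝒢 he
  replace he := he.append (fixedLength_exponent 𝒢)
  refine Feasible.bind_below (ω := fun _ x => x.1.2) he hω.pub ?_
  have hy₀ := FeasibleFun.snd he (fixedLength_exponent 𝒢)
  replace hω := hω.extend 𝒢 he
  replace hin := hin.extend 𝒢 he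
  replace ha := ha.extend 𝒢 he
  replace he := he.append (fixedLength_exponent 𝒢)
  refine Feasible.bind_below (ω := fun _ x => x.1.1.2) he hω.pub ?_
  have hy₁ := FeasibleFun.snd he (fixedLength_exponent 𝒢)
  replace hω := hω.extend 𝒢 he
  replace hin := hin.extend 𝒢 he
  replace ha := ha.extend 𝒢 he
  replace hy₀ := hy₀.extend 𝒢 he
  replace he := he.append (fixedLength_exponent 𝒢)
  refine Feasible.bind_below (ω := fun _ x => x.1.1.1.2) he hω.pub ?_
  have ht := FeasibleFun.snd he (fixedLength_exponent 𝒢)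
  replace hω := hω.extend 𝒢 he
  replace hin := hin.extend 𝒢 he
  replace ha := ha.extend 𝒢 he
  replace hy₀ := hy₀.extend 𝒢 he
  replace hy₁ := hy₁.extend 𝒢 he
  have hpub := hω.pub
  have hC := hpub.pow hpub.gen ha
  have ht' := hpub.pow hpub.gen ht
  exact (((((((((hin.append hω).append ha).append hy₀).append hy₁).append hpub).append hC).append
    ht').append (hpub.div hC ht'))).congr fun k x => by
    simp [partyInput, dqotFunctionality]

/-- The first helper sees a uniform group element in place of the first component of the query of
the second helper. -/
theorem helper₁_law (k : ℕ) (s : Bool)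
    {β : Type} (K : ∀ ω : Bits (𝒢.coinLen k), ℕ → Bool → ℕ → (𝒢.gen k ω).Carrier → PMF β) :
    (coinsLaw 𝒢 k fun ω a s₁ r₁ r₂ _ _ =>
        K ω a s₁ r₁ (genQuery₂ (𝒢.gen k ω) ((𝒢.gen k ω).g ^ a) (xor s₁ s) r₂ false)) =
      (𝒢.coins k).bind fun ω => (below (𝒢.gen k ω).p).bind fun a =>
        (PMF.uniformOfFintype Bool).bind fun s₁ => (below (𝒢.gen k ω).p).bind fun r₁ =>
        (below (𝒢.gen k ω).p).bind fun t => K ω a s₁ r₁ ((𝒢.gen k ω).g ^ t) := by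
  unfold coinsLaw
  congr 1
  funext ω
  congr 1
  funext a
  congr 1
  funext s₁
  congr 1
  funext r₁
  rw [← (𝒢.gen k ω).bind_pow_perm
    (if false = xor s₁ s then Equiv.refl _ else Equiv.divLeft ((𝒢.gen k ω).g ^ a))
    (K ω a s₁ r₁)]
  congr 1
  funext r₂
  simp only [PMF.bind_const, genQuery₂]
  split_ifs <;> rfl

theorem feasible_helper₁ :
    Feasible id (X := fun k => (Bool → Bits (σ k)) × Bool)
      (fun _ x => partyInput x.1 x.2 .P1 ++ dqotFunctionality x.1 x.2 .P1) fun k _ =>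
      (𝒢.coins k).bind fun ω => (below (𝒢.gen k ω).p).bind fun a =>
        (PMF.uniformOfFintype Bool).bind fun s₁ => (below (𝒢.gen k ω).p).bind fun r₁ =>
        (below (𝒢.gen k ω).p).bind fun t => PMF.pure ((𝒢.gen k ω).pub ++
          str ((𝒢.gen k ω).enc ((𝒢.gen k ω).g ^ a)) ++ [s₁] ++ natBits (𝒢.ordLen k) r₁ ++
          str ((𝒢.gen k ω).enc ((𝒢.gen k ω).g ^ t)) ++
          str ((𝒢.gen k ω).enc ((𝒢.gen k ω).g ^ a / (𝒢.gen k ω).g ^ t))) := by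
  have hcoin : PolyIn id 𝒢.coinLen := 𝒢.coinLen_poly
  have he : FixedLength id (X := fun k => (Bool → Bits (σ k)) × Bool)
      (fun _ x => partyInput x.1 x.2 .P1 ++ dqotFunctionality x.1 x.2 .P1) :=
    ⟨_, .const 0, fun _ _ => rfl⟩
  refine Feasible.bind (Y := fun k => Bits (𝒢.coinLen k)) (enc := fun _ ω => str ω) he
    (.bits hcoin) ?_
  have hω := FeasibleFun.snd he (fixedLength_str hcoin)
  replace he := he.append (fixedLength_str hcoin)
  refine Feasible.bind_below (ω := fun _ x => x.2) he hω.pub ?_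
  have ha := FeasibleFun.snd he (fixedLength_exponent 𝒢)
  replace hω := hω.extend 𝒢 he
  replace he := he.append (fixedLength_exponent 𝒢)
  refine Feasible.bind (Y := fun _ => Bool) (enc := fun _ b => [b]) he .coin ?_
  have hs₁ := FeasibleFun.snd he fixedLength_bit
  replace hω := hω.fst (enc := fun _ (b : Bool) => [b]) he
  replace ha := ha.fst (enc := fun _ (b : Bool) => [b]) he
  replace he := he.append fixedLength_bit
  refine Feasible.bind_below (ω := fun _ x => x.1.1.2) he hω.pub ?_
  have hr₁ := FeasibleFun.snd he (fixedLength_exponent 𝒢)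
  replace hω := hω.extend 𝒢 he
  replace ha := ha.extend 𝒢 he
  replace hs₁ := hs₁.extend 𝒢 he
  replace he := he.append (fixedLength_exponent 𝒢)
  refine Feasible.bind_below (ω := fun _ x => x.1.1.1.2) he hω.pub ?_
  have ht := FeasibleFun.snd he (fixedLength_exponent 𝒢)
  have hpub := (hω.extend 𝒢 he).pub
  have hC := hpub.pow hpub.gen (ha.extend 𝒢 he)
  have ht' := hpub.pow hpub.gen ht
  exact ((((hpub.append hC).append (hs₁.extend 𝒢 he)).append (hr₁.extend 𝒢 he)).append
    ht').append (hpub.div hC ht')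

/-- The share `s₂ = s₁ xor s` is uniform. -/
theorem helper₂_law (k : ℕ) (s : Bool)
    {β : Type} (K : Bits (𝒢.coinLen k) → ℕ → Bool → ℕ → PMF β) :
    (coinsLaw 𝒢 k fun ω a s₁ _ r₂ _ _ => K ω a (xor s₁ s) r₂) =
      (𝒢.coins k).bind fun ω => (below (𝒢.gen k ω).p).bind fun a =>
        (PMF.uniformOfFintype Bool).bind fun s₂ => (below (𝒢.gen k ω).p).bind fun r₂ =>
        K ω a s₂ r₂ := by
  unfold coinsLaw
  simp only [PMF.bind_const]
  congr 1
  funext ω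
  congr 1
  funext a
  conv_rhs =>
    rw [← map_uniformOfFintype_equiv (if s then Equiv.boolNot else Equiv.refl Bool), PMF.bind_map]
  congr 1
  funext s₁
  cases s <;> cases s₁ <;> rfl

theorem feasible_helper₂ :
    Feasible id (X := fun k => (Bool → Bits (σ k)) × Bool)
      (fun _ x => partyInput x.1 x.2 .P2 ++ dqotFunctionality x.1 x.2 .P2) fun k _ =>
      (𝒢.coins k).bind fun ω => (below (𝒢.gen k ω).p).bind fun a =>
        (PMF.uniformOfFintype Bool).bind fun s₂ => (below (𝒢.gen k ω).p).bind fun r₂ =>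
        PMF.pure ((𝒢.gen k ω).pub ++ str ((𝒢.gen k ω).enc ((𝒢.gen k ω).g ^ a)) ++ [s₂] ++
          natBits (𝒢.ordLen k) r₂) := by
  have hcoin : PolyIn id 𝒢.coinLen := 𝒢.coinLen_poly
  have he : FixedLength id (X := fun k => (Bool → Bits (σ k)) × Bool)
      (fun _ x => partyInput x.1 x.2 .P2 ++ dqotFunctionality x.1 x.2 .P2) :=
    ⟨_, .const 0, fun _ _ => rfl⟩
  refine Feasible.bind (Y := fun k => Bits (𝒢.coinLen k)) (enc := fun _ ω => str ω) he
    (.bits hcoin) ?_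
  have hω := FeasibleFun.snd he (fixedLength_str hcoin)
  replace he := he.append (fixedLength_str hcoin)
  refine Feasible.bind_below (ω := fun _ x => x.2) he hω.pub ?_
  have ha := FeasibleFun.snd he (fixedLength_exponent 𝒢)
  replace hω := hω.extend 𝒢 he
  replace he := he.append (fixedLength_exponent 𝒢)
  refine Feasible.bind (Y := fun _ => Bool) (enc := fun _ b => [b]) he .coin ?_
  have hs₂ := FeasibleFun.snd he fixedLength_bit
  replace hω := hω.fst (enc := fun _ (b : Bool) => [b]) he
  replace ha := ha.fst (enc := fun _ (b : Bool) => [b]) he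
  replace he := he.append fixedLength_bit
  refine Feasible.bind_below (ω := fun _ x => x.1.1.2) he hω.pub ?_
  have hpub := (hω.extend 𝒢 he).pub
  exact ((hpub.append (hpub.pow hpub.gen (ha.extend 𝒢 he))).append (hs₂.extend 𝒢 he)).append
    (FeasibleFun.snd he (fixedLength_exponent 𝒢))

theorem exists_simulator_sender (hσ : PolyBounded σ) :
    ∃ Sim : ℕ → Circ, PolySize Sim ∧
      CompIndist (fun k m s => (Sim k).run (partyInput m s .S ++ dqotFunctionality m s .S))
        (fun k m s => do
          let e ← protocol 𝒢 σ k m s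
          pure (e.view .S)) := by
  refine exists_simulator .S _ (fun _ _ _ _ _ _ _ _ _ _ _ _ => rfl)
    ((feasible_sender (𝒢 := 𝒢) hσ).congr fun k x => ?_)
  rw [← sender_law k x.2 fun ω a y₀ y₁ z => PMF.pure (str (x.1 false) ++ str (x.1 true) ++
    str ω ++ natBits (𝒢.ordLen k) a ++ natBits (𝒢.ordLen k) y₀ ++ natBits (𝒢.ordLen k) y₁ ++
    (𝒢.gen k ω).pub ++ str ((𝒢.gen k ω).enc ((𝒢.gen k ω).g ^ a)) ++
    str ((𝒢.gen k ω).enc z) ++ str ((𝒢.gen k ω).enc ((𝒢.gen k ω).g ^ a / z)))]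
  congr 1
  funext ω a s₁ r₁ r₂ y y'
  cases x.2 <;> simp

theorem exists_simulator_helper₁ :
    ∃ Sim : ℕ → Circ, PolySize Sim ∧
      CompIndist (fun k m s => (Sim k).run (partyInput m s .P1 ++ dqotFunctionality m s .P1))
        (fun k m s => do
          let e ← protocol 𝒢 σ k m s
          pure (e.view .P1)) := by
  refine exists_simulator .P1 _ (fun _ _ _ _ _ _ _ _ _ _ _ _ => rfl)
    ((feasible_helper₁ (𝒢 := 𝒢)).congr fun k x => ?_)
  rw [← helper₁_law k x.2 fun ω a s₁ r₁ z => PMF.pure ((𝒢.gen k ω).pub ++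
    str ((𝒢.gen k ω).enc ((𝒢.gen k ω).g ^ a)) ++ [s₁] ++ natBits (𝒢.ordLen k) r₁ ++
    str ((𝒢.gen k ω).enc z) ++ str ((𝒢.gen k ω).enc ((𝒢.gen k ω).g ^ a / z)))]
  congr 1
  funext ω a s₁ r₁ r₂ y y'
  cases h : xor s₁ x.2 <;> simp [encPair, genQuery₂]

theorem exists_simulator_helper₂ :
    ∃ Sim : ℕ → Circ, PolySize Sim ∧
      CompIndist (fun k m s => (Sim k).run (partyInput m s .P2 ++ dqotFunctionality m s .P2))
        (fun k m s => do
          let e ← protocol 𝒢 σ k m s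
          pure (e.view .P2)) :=
  exists_simulator .P2 _ (fun _ _ _ _ _ _ _ _ _ _ _ _ => rfl)
    ((feasible_helper₂ (𝒢 := 𝒢)).congr fun k x => (helper₂_law k x.2 fun ω a s₂ r₂ => PMF.pure
      ((𝒢.gen k ω).pub ++ str ((𝒢.gen k ω).enc ((𝒢.gen k ω).g ^ a)) ++ [s₂] ++
        natBits (𝒢.ordLen k) r₂)).symm)

/-- Every execution gives every party its output. -/
theorem output_eq {k : ℕ} {m : Bool → Bits (σ k)} {s : Bool} {e : Execution}
    (he : e ∈ (protocol 𝒢 σ k m s).dist.support) (P : Party) :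
    e.output P = some (dqotFunctionality m s P) := by
  rw [← bind_pure (protocol 𝒢 σ k m s), protocol_bind_dist] at he
  simp only [coinsLaw, PMF.mem_support_bind_iff, Rom.dist, PMF.mem_support_map_iff,
    Rom.run_bind_eq, Rom.run_pure_eq, PMF.mem_support_pure_iff] at he
  obtain ⟨ω, -, a, -, s₁, -, r₁, -, r₂, -, y, -, y', -, z, ⟨h, -, h', -, rfl⟩, rfl⟩ := he
  rfl

end Perfect

end DQOT

/-! ### Identical until bad -/

/-- Replacing the answer of the oracle to `q` by an independent uniform string is noticed only by
querying `q`. -/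
theorem Rom.expect_uniform_le {n : ℕ} {α : Type} {K : Bits n → Rom n α}
    (hK : ∀ y, IsOracleComp (K y)) (q : List Bool) (t : List Bool → Option (Bits n))
    {φ : α → ENNReal} (hφ : ∀ a, φ a ≤ 1) :
    ((PMF.uniformOfFintype (Bits n)).bind fun y => (K y).run t).expect (fun o => φ o.1) ≤
      ((hash q >>= K).run t).expect (fun o => φ o.1) +
        ((PMF.uniformOfFintype (Bits n)).bind fun y => (K y).run t).expect
          fun o => if o.2 q = none then 0 else 1 := by
  classical
  rw [run_bind_eq]
  cases h : t q with
  -- if `q` has been queried before, the error term on the right is already `1`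
  | some z =>
    refine le_add_left ?_
    simp only [PMF.expect_bind]
    refine PMF.expect_mono fun y _ => PMF.expect_mono fun o ho => ?_
    rw [(hK y).run_extends ho h, if_neg (by simp)]
    exact hφ _
  | none =>
    simp only [hash_run_of_none h, PMF.bind_bind, PMF.pure_bind, PMF.expect_bind]
    rw [← PMF.expect_add]
    refine PMF.expect_mono fun y _ => ?_
    have hle := (hK y).expect_le_programmed h y
      (fun o => if o.2 q = none then φ o.1 else 0) fun o ho => if_neg ho
    refine le_trans (b := ((K y).run t).expect fun o =>
      (if o.2 q = none then φ o.1 else 0) + if o.2 q = none then 0 else 1) ?_ ?_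
    · refine PMF.expect_mono fun o _ => ?_
      split_ifs
      · simp
      · simpa using hφ o.1
    · rw [PMF.expect_add]
      gcongr
      refine hle.trans (PMF.expect_mono fun o _ => ?_)
      split_ifs <;> simp

/-- A one-sided bound for all tests gives a two-sided one, by passing to the complementary test. -/
theorem PMF.abs_toReal_sub_le {α : Type} {μ ν : PMF α} {δ : ENNReal} (hδ : δ ≠ ⊤)
    (h : ∀ φ : α → ENNReal, (∀ a, φ a ≤ 1) → μ.expect φ ≤ ν.expect φ + δ) (a : α) :
    |(μ a).toReal - (ν a).toReal| ≤ δ.toReal := by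
  classical
  have hle (μ ν : PMF α) (h : μ a ≤ ν a + δ) : (μ a).toReal - (ν a).toReal ≤ δ.toReal := by
    rw [sub_le_iff_le_add', ← ENNReal.toReal_add (PMF.apply_ne_top _ _) hδ]
    exact ENNReal.toReal_mono (ENNReal.add_ne_top.mpr ⟨PMF.apply_ne_top _ _, hδ⟩) h
  have h₁ : μ a ≤ ν a + δ := by
    have := h (fun b => if b = a then 1 else 0) fun b => by split_ifs <;> simp
    rwa [← PMF.apply_eq_expect, ← PMF.apply_eq_expect] at this
  have hsum (μ : PMF α) : μ a + (μ.expect fun b => if b = a then 0 else 1) = 1 := by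
    rw [PMF.apply_eq_expect, ← PMF.expect_add]
    refine (congrArg _ (funext fun b => ?_)).trans (μ.expect_const 1)
    split_ifs <;> simp
  have h₂ : ν a ≤ μ a + δ := by
    have h' := h (fun b => if b = a then 0 else 1) fun b => by split_ifs <;> simp
    have hne : (μ.expect fun b => if b = a then 0 else 1) ≠ ⊤ := fun htop => by
      simpa [htop] using hsum μ
    have hne' : (ν.expect fun b => if b = a then 0 else 1) ≠ ⊤ := fun htop => by
      simpa [htop] using hsum ν
    refine (ENNReal.add_le_add_iff_right hne').mp ?_
    rw [hsum ν]
    calc (1 : ENNReal) = μ a + μ.expect fun b => if b = a then 0 else 1 := (hsum μ).symm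
      _ ≤ μ a + ((ν.expect fun b => if b = a then 0 else 1) + δ) := by gcongr
      _ = _ := by ring
  exact abs_sub_le_iff.mpr ⟨hle μ ν h₁, hle ν μ h₂⟩

namespace DQOT

/-! ### Simulation of the receiver -/

theorem _root_.FeasibleFun.xor {ι : Type} {w : ι → ℕ} {X : ι → Type} {e : ∀ i, X i → List Bool}
    {b c : ∀ i, X i → Bool} (hb : FeasibleFun w e fun i x => [b i x])
    (hc : FeasibleFun w e fun i x => [c i x]) : FeasibleFun w e fun i x => [xor (b i x) (c i x)] :=
  (hb.ite (hc.map_not ⟨_, .const 1, fun _ _ => rfl⟩) hc (.const 1) (fun _ _ => rfl)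
    fun _ _ => rfl).congr fun i x => by cases b i x <;> simp

theorem _root_.FeasibleFun.receiverPower {𝒢 : GroupGen} {ι : Type} {κ : ι → ℕ} {X : ι → Type}
    {e : ∀ i, X i → List Bool} {ω : ∀ i, X i → Bits (𝒢.coinLen (κ i))}
    {g : ∀ i (x : X i), (𝒢.gen (κ i) (ω i x)).Carrier} {b : ∀ i, X i → Bool}
    {r₁ r₂ : ∀ i, X i → Fin (2 ^ 𝒢.ordLen (κ i))}
    (hpub : FeasibleFun κ e fun i x => (𝒢.gen (κ i) (ω i x)).pub)
    (hg : FeasibleFun κ e fun i x => str ((𝒢.gen (κ i) (ω i x)).enc (g i x)))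
    (hb : FeasibleFun κ e fun i x => [b i x])
    (hr₁ : FeasibleFun κ e fun i x => natBits (𝒢.ordLen (κ i)) (r₁ i x))
    (hr₂ : FeasibleFun κ e fun i x => natBits (𝒢.ordLen (κ i)) (r₂ i x)) :
    FeasibleFun κ e fun i x =>
      str ((𝒢.gen (κ i) (ω i x)).enc (receiverPower (g i x) (b i x) (r₁ i x) (r₂ i x))) :=
  (hb.ite_elem (hpub.div (hpub.pow hg hr₂) (hpub.pow hg hr₁))
    (hpub.mul (hpub.pow hg hr₂) (hpub.pow hg hr₁)))

variable {𝒢 : GroupGen} {σ : ℕ → ℕ}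

/-- What determines the simulated view of the receiver, apart from the answer of the oracle: `C` is
the public key, `y` is the exponent of the ciphertext that the receiver can open, and the other
ciphertext consists of the group element `B` and the string `u'`. -/
structure ReceiverData (𝒢 : GroupGen) (σ : ℕ → ℕ) (k : ℕ) where
  ω : Bits (𝒢.coinLen k)
  s : Bool
  ms : Bits (σ k)
  u' : Bits (σ k)
  s₁ : Bool
  r₁ : ℕ
  r₂ : ℕ
  y : ℕ
  C : (𝒢.gen k ω).Carrier
  B : (𝒢.gen k ω).Carrier

namespace ReceiverData

variable {k : ℕ} (d : ReceiverData 𝒢 σ k)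

/-- The query that the receiver makes in order to decrypt the chosen message. -/
def query : List Bool :=
  str ((𝒢.gen k d.ω).enc (receiverPower (𝒢.gen k d.ω).g (xor d.s₁ d.s) d.r₁ d.r₂ ^ d.y))

/-- The view of the receiver, where `u` is the string of the ciphertext that it can open. -/
def view (u : Bits (σ k)) : List Bool :=
  receiverView (𝒢.gen k d.ω) d.s d.s₁ d.r₁ d.r₂ d.C ((𝒢.gen k d.ω).g ^ d.y) d.B u d.u' d.ms

/-- The part of the view that precedes the string of the first ciphertext. -/
def front : List Bool :=
  [d.s, d.s₁, xor d.s₁ d.s] ++ natBits (𝒢.ordLen k) d.r₁ ++ natBits (𝒢.ordLen k) d.r₂ ++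
    (𝒢.gen k d.ω).pub ++ str ((𝒢.gen k d.ω).enc d.C) ++
    str ((𝒢.gen k d.ω).enc (if d.s then d.B else (𝒢.gen k d.ω).g ^ d.y))

/-- The group element of the second ciphertext. The order of the ciphertexts depends on `s`. -/
def middle : List Bool := str ((𝒢.gen k d.ω).enc (if d.s then (𝒢.gen k d.ω).g ^ d.y else d.B))

/-- The data as a string. It contains the query of the receiver and the constant parts of the view
in the form in which they are used. -/
def encode : List Bool := d.query ++ [d.s] ++ str d.ms ++ str d.u' ++ d.front ++ d.middle

/-- The length of `front`. -/
def frontLength (𝒢 : GroupGen) (k : ℕ) : ℕ :=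
  3 + 𝒢.ordLen k + 𝒢.ordLen k + (𝒢.descLen k + 𝒢.ordLen k + 𝒢.elemLen k) + 𝒢.elemLen k +
    𝒢.elemLen k

theorem length_front : d.front.length = frontLength 𝒢 k := by
  simp only [front, List.length_append, length_natBits, length_str, length_pub, frontLength]
  rfl

/-- The length of `encode`. -/
def encodeLength (𝒢 : GroupGen) (σ : ℕ → ℕ) (k : ℕ) : ℕ :=
  𝒢.elemLen k + 1 + σ k + σ k + frontLength 𝒢 k + 𝒢.elemLen k

theorem length_encode : d.encode.length = encodeLength 𝒢 σ k := by
  simp only [encode, List.length_append, length_front, query, middle, length_str, encodeLength]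
  rfl

theorem frontLength_poly (𝒢 : GroupGen) {ι : Type} (κ : ι → ℕ) :
    PolyIn κ fun i => frontLength 𝒢 (κ i) := by
  have he := 𝒢.elemLen_poly.polyIn κ
  have ho := 𝒢.ordLen_poly.polyIn κ
  exact (((((PolyIn.const 3).add ho).add ho).add
    (((𝒢.descLen_poly.polyIn κ).add ho).add he)).add he).add he

theorem encodeLength_poly (𝒢 : GroupGen) (hσ : PolyBounded σ) {ι : Type} (κ : ι → ℕ) :
    PolyIn κ fun i => encodeLength 𝒢 σ (κ i) := by
  have he := 𝒢.elemLen_poly.polyIn κ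
  have hs := hσ.polyIn κ
  exact ((((he.add (.const 1)).add hs).add hs).add (frontLength_poly 𝒢 κ)).add he

theorem view_eq (u : Bits (σ k)) :
    d.view u = d.front ++ (if d.s then str d.u' else str u) ++ d.middle ++
      (if d.s then str u else str d.u') ++ str d.ms := by
  simp only [view, receiverView, front, middle]

theorem feasible_encode {ι : Type} {κ : ι → ℕ} {X : ι → Type}
    {e : ∀ i, X i → List Bool} (d : ∀ i, X i → ReceiverData 𝒢 σ (κ i))
    (hω : FeasibleFun κ e fun i x => (𝒢.gen (κ i) (d i x).ω).pub)
    (hs : FeasibleFun κ e fun i x => [(d i x).s])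
    (hms : FeasibleFun κ e fun i x => str (d i x).ms)
    (hu' : FeasibleFun κ e fun i x => str (d i x).u')
    (hs₁ : FeasibleFun κ e fun i x => [(d i x).s₁])
    (hr₁ : FeasibleFun κ e fun i x => natBits (𝒢.ordLen (κ i)) (d i x).r₁)
    (hr₂ : FeasibleFun κ e fun i x => natBits (𝒢.ordLen (κ i)) (d i x).r₂)
    (hy : FeasibleFun κ e fun i x => natBits (𝒢.ordLen (κ i)) (d i x).y)
    (hC : FeasibleFun κ e fun i x => str ((𝒢.gen (κ i) (d i x).ω).enc (d i x).C))
    (hB : FeasibleFun κ e fun i x => str ((𝒢.gen (κ i) (d i x).ω).enc (d i x).B))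
    (lr₁ : ∀ i x, (d i x).r₁ < 2 ^ 𝒢.ordLen (κ i)) (lr₂ : ∀ i x, (d i x).r₂ < 2 ^ 𝒢.ordLen (κ i))
    (ly : ∀ i x, (d i x).y < 2 ^ 𝒢.ordLen (κ i)) :
    FeasibleFun κ e fun i x => (d i x).encode := by
  have hpub := hω
  have hs₂ := hs₁.xor hs
  have hy' := hpub.pow hpub.gen (N := fun i x => ⟨_, ly i x⟩) hy
  have hq := hpub.pow (hpub.receiverPower hpub.gen hs₂ (r₁ := fun i x => ⟨_, lr₁ i x⟩)
    (r₂ := fun i x => ⟨_, lr₂ i x⟩) hr₁ hr₂) (N := fun i x => ⟨_, ly i x⟩) hy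
  have hfront := ((((((hs.append hs₁).append hs₂).append hr₁).append hr₂).append hpub).append
    hC).append (hs.ite_elem hB hy')
  exact (((((hq.append hs).append hms).append hu').append hfront).append
    (hs.ite_elem hy' hB)).congr fun i x => by
      simp [encode, query, front, middle]

/-- The circuit that makes the query of the receiver and assembles the view. -/
theorem exists_main (𝒢 : GroupGen) (hσ : PolyBounded σ) : ∃ M : ℕ → Circ, PolySize M ∧
    ∀ k (d : ReceiverData 𝒢 σ k), ((M k).run d.encode : Rom (σ k) _) =
      hash d.query >>= fun h => pure (d.view (bxor h d.ms)) := by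
  have hσ' : PolyIn id σ := hσ
  let e : ∀ k, ReceiverData 𝒢 σ k × Bits (σ k) → List Bool := fun k p => p.1.encode ++ str p.2
  have he : FixedLength id (X := fun k => ReceiverData 𝒢 σ k) fun _ d => d.encode :=
    ⟨_, encodeLength_poly 𝒢 hσ id, fun k d => d.length_encode⟩
  have hh : FeasibleFun id e fun _ p => str p.2 :=
    FeasibleFun.snd (Y := fun k => Bits (σ k)) he (fixedLength_str hσ')
  have hs : FeasibleFun id e fun _ p => [p.1.s] :=
    .slice ⟨_, .const 1, fun _ _ => rfl⟩ 𝒢.elemLen fun k p => ⟨p.1.query, _, by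
      simp only [e, encode, List.append_assoc]; rfl, length_str _⟩
  have hms : FeasibleFun id e fun _ p => str p.1.ms :=
    .slice ⟨_, hσ', fun _ _ => length_str _⟩ (fun k => 𝒢.elemLen k + 1) fun k p =>
      ⟨p.1.query ++ [p.1.s], _, by simp only [e, encode, List.append_assoc]; rfl,
        by simp [query, length_str]⟩
  have hu' : FeasibleFun id e fun _ p => str p.1.u' :=
    .slice ⟨_, hσ', fun _ _ => length_str _⟩ (fun k => 𝒢.elemLen k + 1 + σ k) fun k p =>
      ⟨p.1.query ++ [p.1.s] ++ str p.1.ms, _, by simp only [e, encode, List.append_assoc]; rfl,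
        by simp [query, length_str]; omega⟩
  have hfront : FeasibleFun id e fun _ p => p.1.front :=
    .slice ⟨_, frontLength_poly 𝒢 id, fun _ p => p.1.length_front⟩
      (fun k => 𝒢.elemLen k + 1 + σ k + σ k) fun k p =>
      ⟨p.1.query ++ [p.1.s] ++ str p.1.ms ++ str p.1.u', _, by
        simp only [e, encode, List.append_assoc]; rfl,
        by simp [query, length_str]; omega⟩
  have hmiddle : FeasibleFun id e fun _ p => p.1.middle :=
    .slice ⟨_, 𝒢.elemLen_poly.polyIn id, fun _ p => length_str _⟩
      (fun k => 𝒢.elemLen k + 1 + σ k + σ k + frontLength 𝒢 k) fun k p =>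
      ⟨p.1.query ++ [p.1.s] ++ str p.1.ms ++ str p.1.u' ++ p.1.front, _, by
        simp only [e, encode, List.append_assoc]; rfl,
        by simp [query, length_str, length_front]; omega⟩
  have hu := hh.str_bxor hσ' hms
  have hl (k) (x : Bits (σ k)) := length_str x
  obtain ⟨c, hc, h⟩ := ((((hfront.append (hs.ite hu' hu hσ' (fun _ _ => hl _ _)
    fun _ _ => hl _ _)).append hmiddle).append (hs.ite hu hu' hσ' (fun _ _ => hl _ _)
    fun _ _ => hl _ _)).append hms).congr fun k p => (p.1.view_eq _).symm
  refine ⟨fun k => .seq (.pair (.wires (List.range' 0 (encodeLength 𝒢 σ k)))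
    (.seq (.wires (List.range' 0 (𝒢.elemLen k))) .query)) (c k), ?_, fun k d => ?_⟩
  · refine PolyIn.mono (((encodeLength_poly 𝒢 hσ id).add (𝒢.elemLen_poly.polyIn id)).add
      (PolyIn.add hc (.const 10))) fun k => ?_
    simp only [Circ.size, List.length_range', id]
    omega
  · have e₁ : ((List.range' 0 (encodeLength 𝒢 σ k)).map fun j => d.encode.getD j false) =
        d.encode := by
      rw [map_getD_range' _ _ _ (by rw [d.length_encode, zero_add]), List.drop_zero,
        List.take_of_length_le d.length_encode.le]
    have e₂ : ((List.range' 0 (𝒢.elemLen k)).map fun j => d.encode.getD j false) = d.query := by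
      rw [map_getD_range' _ _ _ (by rw [d.length_encode, encodeLength]; omega), List.drop_zero]
      simp only [encode, List.append_assoc]
      exact List.take_left' (length_str _)
    simp only [Circ.run, LawfulMonad.pure_bind, bind_assoc, e₁, e₂]
    refine bind_congr fun y => ?_
    rw [(c k).run_eq_law (h k).1]
    exact (congrArg liftM ((h k).2 (d, y))).trans (Rom.lift_pure _)

end ReceiverData

end DQOT

/-! ### Searching the queries of a circuit -/

/-- If the oracle circuit `c` makes the query `q`, then `q` is found in the output of an oracle-free
circuit `c'`, at one of `c.size` positions that do not depend on the input: `c'` simulates `c` and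
outputs the table of its queries. -/
theorem Circ.exists_query_search : ∃ P : Polynomial ℕ, ∀ (n L : ℕ) (c : Circ),
    ∃ (c' : Circ) (off : ℕ → ℕ), c'.size ≤ P.eval (c.size + n + L) ∧ c'.OracleFree ∧
      ∀ x q : List Bool, x.length = L →
        (((c.run x : Rom n _).run fun _ => none).expect fun o => if o.2 q = none then 0 else 1) ≤
          ∑ i ∈ Finset.range c.size, (c'.law x).expect fun z =>
            if (List.range' (off i) q.length).map (fun j => z.getD j false) = q then 1 else 0 := by
  obtain ⟨P, hP⟩ := exists_simulation
  let w : ℕ × ℕ × ℕ → ℕ := fun i => i.1 + i.2.1 + i.2.2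
  have hs : PolyIn w fun i => i.1 := PolyIn.weight.mono fun i => by simp only [w]; omega
  have hn : PolyIn w fun i => i.2.1 := PolyIn.weight.mono fun i => by simp only [w]; omega
  have hL : PolyIn w fun i => i.2.2 := PolyIn.weight.mono fun i => by simp only [w]; omega
  have hV := ((hn.add hn).add hL).add (hs.mul (hn.add (.const 1)))
  obtain ⟨Q, hQ⟩ := hs.mul (PolyIn.trans ⟨P, fun _ => le_rfl⟩
    (hV.add (hs.mul (hV.add (.const 1)))))
  refine ⟨Q, fun n L c => ?_⟩
  obtain ⟨c', hsize, hfree, hlaw⟩ := hP n (n + n + L + c.size * (n + 1))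
    (c.size * (n + n + L + c.size * (n + 1) + 1)) c L [] (by omega) (by omega)
    (by simp [Table.width])
  refine ⟨c', fun i => c.outLength n L + Table.width n ((c.queryLengths n L).take i),
    hsize.trans (hQ (c.size, n, L)), hfree, fun x q hx => ?_⟩
  have hlaw' : c'.law x = (c.runTable x []).map
      fun (p : List Bool × Table n) => p.1 ++ p.2.encode := by
    simpa [Table.encode] using hlaw x [] hx rfl
  have hrun : ((c.run x : Rom n _).run fun _ => none) =
      (c.runTable x []).map fun p => (p.1, p.2.oracle) := c.run_oracle x []
  rw [hrun, PMF.expect_map]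
  simp only [hlaw', PMF.expect_map]
  refine (PMF.expect_mono fun p hp => ?_).trans (PMF.expect_sum _ _ _).le
  obtain ⟨h₁, h₂⟩ := Circ.lengths_of_mem_support hp
  rw [hx] at h₁ h₂
  split_ifs with h
  · exact zero_le
  · obtain ⟨y, hy⟩ := Option.ne_none_iff_exists'.mp h
    obtain ⟨s, t, hst, -⟩ := List.lookup_eq_some_iff.mp hy
    have hshape : Table.shape s = (c.queryLengths n L).take s.length := by
      rw [show c.queryLengths n L = p.2.shape from h₂.symm, hst]
      simp [Table.shape]
    have hi : s.length < c.size := by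
      refine lt_of_lt_of_le ?_ (c.length_queryLengths_le (n := n) L)
      rw [show c.queryLengths n L = p.2.shape from h₂.symm, hst]
      simp [Table.shape]
    refine le_trans ?_ (Finset.single_le_sum (fun _ _ => zero_le) (Finset.mem_range.mpr hi))
    rw [if_pos]
    have hz : p.1 ++ p.2.encode = (p.1 ++ Table.encode s) ++ q ++ (str y ++ Table.encode t) := by
      rw [hst]
      simp [Table.encode]
    have hlen : (p.1 ++ Table.encode s).length =
        c.outLength n L + Table.width n ((c.queryLengths n L).take s.length) := by
      rw [List.length_append, h₁, Table.length_encode, hshape]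
    rw [← hlen, hz, map_getD_range' _ _ _ (by simp; omega), List.append_assoc, List.drop_left,
      List.take_left]

/-! ### Hiding the message that is not chosen -/

/-- The variant of `Rom.expect_uniform_le` in which a computation `X` precedes the query. -/
theorem Rom.expect_uniform_bind_le {n : ℕ} {α β : Type} (X : Rom n β) {K : β → Bits n → Rom n α}
    (hK : ∀ b y, IsOracleComp (K b y)) (q : List Bool) (t : List Bool → Option (Bits n))
    {φ : α → ENNReal} (hφ : ∀ a, φ a ≤ 1) :
    ((PMF.uniformOfFintype (Bits n)).expect fun y =>
        ((X >>= fun b => K b y).run t).expect fun o => φ o.1) ≤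
      ((X >>= fun b => hash q >>= K b).run t).expect (fun o => φ o.1) +
        (PMF.uniformOfFintype (Bits n)).expect fun y =>
          ((X >>= fun b => K b y).run t).expect fun o => if o.2 q = none then 0 else 1 := by
  simp only [← PMF.expect_bind, run_bind_eq]
  rw [PMF.bind_comm, PMF.expect_bind, PMF.expect_bind, PMF.expect_bind, ← PMF.expect_add]
  exact PMF.expect_mono fun p _ => expect_uniform_le (hK p.1) q p.2 hφ

namespace DQOT

variable {𝒢 : GroupGen} {σ : ℕ → ℕ} {k : ℕ}

namespace ReceiverData

variable (d : ReceiverData 𝒢 σ k)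

/-- The power of `B` with the receiver's own exponent. If `B = g ^ y'`, this is `X ^ y'` for the
component `X` of the combined query that the receiver knows the exponent of, so that the product of
`ownPower` with the element `(C / X) ^ y'`, which hides the other message, is `C ^ y'`. -/
def ownPower : (𝒢.gen k d.ω).Carrier := receiverPower d.B (xor d.s₁ d.s) d.r₁ d.r₂

/-- The query that hides the other message, if `y'` is the exponent of its ciphertext. -/
def otherQuery (y' : ℕ) : List Bool :=
  str ((𝒢.gen k d.ω).enc
    ((d.C / receiverPower (𝒢.gen k d.ω).g (xor d.s₁ d.s) d.r₁ d.r₂) ^ y'))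

/-- The data with another string `u'`. -/
def setPad (u : Bits (σ k)) : ReceiverData 𝒢 σ k := { d with u' := u }

end ReceiverData

/-- The law of the simulated data for given `C` and `B`: the remaining coins are chosen as in the
protocol, and the encryption `u'` of the other message is replaced by a uniform string. -/
def sampleData (ω : Bits (𝒢.coinLen k)) (s : Bool) (ms : Bits (σ k))
    (C B : (𝒢.gen k ω).Carrier) : PMF (ReceiverData 𝒢 σ k) :=
  (PMF.uniformOfFintype Bool).bind fun s₁ => (below (𝒢.gen k ω).p).bind fun r₁ =>
    (below (𝒢.gen k ω).p).bind fun r₂ => (below (𝒢.gen k ω).p).bind fun y =>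
    (PMF.uniformOfFintype (Bits (σ k))).bind fun u' =>
    PMF.pure ⟨ω, s, ms, u', s₁, r₁, r₂, y, C, B⟩

/-- The real view of the receiver on the coins in `d`: the other message `m'` is encrypted by the
oracle, and `d.u'` is ignored. -/
def realView (d : ReceiverData 𝒢 σ k) (y' : ℕ) (m' : Bits (σ k)) : Rom (σ k) (List Bool) := do
  let h ← hash d.query
  let h' ← hash (d.otherQuery y')
  pure ((d.setPad (bxor h' m')).view (bxor h d.ms))

/-- The simulated view of the receiver: `d.u'` stands for the encryption of the other message. -/
def simView (d : ReceiverData 𝒢 σ k) : Rom (σ k) (List Bool) := do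
  let h ← hash d.query
  pure (d.view (bxor h d.ms))

/-- A one-time pad. -/
theorem expect_uniform_bxor {n : ℕ} (m : Bits n) (φ : Bits n → ENNReal) :
    ((PMF.uniformOfFintype (Bits n)).expect fun y => φ (bxor y m)) =
      (PMF.uniformOfFintype (Bits n)).expect φ := by
  have hinv : Function.Involutive fun y : Bits n => bxor y m := fun y => by
    funext i
    simp [bxor]
  conv_rhs => rw [← map_uniformOfFintype_equiv hinv.toPerm, PMF.expect_map]
  rfl

/-- The distinguisher notices the replacement of the encryption of the other message by a uniform
string only by making the query that hides it. -/
theorem expect_sampleData_le (D : Circ) (ω : Bits (𝒢.coinLen k)) (s : Bool) (ms m' : Bits (σ k))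
    (C B : (𝒢.gen k ω).Carrier) (y' : ℕ) {φ : List Bool → ENNReal} (hφ : ∀ a, φ a ≤ 1) :
    ((sampleData ω s ms C B).expect fun d =>
        (simView d >>= fun v => D.run v).dist.expect φ) ≤
      ((sampleData ω s ms C B).expect fun d =>
        (realView d y' m' >>= fun v => D.run v).dist.expect φ) +
      (sampleData ω s ms C B).expect fun d =>
        ((simView d >>= fun v => D.run v).run fun _ => none).expect fun o =>
          if o.2 (d.otherQuery y') = none then 0 else 1 := by
  unfold sampleData
  simp only [PMF.expect_bind, PMF.expect_pure]
  rw [← PMF.expect_add]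
  refine PMF.expect_mono fun s₁ _ => ?_
  rw [← PMF.expect_add]
  refine PMF.expect_mono fun r₁ _ => ?_
  rw [← PMF.expect_add]
  refine PMF.expect_mono fun r₂ _ => ?_
  rw [← PMF.expect_add]
  refine PMF.expect_mono fun y _ => ?_
  -- the component `u'` of `d` does not matter here
  let d : ReceiverData 𝒢 σ k := ⟨ω, s, ms, m', s₁, r₁, r₂, y, C, B⟩
  have h := Rom.expect_uniform_bind_le (hash d.query)
    (K := fun h u => D.run ((d.setPad (bxor u m')).view (bxor h d.ms)))
    (fun _ _ => Circ.isOracleComp_run _ _) (d.otherQuery y') (fun _ => none) hφ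
  rw [expect_uniform_bxor m' fun u => PMF.expect (StateT.run (hash d.query >>= fun h =>
      D.run ((d.setPad u).view (bxor h d.ms))) fun _ => none) fun o => φ o.1,
    expect_uniform_bxor m' fun u => PMF.expect (StateT.run (hash d.query >>= fun h =>
      D.run ((d.setPad u).view (bxor h d.ms))) fun _ => none) fun o =>
        if o.2 (d.otherQuery y') = none then 0 else 1] at h
  simp only [simView, realView, bind_assoc, LawfulMonad.pure_bind, Rom.dist, PMF.expect_map]
  refine h.trans (le_of_eq ?_)
  congr 1
  exact (PMF.expect_const _ _).symm

/-- The law of the real view of the receiver. -/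
theorem receiver_view_dist (D : Circ) (k : ℕ) (m : Bool → Bits (σ k)) (s : Bool) :
    ((protocol 𝒢 σ k m s >>= fun e => pure (e.view .R)) >>= fun v => D.run v).dist =
      (𝒢.coins k).bind fun ω => (below (𝒢.gen k ω).p).bind fun a =>
        (below (𝒢.gen k ω).p).bind fun y' =>
          (sampleData ω s (m s) ((𝒢.gen k ω).g ^ a) ((𝒢.gen k ω).g ^ y')).bind fun d =>
            (realView d y' (m !s) >>= fun v => D.run v).dist := by
  simp only [bind_assoc, LawfulMonad.pure_bind]
  rw [protocol_bind_dist]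
  unfold coinsLaw sampleData
  congr 1
  funext ω
  congr 1
  funext a
  simp only [PMF.bind_bind, PMF.pure_bind, realView, bind_assoc, LawfulMonad.pure_bind]
  refine Eq.trans ?_ (PMF.bind_comm _ _ _)
  congr 1
  funext s₁
  refine Eq.trans ?_ (PMF.bind_comm _ _ _)
  congr 1
  funext r₁
  refine Eq.trans ?_ (PMF.bind_comm _ _ _)
  congr 1
  funext r₂
  refine Eq.trans ?_ (PMF.bind_comm _ _ _)
  congr 1
  funext y
  congr 1
  funext y'
  exact (PMF.bind_const _ _).symm

/-- The output also contains `ownPower`, which only the reduction to CDH uses. -/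
theorem feasible_sampleData (hσ : PolyBounded σ) {ι : Type} {κ : ι → ℕ} {X : ι → Type}
    {e : ∀ i, X i → List Bool} {ω : ∀ i, X i → Bits (𝒢.coinLen (κ i))} {s : ∀ i, X i → Bool}
    {ms : ∀ i, X i → Bits (σ (κ i))} {C B : ∀ i (x : X i), (𝒢.gen (κ i) (ω i x)).Carrier}
    (he : FixedLength κ e) (hpub : FeasibleFun κ e fun i x => (𝒢.gen (κ i) (ω i x)).pub)
    (hs : FeasibleFun κ e fun i x => [s i x]) (hms : FeasibleFun κ e fun i x => str (ms i x))
    (hC : FeasibleFun κ e fun i x => str ((𝒢.gen (κ i) (ω i x)).enc (C i x)))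
    (hB : FeasibleFun κ e fun i x => str ((𝒢.gen (κ i) (ω i x)).enc (B i x))) :
    Feasible κ e fun i x => (sampleData (ω i x) (s i x) (ms i x) (C i x) (B i x)).map fun d =>
      d.encode ++ str ((𝒢.gen (κ i) d.ω).enc d.ownPower) := by
  unfold sampleData
  simp only [PMF.map_bind, PMF.pure_map]
  refine Feasible.bind (Y := fun _ => Bool) (enc := fun _ b => [b]) he .coin ?_
  have hs₁ := FeasibleFun.snd he fixedLength_bit
  replace hpub := hpub.fst (enc := fun _ (b : Bool) => [b]) he
  replace hs := hs.fst (enc := fun _ (b : Bool) => [b]) he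
  replace hms := hms.fst (enc := fun _ (b : Bool) => [b]) he
  replace hC := hC.fst (enc := fun _ (b : Bool) => [b]) he
  replace hB := hB.fst (enc := fun _ (b : Bool) => [b]) he
  replace he := he.append fixedLength_bit
  refine Feasible.bind_below (ω := fun i x => ω i x.1) he hpub ?_
  have hr₁ := FeasibleFun.snd he (fixedLength_exponent 𝒢)
  replace hpub := hpub.extend 𝒢 he
  replace hs := hs.extend 𝒢 he
  replace hms := hms.extend 𝒢 he
  replace hC := hC.extend 𝒢 he
  replace hB := hB.extend 𝒢 he
  replace hs₁ := hs₁.extend 𝒢 he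
  replace he := he.append (fixedLength_exponent 𝒢)
  refine Feasible.bind_below (ω := fun i x => ω i x.1.1) he hpub ?_
  have hr₂ := FeasibleFun.snd he (fixedLength_exponent 𝒢)
  replace hpub := hpub.extend 𝒢 he
  replace hs := hs.extend 𝒢 he
  replace hms := hms.extend 𝒢 he
  replace hC := hC.extend 𝒢 he
  replace hB := hB.extend 𝒢 he
  replace hs₁ := hs₁.extend 𝒢 he
  replace hr₁ := hr₁.extend 𝒢 he
  replace he := he.append (fixedLength_exponent 𝒢)
  refine Feasible.bind_below (ω := fun i x => ω i x.1.1.1) he hpub ?_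
  have hy := FeasibleFun.snd he (fixedLength_exponent 𝒢)
  replace hpub := hpub.extend 𝒢 he
  replace hs := hs.extend 𝒢 he
  replace hms := hms.extend 𝒢 he
  replace hC := hC.extend 𝒢 he
  replace hB := hB.extend 𝒢 he
  replace hs₁ := hs₁.extend 𝒢 he
  replace hr₁ := hr₁.extend 𝒢 he
  replace hr₂ := hr₂.extend 𝒢 he
  replace he := he.append (fixedLength_exponent 𝒢)
  refine Feasible.bind (Y := fun i => Bits (σ (κ i))) (enc := fun _ u => str u) he
    (.bits (hσ.polyIn κ)) ?_
  have hu' := FeasibleFun.snd he (fixedLength_str (hσ.polyIn κ))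
  replace hpub := hpub.fst (enc := fun i (u : Bits (σ (κ i))) => str u) he
  replace hs := hs.fst (enc := fun i (u : Bits (σ (κ i))) => str u) he
  replace hms := hms.fst (enc := fun i (u : Bits (σ (κ i))) => str u) he
  replace hC := hC.fst (enc := fun i (u : Bits (σ (κ i))) => str u) he
  replace hB := hB.fst (enc := fun i (u : Bits (σ (κ i))) => str u) he
  replace hs₁ := hs₁.fst (enc := fun i (u : Bits (σ (κ i))) => str u) he
  replace hr₁ := hr₁.fst (enc := fun i (u : Bits (σ (κ i))) => str u) he
  replace hr₂ := hr₂.fst (enc := fun i (u : Bits (σ (κ i))) => str u) he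
  replace hy := hy.fst (enc := fun i (u : Bits (σ (κ i))) => str u) he
  have henc := ReceiverData.feasible_encode (σ := σ) (fun i
    (z : ((((X i × Bool) × Fin (2 ^ 𝒢.ordLen (κ i))) × Fin (2 ^ 𝒢.ordLen (κ i))) ×
      Fin (2 ^ 𝒢.ordLen (κ i))) × Bits (σ (κ i))) => ⟨ω i z.1.1.1.1.1, s i z.1.1.1.1.1,
    ms i z.1.1.1.1.1, z.2, z.1.1.1.1.2, z.1.1.1.2, z.1.1.2, z.1.2, C i z.1.1.1.1.1,
    B i z.1.1.1.1.1⟩) hpub hs hms hu' hs₁ hr₁ hr₂ hy hC hB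
    (fun _ z => z.1.1.1.2.2) (fun _ z => z.1.1.2.2) fun _ z => z.1.2.2
  exact henc.append (hpub.receiverPower hB (hs₁.xor hs) hr₁ hr₂)

/-- The first part of the simulator of the receiver, which samples the data without the oracle. -/
theorem feasible_receiver (hσ : PolyBounded σ) :
    Feasible id (X := fun k => (Bool → Bits (σ k)) × Bool)
      (fun _ x => partyInput x.1 x.2 .R ++ dqotFunctionality x.1 x.2 .R) fun k x =>
      (𝒢.coins k).bind fun ω => (below (𝒢.gen k ω).p).bind fun a =>
        (below (𝒢.gen k ω).p).bind fun y' =>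
          (sampleData ω x.2 (x.1 x.2) ((𝒢.gen k ω).g ^ a) ((𝒢.gen k ω).g ^ y')).map
            ReceiverData.encode := by
  have hcoin : PolyIn id 𝒢.coinLen := 𝒢.coinLen_poly
  have he : FixedLength id (X := fun k => (Bool → Bits (σ k)) × Bool)
      (fun _ x => partyInput x.1 x.2 .R ++ dqotFunctionality x.1 x.2 .R) :=
    ⟨_, PolyIn.add (.const 1) (hσ.polyIn id), fun k x => by
      simp [partyInput, dqotFunctionality, length_str, Nat.add_comm]⟩
  have hs : FeasibleFun id (X := fun k => (Bool → Bits (σ k)) × Bool)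
      (fun _ x => partyInput x.1 x.2 .R ++ dqotFunctionality x.1 x.2 .R) fun _ x => [x.2] :=
    .slice ⟨_, .const 1, fun _ _ => rfl⟩ (fun _ => 0) fun k x => ⟨[], str (x.1 x.2), rfl, rfl⟩
  have hms : FeasibleFun id (X := fun k => (Bool → Bits (σ k)) × Bool)
      (fun _ x => partyInput x.1 x.2 .R ++ dqotFunctionality x.1 x.2 .R)
      fun _ x => str (x.1 x.2) :=
    .slice ⟨_, hσ.polyIn id, fun _ _ => length_str _⟩ (fun _ => 1) fun k x =>
      ⟨[x.2], [], by simp [partyInput, dqotFunctionality], rfl⟩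
  refine Feasible.bind (Y := fun k => Bits (𝒢.coinLen k)) (enc := fun _ ω => str ω) he
    (.bits hcoin) ?_
  have hω := FeasibleFun.snd he (fixedLength_str hcoin)
  replace hs := hs.fst (enc := fun k (ω : Bits (𝒢.coinLen k)) => str ω) he
  replace hms := hms.fst (enc := fun k (ω : Bits (𝒢.coinLen k)) => str ω) he
  replace he := he.append (fixedLength_str hcoin)
  refine Feasible.bind_below (ω := fun _ x => x.2) he hω.pub ?_
  have ha := FeasibleFun.snd he (fixedLength_exponent 𝒢)
  replace hω := hω.extend 𝒢 he
  replace hs := hs.extend 𝒢 he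
  replace hms := hms.extend 𝒢 he
  replace he := he.append (fixedLength_exponent 𝒢)
  refine Feasible.bind_below (ω := fun _ x => x.1.2) he hω.pub ?_
  have hy' := FeasibleFun.snd he (fixedLength_exponent 𝒢)
  replace hω := hω.extend 𝒢 he
  replace ha := ha.extend 𝒢 he
  replace hs := hs.extend 𝒢 he
  replace hms := hms.extend 𝒢 he
  replace he := he.append (fixedLength_exponent 𝒢)
  have hpub := hω.pub
  have hread : FeasibleFun id (X := fun k => ReceiverData 𝒢 σ k)
      (fun k d => d.encode ++ str ((𝒢.gen k d.ω).enc d.ownPower)) fun _ d => d.encode :=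
    .slice ⟨_, ReceiverData.encodeLength_poly 𝒢 hσ id, fun k d => d.length_encode⟩ (fun _ => 0)
      fun k d => ⟨[], _, rfl, rfl⟩
  refine (Feasible.comp (Y := fun k => ReceiverData 𝒢 σ k)
    (G := fun _ d => PMF.pure d.encode) hread (feasible_sampleData hσ he hpub
    hs hms (hpub.pow hpub.gen ha) (hpub.pow hpub.gen hy'))).congr fun k x => ?_
  exact PMF.bind_pure_comp _ _

/-! ### The reduction to CDH -/

/-- An instance of the Diffie–Hellman problem: a group and the elements `g ^ a` and `g ^ b`. -/
abbrev CDHInput (𝒢 : GroupGen) (k : ℕ) : Type :=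
  Σ ω : Bits (𝒢.coinLen k), (𝒢.gen k ω).Carrier × (𝒢.gen k ω).Carrier

/-- The input of the adversary in the game `GroupGen.cdhGame`. -/
def CDHInput.encode (x : CDHInput 𝒢 k) : List Bool :=
  (𝒢.gen k x.1).pub ++ str ((𝒢.gen k x.1).enc x.2.1) ++ str ((𝒢.gen k x.1).enc x.2.2)

/-- The length of the input of a CDH adversary. -/
def cdhLength (𝒢 : GroupGen) (k : ℕ) : ℕ :=
  𝒢.descLen k + 𝒢.ordLen k + 𝒢.elemLen k + 𝒢.elemLen k + 𝒢.elemLen k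

theorem CDHInput.length_encode (x : CDHInput 𝒢 k) : x.encode.length = cdhLength 𝒢 k := by
  simp only [encode, cdhLength, List.length_append, length_pub, length_str]

/-- The output of the adversary on the input `x`, if `d` is the rest of the simulated data and `z`
the result of the search: the product of `ownPower` with what `z` contains at the position `a`. -/
def solution (M : Circ) (a : ℕ) (x : CDHInput 𝒢 k) (d : ReceiverData 𝒢 σ k) (z : List Bool) :
    List Bool :=
  M.eval ((𝒢.gen k x.1).pub ++ (List.range' a (𝒢.elemLen k)).map (fun j => z.getD j false) ++
    str ((𝒢.gen k d.ω).enc d.ownPower))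

theorem feasible_solution (hσ : PolyBounded σ) {c M : ℕ → Circ} (hc : PolySize c)
    (hfree : ∀ k, (c k).OracleFree) (hM : PolySize M) (hdet : ∀ k, (M k).IsDet)
    (off : ℕ → ℕ → ℕ) :
    Feasible (Sigma.fst : (Σ k, Bits (σ k) × Bool × ℕ) → ℕ) (X := fun i => CDHInput 𝒢 i.1)
      (fun _ x => x.encode) fun i x =>
      (sampleData x.1 i.2.2.1 i.2.1 x.2.1 x.2.2).bind fun d => ((c i.1).law d.encode).bind fun z =>
        PMF.pure (solution (M i.1) (off i.1 i.2.2.2) x d z) := by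
  let ι := Σ k, Bits (σ k) × Bool × ℕ
  let κ : ι → ℕ := Sigma.fst
  let X : ι → Type := fun i => CDHInput 𝒢 (κ i)
  let Y : ι → Type := fun i => ReceiverData 𝒢 σ (κ i)
  let e : ∀ i, X i → List Bool := fun i x => x.encode
  let enc : ∀ i, Y i → List Bool := fun i d =>
    d.encode ++ str ((𝒢.gen (κ i) d.ω).enc d.ownPower)
  have hel := 𝒢.elemLen_poly.polyIn κ
  have hpl := ((𝒢.descLen_poly.polyIn κ).add (𝒢.ordLen_poly.polyIn κ)).add hel
  have he : FixedLength κ e := ⟨_, (hpl.add hel).add hel, fun i x => x.length_encode⟩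
  have henc : FixedLength κ enc := ⟨_, (ReceiverData.encodeLength_poly 𝒢 hσ κ).add hel,
    fun i d => by simp only [enc, List.length_append, ReceiverData.length_encode, length_str]⟩
  have hpub : FeasibleFun κ e fun i x => (𝒢.gen (κ i) x.1).pub :=
    .slice ⟨_, hpl, fun _ _ => length_pub _⟩ (fun _ => 0) fun i x => ⟨[], _, by
      simp only [e, CDHInput.encode, List.append_assoc]; rfl, rfl⟩
  have hC : FeasibleFun κ e fun i x => str ((𝒢.gen (κ i) x.1).enc x.2.1) :=
    .slice ⟨_, hel, fun _ _ => length_str _⟩ _ fun i x =>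
      ⟨(𝒢.gen (κ i) x.1).pub, _, rfl, length_pub _⟩
  have hB : FeasibleFun κ e fun i x => str ((𝒢.gen (κ i) x.1).enc x.2.2) :=
    .slice ⟨_, hel, fun _ _ => length_str _⟩
      (fun i => 𝒢.descLen (κ i) + 𝒢.ordLen (κ i) + 𝒢.elemLen (κ i) + 𝒢.elemLen (κ i)) fun i x =>
      ⟨(𝒢.gen (κ i) x.1).pub ++ str ((𝒢.gen (κ i) x.1).enc x.2.1), [],
        (List.append_nil _).symm, by rw [List.length_append, length_pub, length_str]⟩
  have hs : FeasibleFun κ e fun i _ => [i.2.2.1] := .const _ (.const 1)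
  have hms : FeasibleFun κ e fun i _ => str i.2.1 := .const _ (by
    simpa only [length_str] using hσ.polyIn κ)
  let Z : ι → Type := fun i => X i × Y i
  let e' : ∀ i, Z i → List Bool := fun i p => e i p.1 ++ enc i p.2
  have he' : FixedLength κ e' := he.append henc
  have hslice : FeasibleFun κ (X := fun i => Z i × List Bool) (fun i p => e' i p.1 ++ p.2)
      fun i p => (List.range' (off i.1 i.2.2.2) (𝒢.elemLen i.1)).map fun j => p.2.getD j false := by
    obtain ⟨l, hl, h⟩ := he'
    refine (FeasibleFun.wires (fun i => List.range' (l i + off i.1 i.2.2.2) (𝒢.elemLen i.1))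
      (by simpa using hel)).congr fun i p => ?_
    rw [← List.map_add_range', List.map_map]
    refine List.map_congr_left fun j _ => ?_
    rw [Function.comp_apply, ← h i p.1, List.getD_append_right _ _ _ _ (Nat.le_add_right _ _),
      Nat.add_sub_cancel_left]
  have hown : FeasibleFun κ e' fun i p => str ((𝒢.gen (κ i) p.2.ω).enc p.2.ownPower) :=
    .slice ⟨_, hel, fun _ _ => length_str _⟩
      (fun i => cdhLength 𝒢 (κ i) + ReceiverData.encodeLength 𝒢 σ (κ i)) fun i p =>
      ⟨e i p.1 ++ p.2.encode, [], by simp only [e', enc, List.append_assoc, List.append_nil],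
        by rw [List.length_append, p.2.length_encode, p.1.length_encode]⟩
  have hread : FeasibleFun κ e' fun i p => p.2.encode :=
    .slice ⟨_, ReceiverData.encodeLength_poly 𝒢 hσ κ, fun i p => p.2.length_encode⟩
      (fun i => cdhLength 𝒢 (κ i)) fun i p =>
      ⟨e i p.1, _, by simp only [e', enc, List.append_assoc]; rfl, p.1.length_encode⟩
  have hpub' : FeasibleFun κ e' fun i p => (𝒢.gen (κ i) p.1.1).pub := hpub.fst he
  have hrun : Feasible κ e' fun i p => ((c i.1).law p.2.encode).map fun z => z := by
    refine Feasible.comp_fun (f := fun i (p : Z i) => p.2)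
      (e' := fun i d => d.encode) (G := fun i d => ((c i.1).law d.encode).map fun z => z)
      ⟨fun i => c i.1, PolyBounded.polyIn hc κ, fun i => ⟨hfree _, fun d => (PMF.map_id _).symm⟩⟩
      hread
  have hsolve : Feasible κ (X := fun i => Z i × List Bool) (fun i p => e' i p.1 ++ p.2)
      fun i p => PMF.pure (solution (M i.1) (off i.1 i.2.2.2) p.1.1 p.1.2 p.2) :=
    (((hpub'.fst (enc := fun _ z => z) he').append hslice).append
      (hown.fst (enc := fun _ z => z) he')).eval (fun i => M i.1) (PolyBounded.polyIn hM κ)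
      fun i => hdet i.1
  have hlast : Feasible κ e' fun i p => ((c i.1).law p.2.encode).bind fun z =>
      PMF.pure (solution (M i.1) (off i.1 i.2.2.2) p.1 p.2 z) :=
    Feasible.bind (enc := fun _ z => z) he' hrun hsolve
  exact Feasible.bind he (feasible_sampleData hσ he hpub hs hms hC hB) hlast

/-- The adversary chooses the rest of the simulated data, runs `c`, and computes its `solution` from
the output at the position `off k j`; it wins if that part of the output is the query that hides the
other message. The advice of the index consists of the inputs of the receiver and of `j`. -/
theorem exists_adversary (hσ : PolyBounded σ) {c : ℕ → Circ} (hc : PolySize c)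
    (hfree : ∀ k, (c k).OracleFree) (off : ℕ → ℕ → ℕ) :
    ∃ A : (Σ k, Bits (σ k) × Bool × ℕ) → Circ, PolyIn Sigma.fst (fun i => (A i).size) ∧
      ∀ i, (A i).OracleFree ∧
        ((𝒢.coins i.1).expect fun ω => (below (𝒢.gen i.1 ω).p).expect fun a =>
          (below (𝒢.gen i.1 ω).p).expect fun y' =>
            (sampleData ω i.2.2.1 i.2.1 ((𝒢.gen i.1 ω).g ^ a)
                ((𝒢.gen i.1 ω).g ^ y')).expect fun d =>
              ((c i.1).law d.encode).expect fun z =>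
                if (List.range' (off i.1 i.2.2.2) (𝒢.elemLen i.1)).map (fun j => z.getD j false) =
                  d.otherQuery y' then 1 else 0) ≤ 𝒢.cdhGame (A i) i.1 True := by
  obtain ⟨M, hM, hmul⟩ := 𝒢.mul_poly
  obtain ⟨A, hA, h⟩ := feasible_solution (𝒢 := 𝒢) hσ hc hfree hM (fun k => (hmul k).1) off
  refine ⟨A, hA, fun i => ⟨(h i).1, ?_⟩⟩
  obtain ⟨k, ms, s, j⟩ := i
  have hgame : 𝒢.cdhGame (A ⟨k, ms, s, j⟩) k = (𝒢.coins k).bind fun ω =>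
      (below (𝒢.gen k ω).p).bind fun a => (below (𝒢.gen k ω).p).bind fun b =>
        ((A ⟨k, ms, s, j⟩).law (CDHInput.encode (k := k)
          ⟨ω, (𝒢.gen k ω).g ^ a, (𝒢.gen k ω).g ^ b⟩)).bind
          fun out => PMF.pure (out = str ((𝒢.gen k ω).enc ((𝒢.gen k ω).g ^ (a * b)))) := by
    simp only [GroupGen.cdhGame, Circ.plain_eq_law _ (h ⟨k, ms, s, j⟩).1]
    rfl
  rw [hgame, PMF.apply_eq_expect]
  simp only [PMF.expect_bind, PMF.expect_pure]
  refine PMF.expect_mono fun ω _ => PMF.expect_mono fun a _ => PMF.expect_mono fun y' _ => ?_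
  rw [(h ⟨k, ms, s, j⟩).2 ⟨ω, (𝒢.gen k ω).g ^ a, (𝒢.gen k ω).g ^ y'⟩]
  simp only [sampleData, PMF.expect_bind, PMF.expect_pure]
  refine PMF.expect_mono fun s₁ _ => PMF.expect_mono fun r₁ _ => PMF.expect_mono fun r₂ _ =>
    PMF.expect_mono fun y _ => PMF.expect_mono fun u' _ => PMF.expect_mono fun z _ => ?_
  split_ifs with hz hz'
  · exact le_rfl
  · refine absurd (eq_true ?_) hz'
    rw [solution, hz]
    refine ((hmul k).2 ω _ _).trans (congrArg (fun x => str ((𝒢.gen k ω).enc x)) ?_)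
    simp only [ReceiverData.ownPower, receiverPower_pow]
    rw [← mul_pow, div_mul_cancel, pow_mul]
  · exact zero_le
  · exact le_rfl

/-! ### The view of the receiver -/

/-- The advantage of a distinguisher is at most the probability that it makes the query that hides
the other message, and hence at most the number of positions at which the query can be found times
the success probability of the adversary against CDH. -/
theorem exists_simulator_receiver (hσ : PolyBounded σ) (hCDH : 𝒢.CDHHard) :
    ∃ Sim : ℕ → Circ, PolySize Sim ∧
      CompIndist (fun k m s => (Sim k).run (partyInput m s .R ++ dqotFunctionality m s .R))
        (fun k m s => do
          let e ← protocol 𝒢 σ k m s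
          pure (e.view .R)) := by
  obtain ⟨S, hS, hlaw⟩ := feasible_receiver (𝒢 := 𝒢) hσ
  obtain ⟨M, hM, hrun⟩ := ReceiverData.exists_main 𝒢 hσ
  refine ⟨fun k => .seq (S k) (M k), PolyIn.add (PolyIn.add hS hM) (.const 1), fun D hD => ?_⟩
  -- the part of the simulation that makes queries, together with the distinguisher
  let c : ℕ → Circ := fun k => .seq (M k) (D k)
  have hc : PolyIn id fun k => (c k).size := (PolyIn.add hM hD).add (.const 1)
  obtain ⟨P, hP⟩ := Circ.exists_query_search
  choose c' off hsize hfree hsearch using fun k =>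
    hP (σ k) (ReceiverData.encodeLength 𝒢 σ k) (c k)
  have hc' : PolySize c' := PolyIn.mono (PolyIn.trans ⟨P, fun _ => le_rfl⟩
    ((hc.add (hσ.polyIn id)).add (ReceiverData.encodeLength_poly 𝒢 hσ id))) hsize
  obtain ⟨A, ⟨Q, hQ⟩, hA⟩ := exists_adversary (𝒢 := 𝒢) hσ hc' hfree off
  -- the adversary is nonuniform: it is given the inputs and the position with the best chances
  choose best hbest using fun k => Finite.exists_max
    fun j : Bits (σ k) × Bool × Fin ((c k).size + 1) =>
      𝒢.cdhGame (A ⟨k, j.1, j.2.1, j.2.2⟩) k True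
  have hneg := hCDH (fun k => A ⟨k, (best k).1, (best k).2.1, (best k).2.2⟩) (fun k => (hA _).1)
    ⟨Q, fun k => hQ _⟩
  obtain ⟨R, hR⟩ := hc
  refine ⟨_, hneg.polynomial_mul (R.map (Nat.castRingHom ℝ)), fun k m s => ?_⟩
  have hbad : ((𝒢.coins k).expect fun ω => (below (𝒢.gen k ω).p).expect fun a =>
      (below (𝒢.gen k ω).p).expect fun y' =>
        (sampleData ω s (m s) ((𝒢.gen k ω).g ^ a) ((𝒢.gen k ω).g ^ y')).expect fun d =>
          ((simView d >>= fun v => (D k).run v).run fun _ => none).expect fun o =>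
            if o.2 (d.otherQuery y') = none then 0 else 1) ≤
      (c k).size * 𝒢.cdhGame (A ⟨k, (best k).1, (best k).2.1, (best k).2.2⟩) k True := by
    have hd (d : ReceiverData 𝒢 σ k) (y' : ℕ) :
        (((simView d >>= fun v => (D k).run v).run fun _ => none).expect fun o =>
          if o.2 (d.otherQuery y') = none then 0 else 1) ≤
        ∑ j ∈ Finset.range (c k).size, ((c' k).law d.encode).expect fun z =>
          if (List.range' (off k j) (𝒢.elemLen k)).map (fun j => z.getD j false) =
            d.otherQuery y' then 1 else 0 := by
      have h := hsearch k d.encode (d.otherQuery y') d.length_encode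
      rw [show ((c k).run d.encode : Rom (σ k) _) = simView d >>= fun v => (D k).run v by
        simp only [c, Circ.run, hrun]; rfl] at h
      rwa [show (d.otherQuery y').length = 𝒢.elemLen k from length_str _] at h
    refine (PMF.expect_mono fun ω _ => PMF.expect_mono fun a _ => PMF.expect_mono fun y' _ =>
      PMF.expect_mono fun d _ => hd d y').trans ?_
    simp only [PMF.expect_sum]
    refine (Finset.sum_le_card_nsmul _ _ _ fun j hj => ?_).trans (by
      rw [Finset.card_range, nsmul_eq_mul])
    exact ((hA ⟨k, m s, s, j⟩).2).trans
      (hbest k (m s, s, ⟨j, (Finset.mem_range.mp hj).trans (Nat.lt_succ_self _)⟩))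
  have hsim : (((Circ.seq (S k) (M k)).run (partyInput m s .R ++ dqotFunctionality m s .R) :
      Rom (σ k) _) >>= fun v => (D k).run v).dist =
      (𝒢.coins k).bind fun ω => (below (𝒢.gen k ω).p).bind fun a =>
        (below (𝒢.gen k ω).p).bind fun y' =>
          (sampleData ω s (m s) ((𝒢.gen k ω).g ^ a) ((𝒢.gen k ω).g ^ y')).bind fun d =>
            (simView d >>= fun v => (D k).run v).dist := by
    rw [Circ.run, (S k).run_eq_law (hlaw k).1, bind_assoc, Rom.dist_lift_bind,
      (hlaw k).2 (m, s)]
    simp only [PMF.bind_bind, PMF.bind_map]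
    congr 1
    funext ω
    congr 1
    funext a
    congr 1
    funext y'
    congr 1
    funext d
    rw [Function.comp_apply, hrun]
    rfl
  have htop : ((c k).size : ENNReal) *
      𝒢.cdhGame (A ⟨k, (best k).1, (best k).2.1, (best k).2.2⟩) k True ≠ ⊤ :=
    ENNReal.mul_ne_top (ENNReal.natCast_ne_top _) (PMF.apply_ne_top _ _)
  refine (PMF.abs_toReal_sub_le htop (fun φ hφ => ?_) _).trans ?_
  · rw [hsim, receiver_view_dist]
    refine le_trans ?_ (add_le_add_right hbad _)
    simp only [PMF.expect_bind]
    rw [← PMF.expect_add]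
    refine PMF.expect_mono fun ω _ => ?_
    rw [← PMF.expect_add]
    refine PMF.expect_mono fun a _ => ?_
    rw [← PMF.expect_add]
    exact PMF.expect_mono fun y' _ => expect_sampleData_le _ _ _ _ _ _ _ _ hφ
  · rw [ENNReal.toReal_mul, ENNReal.toReal_natCast, Polynomial.eval_natCast_map]
    exact mul_le_mul_of_nonneg_right (Nat.cast_le.mpr (hR k)) ENNReal.toReal_nonneg

end DQOT

/-- If the DL and the CDH assumption hold for the group generator `𝒢`, then DQ-OT over `𝒢` securely
computes delegated-query 1-out-of-2 OT on messages of `σ k` bits in the random-oracle model, in the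
presence of a semi-honest adversary that corrupts one of the four parties. -/
theorem theorem1 (𝒢 : GroupGen) (σ : ℕ → ℕ) (hσ : PolyBounded σ)
    (hDL : 𝒢.DLHard) (hCDH : 𝒢.CDHHard) :
    SecurelyComputesDQOT (DQOT.protocol 𝒢 σ) := by
  refine ⟨fun k m s e he P => DQOT.output_eq he P, fun P => ?_⟩
  cases P with
  | S => exact DQOT.exists_simulator_sender hσ
  | P1 => exact DQOT.exists_simulator_helper₁
  | P2 => exact DQOT.exists_simulator_helper₂
  | R => exact DQOT.exists_simulator_receiver hσ hCDH

end
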